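/- Let $\Omega\subset\mathbb R^3$ be a bounded open set, $T>0$, $Q_T=\Omega\times(0,T)$, $\nu_1>0$, $\nu_1+\nu_2\ge 0$, and $\mathbb S(\mathbf u)=\nu_1(\nabla\mathbf u+\nabla\mathbf u^\top)+\nu_2\,\mathrm{div}\,\mathbf u\,\mathbb I$. Let $E,C_f$ be real constants and let $\lambda\in C_0^\infty(\mathbb R^4)$ be a nonnegative cut-off function with $\mathrm{supp}\,\lambda\subset Q_T$. Then for every $\mu\in(0,2/3)$ there is a constant $c>0$, depending only on $\Omega,T,\nu_1,\nu_2,E,C_f,\lambda,\mu$, such that the following holds for all $m>1$, all $\varepsilon>0$ and all $\mathbf f$ with $\|\mathbf f\|_{L^\infty(Q_T)}\le C_f$. Let $\varrho_\varepsilon\ge 0$ and $\mathbf u_\varepsilon$ be measurable on $Q_T$ and satisfy the energy estimates $$\|\varrho_\varepsilon^{3/2}(1+\varepsilon\varrho_\varepsilon^m)\|_{L^\infty(0,T;L^1(\Omega))}\le E,\quad \|\varrho_\varepsilon|\mathbf u_\varepsilon|^2\|_{L^\infty(0,T;L^1(\Omega))}\le E,\quad \|\mathbf u_\varepsilon\|_{L^2(0,T;W^{1,2}(\Omega))}\le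 E ,$$ and let them be a weak solution of the compressible Navier–Stokes equations with pressure $p(\varrho)=\varrho^{3/2}(1+\varepsilon\varrho^m)$, that is, $$\int_{Q_T}\Big(\varrho_\varepsilon\mathbf u_\varepsilon\cdot\partial_t\boldsymbol\xi+\big(\varrho_\varepsilon\mathbf u_\varepsilon\otimes\mathbf u_\varepsilon+p(\varrho_\varepsilon)\mathbb I-\mathbb S(\mathbf u_\varepsilon)\big):\nabla\boldsymbol\xi+\varrho_\varepsilon\mathbf f\cdot\boldsymbol\xi\Big)dx\,dt=0,\qquad \int_{Q_T}\big(\varrho_\varepsilon\partial_t\psi+\varrho_\varepsilon\mathbf u_\varepsilon\cdot\nabla\psi\big)dx\,dt=0$$ for all vector fields $\boldsymbol\xi\in C_0^\infty(Q_T)$ and functions $\psi\in C_0^\infty(Q_T)$. Put $\rho=\lambda^4\varrho_\varepsilon$, extended by zero to $\mathbb R^4=\mathbb R^3\times\mathbb R$, and $$\Psi^{(q)}_\mu(x,t)=\int_{\mathbb R^3}\frac{(1+|\ln|x-y||)^\mu}{|x-y|^2}\,\rho(y,t)^{q}\,dy,\qquad G_\mu(x,t)=\int_{\mathbb R^3}\frac{\rho(y,t)^{5/4}\,(\ln(1+\rho(y,t)))^\mu}{|x-y|^2}\,dy,$$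 $$G_0(x,t)=\int_{\mathbb R^3}\frac{\rho(y,t)^{5/4}}{|x-y|^2}\,dy,\qquad \Sigma_\mu=G_0\,(1+|\ln G_0|)^\mu\quad(\Sigma_\mu=0\text{ where }G_0=0).$$ Then for almost every $(x,t)\in\mathbb R^4$ the integrals defining $\Psi^{(5/4)}_\mu$, $\Psi^{(4/5)}_\mu$, $G_\mu$, $G_0$ converge absolutely, and $$\|\Psi^{(5/4)}_\mu\|_{L^2(\mathbb R^4)}\le c,\quad \|\Psi^{(4/5)}_\mu\|_{L^2(\mathbb R^4)}\le c,\quad \|G_\mu\|_{L^2(\mathbb R^4)}\le c,\quad \|\Sigma_\mu\|_{L^2(\mathbb R^4)}\le c .$$ -/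

import Mathlib

open MeasureTheory Set
open scoped ContDiff Matrix

noncomputable section

/-- Physical space `ℝ³` with the Euclidean norm. -/
abbrev Space3 : Type := EuclideanSpace ℝ (Fin 3)

/-- Space-time `ℝ⁴ = ℝ³ × ℝ`; a point is `(x, t)`. Its volume is Lebesgue measure. -/
abbrev SpaceTime : Type := Space3 × ℝ

/-- The cylinder `Q_T = Ω × (0, T)`. -/
def spaceTimeCylinder (Ω : Set Space3) (T : ℝ) : Set SpaceTime := Ω ×ˢ Ioo (0 : ℝ) T

/-- Time derivative of a function on space-time. -/
def timeDeriv {F : Type*} [NormedAddCommGroup F] [NormedSpace ℝ F]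
    (g : SpaceTime → F) (z : SpaceTime) : F :=
  fderiv ℝ g z ((0 : Space3), (1 : ℝ))

/-- Partial derivative with respect to `x_j` of a function on space-time. -/
def spaceDeriv {F : Type*} [NormedAddCommGroup F] [NormedSpace ℝ F]
    (j : Fin 3) (g : SpaceTime → F) (z : SpaceTime) : F :=
  fderiv ℝ g z (EuclideanSpace.single j (1 : ℝ), (0 : ℝ))

/-- `g ∈ C₀^∞(U)`: smooth with compact support contained in `U`. -/
def IsTestFunction {V F : Type*} [NormedAddCommGroup V] [NormedSpace ℝ V]
    [NormedAddCommGroup F] [NormedSpace ℝ F] (U : Set V) (g : V → F) : Prop :=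
  ContDiff ℝ ∞ g ∧ HasCompactSupport g ∧ tsupport g ⊆ U

/-- `Dw` is the weak gradient of the vector field `w` in `Ω`, `Dw i j = ∂w_i / ∂x_j`. -/
structure HasWeakGradient (Ω : Set Space3) (w : Space3 → Space3)
    (Dw : Space3 → Matrix (Fin 3) (Fin 3) ℝ) : Prop where
  locallyIntegrable : LocallyIntegrableOn w Ω
  locallyIntegrable_grad : ∀ i j, LocallyIntegrableOn (fun x => Dw x i j) Ω
  integral_eq : ∀ φ : Space3 → ℝ, IsTestFunction Ω φ → ∀ i j,
    ∫ x in Ω, w x i * fderiv ℝ φ x (EuclideanSpace.single j (1 : ℝ))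
      = -∫ x in Ω, Dw x i j * φ x

/-- The artificial pressure `p(s) = s^{3/2} (1 + ε s^m)`. -/
def pressure (m ε s : ℝ) : ℝ := s ^ (3 / 2 : ℝ) * (1 + ε * s ^ m)

/-- The viscous stress tensor `ν₁ (∇u + ∇uᵀ) + ν₂ (div u) I` as a function of `D = ∇u`. -/
def viscousStress (ν₁ ν₂ : ℝ) (D : Matrix (Fin 3) (Fin 3) ℝ) : Matrix (Fin 3) (Fin 3) ℝ :=
  ν₁ • (D + Dᵀ) + (ν₂ * D.trace) • (1 : Matrix (Fin 3) (Fin 3) ℝ)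

/-- `(dens, u)`, with `Du` the spatial gradient of `u`, is a weak solution in `Q_T = Ω × (0,T)` of
the compressible Navier–Stokes equations with pressure `pressure m ε` and force density `f`:
```
  ∂ₜ(dens u) + div(dens u ⊗ u) + ∇p(dens) = div S(u) + dens f,   ∂ₜ dens + div(dens u) = 0,
```
and it obeys the energy estimate with bound `E`. No initial or boundary condition is imposed. Only
the values in `Q_T` matter. -/
structure IsEnergyWeakSolution (Ω : Set Space3) (T ν₁ ν₂ m ε E : ℝ) (f : SpaceTime → Space3)
    (dens : SpaceTime → ℝ) (u : SpaceTime → Space3)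
    (Du : SpaceTime → Matrix (Fin 3) (Fin 3) ℝ) : Prop where
  aemeasurable_dens : AEMeasurable dens (volume.restrict (spaceTimeCylinder Ω T))
  aemeasurable_u : AEMeasurable u (volume.restrict (spaceTimeCylinder Ω T))
  aemeasurable_Du : ∀ i j, AEMeasurable (fun z => Du z i j) (volume.restrict (spaceTimeCylinder Ω T))
  dens_nonneg : ∀ᵐ z ∂(volume.restrict (spaceTimeCylinder Ω T)), 0 ≤ dens z
  /-- `Du(·, t)` is the weak gradient of `u(·, t)` in `Ω` for almost every `t ∈ (0, T)`. -/
  weakGradient : ∀ᵐ t ∂(volume.restrict (Ioo (0 : ℝ) T)),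
    HasWeakGradient Ω (fun x => u (x, t)) (fun x => Du (x, t))
  /-- `‖p(dens)‖_{L^∞(0,T; L¹(Ω))} ≤ E`. -/
  pressure_le : ∀ᵐ t ∂(volume.restrict (Ioo (0 : ℝ) T)),
    ∫⁻ x in Ω, ENNReal.ofReal (pressure m ε (dens (x, t))) ≤ ENNReal.ofReal E
  /-- `‖dens |u|²‖_{L^∞(0,T; L¹(Ω))} ≤ E`. -/
  kinetic_le : ∀ᵐ t ∂(volume.restrict (Ioo (0 : ℝ) T)),
    ∫⁻ x in Ω, ENNReal.ofReal (dens (x, t) * ‖u (x, t)‖ ^ 2) ≤ ENNReal.ofReal E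
  /-- `‖u‖_{L²(0,T; W^{1,2}(Ω))} ≤ E`. -/
  dissipation_le :
    ∫⁻ z in spaceTimeCylinder Ω T, ENNReal.ofReal (‖u z‖ ^ 2 + ∑ i, ∑ j, Du z i j ^ 2)
      ≤ ENNReal.ofReal (E ^ 2)
  /-- Weak form of the momentum balance. -/
  momentum : ∀ ξ : SpaceTime → Space3, IsTestFunction (spaceTimeCylinder Ω T) ξ →
    ∫ z in spaceTimeCylinder Ω T,
      (dens z * inner ℝ (u z) (timeDeriv ξ z)
        + ∑ i, ∑ j,
            (dens z * u z i * u z j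
                + pressure m ε (dens z) * (1 : Matrix (Fin 3) (Fin 3) ℝ) i j
                - viscousStress ν₁ ν₂ (Du z) i j) * spaceDeriv j ξ z i
        + dens z * inner ℝ (f z) (ξ z)) = 0
  /-- Weak form of the mass balance. -/
  mass : ∀ ψ : SpaceTime → ℝ, IsTestFunction (spaceTimeCylinder Ω T) ψ →
    ∫ z in spaceTimeCylinder Ω T,
      (dens z * timeDeriv ψ z + ∑ j, dens z * u z j * spaceDeriv j ψ z) = 0

/-- The localized density `ρ = κ⁴ dens`; for a cut-off `κ` supported in `Q_T` it vanishes
outside `Q_T`. -/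
def localDensity (κ dens : SpaceTime → ℝ) (z : SpaceTime) : ℝ := κ z ^ 4 * dens z

/-- The integrand `|x-y|⁻² (1 + |ln|x-y||)^μ ρ(y,t)^q`, `z = (x,t)`. -/
def psiIntegrand (q μ : ℝ) (ρ : SpaceTime → ℝ) (z : SpaceTime) (y : Space3) : ℝ :=
  1 / ‖z.1 - y‖ ^ 2 * (1 + |Real.log ‖z.1 - y‖|) ^ μ * ρ (y, z.2) ^ q

/-- The potential `Ψ_μ(x,t) = ∫ |x-y|⁻² (1 + |ln|x-y||)^μ ρ(y,t)^q dy`. -/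
def psiPotential (q μ : ℝ) (ρ : SpaceTime → ℝ) (z : SpaceTime) : ℝ :=
  ∫ y, psiIntegrand q μ ρ z y

/-- The integrand `|x-y|⁻² ρ(y,t)^{5/4} (ln (1 + ρ(y,t)))^μ`, `z = (x,t)`. -/
def gIntegrand (μ : ℝ) (ρ : SpaceTime → ℝ) (z : SpaceTime) (y : Space3) : ℝ :=
  1 / ‖z.1 - y‖ ^ 2 * ρ (y, z.2) ^ (5 / 4 : ℝ) * Real.log (1 + ρ (y, z.2)) ^ μ

/-- The potential `G_μ(x,t) = ∫ |x-y|⁻² ρ(y,t)^{5/4} (ln (1 + ρ(y,t)))^μ dy`. For `μ = 0` the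
logarithmic factor is `1`. -/
def gPotential (μ : ℝ) (ρ : SpaceTime → ℝ) (z : SpaceTime) : ℝ :=
  ∫ y, gIntegrand μ ρ z y

/-- `Σ_μ = G_0 (1 + |ln G_0|)^μ`, equal to `0` where `G_0 = 0`. -/
def sigmaPotential (μ : ℝ) (ρ : SpaceTime → ℝ) (z : SpaceTime) : ℝ :=
  gPotential 0 ρ z * (1 + |Real.log (gPotential 0 ρ z)|) ^ μ

/-- `F ∈ L²(ℝ⁴)` with `‖F‖_{L²(ℝ⁴)} ≤ c`. -/
def L2NormLe (F : SpaceTime → ℝ) (c : ℝ) : Prop :=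
  MemLp F 2 volume ∧ eLpNorm F 2 volume ≤ ENNReal.ofReal c

end

/-! The equations are tested with a singular field centred at a second point, over which one
integrates as well. Put ℓ(s) = 2 + ½ ln(1 + 1/s), b(x) = ℓ(|x|² + e)^α (|x|² + e)^(-1/2) x with α =
2μ, η = κ⁴, and let θ be an even mollifier in time. At z = (x,t) the momentum balance is tested with
η(z) θ(t-s) b(x-y) and weighted with (η dens)(w), w = (y,s). At w the mass balance is tested with
η(w) θ(t-s) u(z)·b(x-y) and weighted with (η dens)(z). Both integrate to zero. In their sum the
derivatives of θ cancel, so no regularity in time is needed. With r² = |x-y|² + e, and a prime for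
values at w, the pressure contributes at least G = p dens' ℓ^α / r (up to cut-offs), since div b ≥
ℓ^α / r (`testField_div`). The convective terms combine to dens dens' u·Db(u - u'). As Db is even,
exchanging z and w turns this into half the quadratic form (u - u')·Db(u - u'). For α = 0 the form
is nonnegative; for α > 0 it loses at most α ℓ^(α-1) / r per unit of |u - u'|², one logarithm less
than the pressure gains (`testField_quadratic`).

That logarithm pays for the loss. X = dens dens' |u|² ℓ^(α-1) / r satisfies X⁵ ≤ C G² (V (p' + k))³
with V = N dens |κu|² + |κu|⁶ / N² and k = r⁻² + r⁻³ ℓ^(3α-5) (`pow_five_kinetic_le`), so by Young's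
inequality X is absorbed by G up to a multiple of V (p' + k). With N(t) = 1 + ‖u(t)‖² in W^{1,2},
the Sobolev inequality gives ∫ V dx ≤ C N(t), which is integrable in time. The integral of p' + k
over the second position is bounded uniformly: p' by the energy estimate, k because 3α - 5 < -1,
which is the condition μ < 2/3. Hence the doubled pressure is bounded (`exists_doubled_lower_bound`,
`exists_lintegral_pressureTerm_le`). Letting e → 0 and θ → δ, Fatou's lemma bounds the interaction
energy ∫∫∫ κ⁴ dens^(3/2)(x,t) κ⁴ dens(y,t) ℓ^α / |x-y| (`exists_interaction_le`).

The rest is potential theory. The squared L² norm of a potential with kernel |w|⁻² (1 + |ln|w||)^μ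
and density g is a double integral of g(y) g(y') against the composed kernel, which scaling bounds
by C (1 + |ln|y-y'||)^(2μ) / |y-y'| (`exists_lintegral_kernel_mul_le`); hence α = 2μ. Since a^(5/4)
b^(5/4) ≤ a^(3/2) b + b^(3/2) a, the interaction energy controls g = ρ^(5/4). For G_μ, either ρ is
at most a power of 1/|x-y|, so that the logarithm of ρ is one of the distance, or the logarithm is
dominated by min(1,|x-y|) ρ^(1/4), which leaves a convolution of ρ^(3/2) ∈ L¹ with an L² kernel
(`log_one_add_rpow_le`). For Σ_μ, a large value of G_0 comes mostly from points with |x-y| ≤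
G_0^(-1/4), where the logarithm of the distance dominates that of G_0; where G_0 is bounded, its
decay like |x|⁻² suffices (`exists_sigmaPotential_le`). -/

noncomputable section

/-! ### The regularized radial test field and its gradient. -/

/-- A smooth substitute for `2 + |log r|` near `r = 0`, as a function of `s = r²`. -/
def logWeight (s : ℝ) : ℝ := 2 + Real.log (1 + 1 / s) / 2

/-- The profile `L(s)^α s^{-1/2}`, where `L` is `logWeight`. -/
def radialProfile (α s : ℝ) : ℝ := logWeight s ^ α * s ^ (-(1 / 2) : ℝ)

/-- The derivative of `radialProfile α`. -/
def radialSlope (α s : ℝ) : ℝ :=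
  -(radialProfile α s / (2 * s)) - α * radialProfile (α - 1) s / (2 * s * (s + 1))

/-- The radial field with profile `radialProfile α`, regularized at the origin by `e`. -/
def testField (α e : ℝ) (x : Space3) : Space3 := radialProfile α (‖x‖ ^ 2 + e) • x

lemma two_le_logWeight {s : ℝ} (hs : 0 < s) : 2 ≤ logWeight s := by
  have : 0 ≤ Real.log (1 + 1 / s) := Real.log_nonneg (by have := one_div_pos.2 hs; linarith)
  unfold logWeight; linarith

lemma logWeight_pos {s : ℝ} (hs : 0 < s) : 0 < logWeight s := by
  linarith [two_le_logWeight hs]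

lemma hasDerivAt_logWeight {s : ℝ} (hs : 0 < s) :
    HasDerivAt logWeight (-(1 / (2 * s * (s + 1)))) s := by
  have h1 : HasDerivAt (fun s : ℝ => 1 + 1 / s) (-(1 / s ^ 2)) s := by
    simpa [one_div] using (hasDerivAt_inv hs.ne').const_add 1
  have h2 : (1 + 1 / s) ≠ 0 := by positivity
  have h3 := ((h1.log h2).div_const 2).const_add 2
  refine h3.congr_deriv ?_
  field_simp

lemma radialProfile_pos (α : ℝ) {s : ℝ} (hs : 0 < s) : 0 < radialProfile α s := by
  have := logWeight_pos hs
  unfold radialProfile; positivity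

lemma radialProfile_sub_one (α : ℝ) {s : ℝ} (hs : 0 < s) :
    radialProfile (α - 1) s = radialProfile α s / logWeight s := by
  unfold radialProfile
  rw [Real.rpow_sub_one (logWeight_pos hs).ne']; ring

lemma hasDerivAt_radialProfile (α : ℝ) {s : ℝ} (hs : 0 < s) :
    HasDerivAt (radialProfile α) (radialSlope α s) s := by
  have hL := logWeight_pos hs
  have h1 := (hasDerivAt_logWeight hs).rpow_const (p := α) (Or.inl hL.ne')
  have h2 := Real.hasDerivAt_rpow_const (x := s) (p := (-(1 / 2) : ℝ)) (Or.inl hs.ne')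
  refine (h1.mul h2).congr_deriv ?_
  unfold radialSlope radialProfile
  rw [Real.rpow_sub_one hs.ne']
  field_simp
  ring

lemma contDiffAt_logWeight {s : ℝ} (hs : 0 < s) : ContDiffAt ℝ ∞ logWeight s := by
  unfold logWeight
  have h1 : ContDiffAt ℝ ∞ (fun s : ℝ => 1 + 1 / s) s :=
    contDiffAt_const.add (contDiffAt_const.div contDiffAt_id hs.ne')
  exact contDiffAt_const.add ((h1.log (by positivity)).div_const 2)

lemma contDiffAt_radialProfile (α : ℝ) {s : ℝ} (hs : 0 < s) :
    ContDiffAt ℝ ∞ (radialProfile α) s := by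
  unfold radialProfile
  exact ((contDiffAt_logWeight hs).rpow_const_of_ne (logWeight_pos hs).ne').mul
    (contDiffAt_id.rpow_const_of_ne hs.ne')

lemma normSq_add_pos {e : ℝ} (he : 0 < e) (x : Space3) : 0 < ‖x‖ ^ 2 + e := by positivity

lemma contDiff_testField (α : ℝ) {e : ℝ} (he : 0 < e) : ContDiff ℝ ∞ (testField α e) := by
  have h : ContDiff ℝ ∞ (fun x : Space3 => radialProfile α (‖x‖ ^ 2 + e)) := by
    rw [contDiff_iff_contDiffAt]
    intro x
    exact (contDiffAt_radialProfile α (normSq_add_pos he x)).comp x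
      (((contDiff_norm_sq ℝ).add contDiff_const).contDiffAt)
  exact h.smul contDiff_id

lemma fderiv_testField (α : ℝ) {e : ℝ} (he : 0 < e) (x w : Space3) :
    fderiv ℝ (testField α e) x w = radialProfile α (‖x‖ ^ 2 + e) • w
      + (2 * radialSlope α (‖x‖ ^ 2 + e) * inner ℝ x w) • x := by
  have h1 : HasFDerivAt (fun x : Space3 => ‖x‖ ^ 2 + e) (2 • (innerSL ℝ x)) x :=
    ((hasStrictFDerivAt_norm_sq x).hasFDerivAt).add_const e
  have h2 := ((hasDerivAt_radialProfile α (normSq_add_pos he x)).comp_hasFDerivAt x h1).smul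
    (hasFDerivAt_id x)
  have h3 : HasFDerivAt (testField α e) _ x := h2
  rw [h3.fderiv]
  simp
  ring_nf

lemma radialProfile_sub_one_le (α : ℝ) {s : ℝ} (hs : 0 < s) :
    radialProfile (α - 1) s ≤ radialProfile α s / 2 := by
  rw [radialProfile_sub_one α hs]
  exact div_le_div_of_nonneg_left (radialProfile_pos α hs).le (by norm_num) (two_le_logWeight hs)

/-- The slope has one part from `s ^ (-1/2)`, which contributes exactly `-radialProfile α s`, and
one from the logarithm, which carries one logarithm less. The factor `1 / (s + 1)` of the latter is
dropped. -/
lemma radialSlope_bounds {α s : ℝ} (hα : 0 ≤ α) (hs : 0 < s) :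
    -(radialProfile α s + α * radialProfile (α - 1) s) ≤ 2 * radialSlope α s * s
      ∧ 2 * radialSlope α s * s ≤ 0 := by
  have h1 := radialProfile_pos α hs
  have h2 := radialProfile_pos (α - 1) hs
  have h : 2 * radialSlope α s * s
      = -(radialProfile α s + α * radialProfile (α - 1) s / (s + 1)) := by
    unfold radialSlope; field_simp; ring
  rw [h]
  have h3 : 0 ≤ α * radialProfile (α - 1) s / (s + 1) := by positivity
  have h4 : α * radialProfile (α - 1) s / (s + 1) ≤ α * radialProfile (α - 1) s :=
    div_le_self (by positivity) (by linarith)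
  constructor <;> linarith

/-- By Cauchy–Schwarz the worst direction is the radial one. There the derivative of `s ^ (-1/2)` is
compensated by the identity part of the gradient (convexity of `√(|x|² + e)`), so only the
derivative of the logarithm can be negative, and its exponent is `α - 1`. -/
lemma testField_quadratic {α e : ℝ} (hα : 0 ≤ α) (he : 0 < e) (x w : Space3) :
    -(α * radialProfile (α - 1) (‖x‖ ^ 2 + e) * ‖w‖ ^ 2)
      ≤ inner ℝ w (fderiv ℝ (testField α e) x w) := by
  set s := ‖x‖ ^ 2 + e with hs
  have hs0 : 0 < s := normSq_add_pos he x
  rw [fderiv_testField α he, ← hs, inner_add_right, inner_smul_right, inner_smul_right,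
    real_inner_self_eq_norm_sq, real_inner_comm w x]
  have hcs : (inner ℝ w x) ^ 2 ≤ ‖w‖ ^ 2 * s := by
    have h := abs_real_inner_le_norm w x
    have h2 : (inner ℝ w x) ^ 2 ≤ (‖w‖ * ‖x‖) ^ 2 := by
      rw [← sq_abs]; gcongr
    nlinarith [sq_nonneg ‖w‖]
  obtain ⟨hl, hu⟩ := radialSlope_bounds hα hs0
  have hsl : radialSlope α s ≤ 0 := by nlinarith
  have h5 : 2 * radialSlope α s * (‖w‖ ^ 2 * s) ≤ 2 * radialSlope α s * (inner ℝ w x) ^ 2 :=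
    mul_le_mul_of_nonpos_left hcs (by linarith)
  have h6 := mul_le_mul_of_nonneg_right hl (sq_nonneg ‖w‖)
  nlinarith

/-- The trace of the identity part gives three profiles; the slope of `s ^ (-1/2)` costs one and
that of the logarithm at most `α / 2 ≤ 1`, because `logWeight ≥ 2`. This is the purpose of the
additive constant `2` in `logWeight`. -/
lemma testField_div {α e : ℝ} (hα : 0 ≤ α) (hα2 : α ≤ 2) (he : 0 < e) (x : Space3) :
    radialProfile α (‖x‖ ^ 2 + e)
      ≤ ∑ i, (fderiv ℝ (testField α e) x (EuclideanSpace.single i (1 : ℝ))) i := by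
  set s := ‖x‖ ^ 2 + e with hs
  have hs0 : 0 < s := normSq_add_pos he x
  simp_rw [fderiv_testField α he, ← hs]
  have hx : ‖x‖ ^ 2 = x 0 ^ 2 + x 1 ^ 2 + x 2 ^ 2 := by
    simp [EuclideanSpace.norm_sq_eq, Fin.sum_univ_three]
  have h : ∑ i : Fin 3, (radialProfile α s • (EuclideanSpace.single i (1 : ℝ) : Space3)
      + (2 * radialSlope α s * inner ℝ x (EuclideanSpace.single i (1 : ℝ))) • x) i
      = 3 * radialProfile α s + 2 * radialSlope α s * ‖x‖ ^ 2 := by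
    rw [hx]
    simp [Fin.sum_univ_three, EuclideanSpace.inner_single_right]
    ring
  rw [h]
  obtain ⟨hl, hu⟩ := radialSlope_bounds hα hs0
  have hsl : radialSlope α s ≤ 0 := by nlinarith
  have hp := radialProfile_sub_one_le α hs0
  have h7 : 2 * radialSlope α s * s ≤ 2 * radialSlope α s * ‖x‖ ^ 2 :=
    mul_le_mul_of_nonpos_left (by rw [hs]; linarith) (by linarith)
  have hp0 := radialProfile_pos (α - 1) hs0
  nlinarith

lemma norm_sq_le_normSq_add {e : ℝ} (he : 0 < e) (x : Space3) :
    ‖x‖ ≤ (‖x‖ ^ 2 + e) ^ (1 / 2 : ℝ) := by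
  rw [← Real.sqrt_eq_rpow]
  exact Real.le_sqrt_of_sq_le (by linarith)

lemma norm_testField_le (α : ℝ) {e : ℝ} (he : 0 < e) (x : Space3) :
    ‖testField α e x‖ ≤ logWeight (‖x‖ ^ 2 + e) ^ α := by
  have hs0 := normSq_add_pos he x
  have hL := logWeight_pos hs0
  unfold testField
  rw [norm_smul, Real.norm_of_nonneg (radialProfile_pos α hs0).le, radialProfile, mul_assoc]
  refine mul_le_of_le_one_right (by positivity) ?_
  calc _ ≤ (‖x‖ ^ 2 + e) ^ (-(1 / 2) : ℝ) * (‖x‖ ^ 2 + e) ^ (1 / 2 : ℝ) := by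
        gcongr; exact norm_sq_le_normSq_add he x
    _ = 1 := by rw [← Real.rpow_add hs0]; norm_num

lemma norm_fderiv_testField_le {α e : ℝ} (hα : 0 ≤ α) (hα2 : α ≤ 2) (he : 0 < e) (x w : Space3) :
    ‖fderiv ℝ (testField α e) x w‖ ≤ 3 * radialProfile α (‖x‖ ^ 2 + e) * ‖w‖ := by
  set s := ‖x‖ ^ 2 + e with hs
  have hs0 : 0 < s := normSq_add_pos he x
  rw [fderiv_testField α he, ← hs]
  obtain ⟨hl, hu⟩ := radialSlope_bounds hα hs0
  have hsl : radialSlope α s ≤ 0 := by nlinarith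
  have hp := radialProfile_sub_one_le α hs0
  have hp0 := radialProfile_pos (α - 1) hs0
  have hp1 := radialProfile_pos α hs0
  have h1 : ‖radialProfile α s • w‖ = radialProfile α s * ‖w‖ := by
    rw [norm_smul, Real.norm_of_nonneg hp1.le]
  have h2 : ‖(2 * radialSlope α s * inner ℝ x w) • x‖ ≤ 2 * radialProfile α s * ‖w‖ := by
    rw [norm_smul, norm_mul, Real.norm_of_nonpos (by linarith : 2 * radialSlope α s ≤ 0)]
    calc _ ≤ -(2 * radialSlope α s) * (‖x‖ * ‖w‖) * ‖x‖ := by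
          gcongr
          · linarith
          · exact norm_inner_le_norm x w
      _ = -(2 * radialSlope α s) * ‖x‖ ^ 2 * ‖w‖ := by ring
      _ ≤ -(2 * radialSlope α s) * s * ‖w‖ := by
          gcongr ?_ * ‖w‖
          exact mul_le_mul_of_nonneg_left (by linarith) (by linarith)
      _ ≤ _ := by
          gcongr ?_ * ‖w‖
          nlinarith
  calc _ ≤ _ := norm_add_le _ _
    _ ≤ _ := by rw [h1]; linarith

lemma exists_logWeight_rpow_le {α τ : ℝ} (hα : 0 < α) (hτ : 0 < τ) (D : ℝ) :
    ∃ C : ℝ, 0 < C ∧ ∀ s : ℝ, 0 < s → s ≤ D → logWeight s ^ α ≤ C * s ^ (-τ) := by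
  rcases le_or_gt D 0 with hD | hD
  · exact ⟨1, one_pos, fun s h1 h2 => by linarith⟩
  -- The elementary bound of `log` by the power `ε`, raised to the power `α`, has to produce the
  -- power `τ`.
  set ε := τ / α with hε
  have hε0 : 0 < ε := by positivity
  refine ⟨(2 + 1 / (2 * ε)) ^ α * (D + 1) ^ τ, by positivity, fun s hs hsD => ?_⟩
  have h0 : (1 : ℝ) ≤ 1 + 1 / s := by have := one_div_pos.2 hs; linarith
  have h1 : Real.log (1 + 1 / s) ≤ (1 + 1 / s) ^ ε / ε := Real.log_le_rpow_div (by linarith) hε0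
  have h2 : (1 : ℝ) ≤ (1 + 1 / s) ^ ε := Real.one_le_rpow h0 hε0.le
  have h3 : logWeight s ≤ (2 + 1 / (2 * ε)) * (1 + 1 / s) ^ ε := by
    unfold logWeight
    have : (1 + 1 / s) ^ ε / ε / 2 = 1 / (2 * ε) * (1 + 1 / s) ^ ε := by field_simp
    nlinarith
  have h4 : 1 + 1 / s ≤ (D + 1) * s⁻¹ := by
    rw [← div_eq_mul_inv, le_div_iff₀ hs]; field_simp; linarith
  calc logWeight s ^ α ≤ ((2 + 1 / (2 * ε)) * ((D + 1) * s⁻¹) ^ ε) ^ α := by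
        refine Real.rpow_le_rpow (logWeight_pos hs).le (h3.trans ?_) hα.le
        gcongr
    _ = (2 + 1 / (2 * ε)) ^ α * ((D + 1) ^ τ * s ^ (-τ)) := by
        have hsi : 0 ≤ s⁻¹ := by positivity
        rw [Real.mul_rpow (by positivity) (by positivity), ← Real.rpow_mul (by positivity),
          show ε * α = τ by rw [hε]; field_simp, Real.mul_rpow (by positivity) hsi,
          Real.inv_rpow hs.le, Real.rpow_neg hs.le]
    _ = _ := by ring
end

/-! ### Uniform local integrability of the singular kernel. -/

noncomputable section

/-- A kernel in `s = |x - y|² + e` whose integral over balls is bounded uniformly in `e`. -/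
def singularKernel (α s : ℝ) : ℝ := s⁻¹ + s ^ (-(3 / 2) : ℝ) * logWeight s ^ (3 * α - 5)

lemma singularKernel_pos (α : ℝ) {s : ℝ} (hs : 0 < s) : 0 < singularKernel α s := by
  have := logWeight_pos hs
  unfold singularKernel; positivity

lemma continuousOn_logWeight : ContinuousOn logWeight (Ioi 0) := fun _ hs =>
  (contDiffAt_logWeight hs).continuousAt.continuousWithinAt

lemma continuousOn_singularKernel (α : ℝ) : ContinuousOn (singularKernel α) (Ioi 0) := by
  unfold singularKernel
  have h1 : ∀ s ∈ Ioi (0 : ℝ), s ≠ 0 := fun s hs => (ne_of_gt hs)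
  exact (continuousOn_id.inv₀ h1).add
    ((continuousOn_id.rpow_const fun s hs => Or.inl (h1 s hs)).mul
      (continuousOn_logWeight.rpow_const fun s hs => Or.inl (logWeight_pos hs).ne'))

lemma continuous_singularKernel_sq_add (α : ℝ) {e : ℝ} (he : 0 < e) :
    Continuous fun y : ℝ => singularKernel α (y ^ 2 + e) :=
  (continuousOn_singularKernel α).comp_continuous (by fun_prop)
    fun y => by rw [mem_Ioi]; positivity

/-- In polar coordinates the logarithmic part is comparable to the differential of `logWeight ^ (3α
- 4)`, which stays between 0 and 1 uniformly in `e` because the exponent is negative. With `α = 2μ`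
this is the condition `μ < 2/3`. -/
lemma radial_integral_singularKernel_le {α : ℝ} (hα : α < 4 / 3) {R e : ℝ} (hR : 0 < R)
    (he : 0 < e) (he1 : e ≤ 1) :
    ∫ y in (0 : ℝ)..R, y ^ 2 * singularKernel α (y ^ 2 + e) ≤ R + (R ^ 2 + 2) / (4 - 3 * α) := by
  have hγ : 0 < 4 - 3 * α := by linarith
  have hpos : ∀ y : ℝ, 0 < y ^ 2 + e := fun y => by positivity
  set g : ℝ → ℝ := fun y => logWeight (y ^ 2 + e) ^ (3 * α - 4) with hg
  set g' : ℝ → ℝ := fun y => (4 - 3 * α) * (logWeight (y ^ 2 + e) ^ (3 * α - 5)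
    * (y / ((y ^ 2 + e) * (y ^ 2 + e + 1)))) with hg'
  have hd : ∀ y, HasDerivAt g (g' y) y := by
    intro y
    have h1 : HasDerivAt (fun y : ℝ => y ^ 2 + e) (2 * y) y := by
      simpa using (hasDerivAt_pow 2 y).add_const e
    have h2 := ((hasDerivAt_logWeight (hpos y)).comp y h1).rpow_const (p := 3 * α - 4)
      (Or.inl (logWeight_pos (hpos y)).ne')
    refine h2.congr_deriv ?_
    simp only [hg', Function.comp]
    rw [show 3 * α - 4 - 1 = 3 * α - 5 by ring]
    have := (hpos y).ne'
    have : y ^ 2 + e + 1 ≠ 0 := by have := hpos y; positivity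
    field_simp
    ring
  have hLc : Continuous fun y : ℝ => logWeight (y ^ 2 + e) :=
    continuousOn_logWeight.comp_continuous (by fun_prop) hpos
  have hc : Continuous g' := by
    refine continuous_const.mul ((hLc.rpow_const fun y => Or.inl (logWeight_pos (hpos y)).ne').mul
      (continuous_id.div (by fun_prop) fun y => ?_))
    have := hpos y; positivity
  have hFTC : ∫ y in (0 : ℝ)..R, g' y = g R - g 0 :=
    intervalIntegral.integral_eq_sub_of_hasDerivAt (fun y _ => hd y) (hc.intervalIntegrable _ _)
  have hbound : ∀ y ∈ Icc (0 : ℝ) R, y ^ 2 * singularKernel α (y ^ 2 + e)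
      ≤ 1 + (R ^ 2 + 2) / (4 - 3 * α) * g' y := by
    intro y hy
    have hs := hpos y
    have hL := logWeight_pos hs
    have h1 : y ^ 2 * (y ^ 2 + e)⁻¹ ≤ 1 := by
      rw [← div_eq_mul_inv, div_le_one hs]; linarith
    have h2 : y ≤ (y ^ 2 + e) ^ (1 / 2 : ℝ) := by
      rw [← Real.sqrt_eq_rpow]; exact Real.le_sqrt_of_sq_le (by linarith)
    have h3 : y ^ 2 * (y ^ 2 + e) ^ (-(3 / 2) : ℝ) ≤ y * (y ^ 2 + e)⁻¹ := by
      calc y ^ 2 * (y ^ 2 + e) ^ (-(3 / 2) : ℝ)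
          = y * (y * (y ^ 2 + e) ^ (-(3 / 2) : ℝ)) := by ring
        _ ≤ y * ((y ^ 2 + e) ^ (1 / 2 : ℝ) * (y ^ 2 + e) ^ (-(3 / 2) : ℝ)) := by
            have := hy.1
            gcongr
        _ = _ := by rw [← Real.rpow_add hs, ← Real.rpow_neg_one]; norm_num
    -- The derivative of `logWeight` carries an additional factor `1 / (s + 1)`; it is harmless
    -- since `s + 1 ≤ R² + 2` on the ball, by `e ≤ 1`.
    have h4 : y * (y ^ 2 + e)⁻¹ ≤ (R ^ 2 + 2) * (y / ((y ^ 2 + e) * (y ^ 2 + e + 1))) := by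
      have h5 : y ^ 2 + e + 1 ≤ R ^ 2 + 2 := by nlinarith [hy.1, hy.2]
      rw [show y * (y ^ 2 + e)⁻¹ = (y ^ 2 + e + 1) * (y / ((y ^ 2 + e) * (y ^ 2 + e + 1))) by
        field_simp]
      have := hy.1
      gcongr
    have h6 := mul_le_mul_of_nonneg_right (h3.trans h4)
      (Real.rpow_nonneg hL.le (3 * α - 5))
    have h7 : (R ^ 2 + 2) / (4 - 3 * α) * g' y = (R ^ 2 + 2)
        * (y / ((y ^ 2 + e) * (y ^ 2 + e + 1))) * logWeight (y ^ 2 + e) ^ (3 * α - 5) := by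
      simp only [hg']; field_simp
    rw [h7]; unfold singularKernel
    linarith
  have hk := continuous_singularKernel_sq_add α he
  calc _ ≤ ∫ y in (0 : ℝ)..R, (1 + (R ^ 2 + 2) / (4 - 3 * α) * g' y) :=
        intervalIntegral.integral_mono_on hR.le
          (((continuous_pow 2).mul hk).intervalIntegrable _ _)
          ((continuous_const.add (continuous_const.mul hc)).intervalIntegrable _ _) hbound
    _ = R + (R ^ 2 + 2) / (4 - 3 * α) * (g R - g 0) := by
        have hi : IntervalIntegrable (fun y => (R ^ 2 + 2) / (4 - 3 * α) * g' y) volume 0 R :=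
          (continuous_const.mul hc).intervalIntegrable _ _
        rw [intervalIntegral.integral_add (by simp) hi,
          intervalIntegral.integral_const_mul, hFTC]
        simp
    _ ≤ R + (R ^ 2 + 2) / (4 - 3 * α) * 1 := by
        have hgR : g R ≤ 1 := Real.rpow_le_one_of_one_le_of_nonpos
          (by linarith [two_le_logWeight (hpos R)]) (by linarith)
        have hg0 : 0 ≤ g 0 := Real.rpow_nonneg (logWeight_pos (hpos 0)).le _
        gcongr
        linarith
    _ = _ := by ring

lemma exists_lintegral_ball_singularKernel_le {α : ℝ} (hα : α < 4 / 3) {R : ℝ} (hR : 0 < R) :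
    ∃ C : ℝ, 0 ≤ C ∧ ∀ e : ℝ, 0 < e → e ≤ 1 →
      ∫⁻ x in Metric.ball (0 : Space3) R, ENNReal.ofReal (singularKernel α (‖x‖ ^ 2 + e))
        ≤ ENNReal.ofReal C := by
  have hγ : 0 < 4 - 3 * α := by linarith
  set V : ℝ := volume.real (Metric.ball (0 : Space3) 1)
  -- `3 * V` is the area of the unit sphere.
  refine ⟨3 * (V * (R + (R ^ 2 + 2) / (4 - 3 * α))), by positivity, fun e he he1 => ?_⟩
  have hk := continuous_singularKernel_sq_add α he
  have hpos : ∀ y : ℝ, 0 < y ^ 2 + e := fun y => by positivity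
  have hint : IntegrableOn (fun x : Space3 => singularKernel α (‖x‖ ^ 2 + e))
      (Metric.ball 0 R) :=
    ((hk.comp continuous_norm).continuousOn.integrableOn_compact
      (isCompact_closedBall (0 : Space3) R)).mono_set Metric.ball_subset_closedBall
  rw [← ofReal_integral_eq_lintegral_ofReal hint
    (ae_of_all _ fun x => (singularKernel_pos α (hpos _)).le)]
  refine ENNReal.ofReal_le_ofReal ?_
  have h1 : ∫ x in Metric.ball (0 : Space3) R, singularKernel α (‖x‖ ^ 2 + e)
      = ∫ x : Space3, (Iio R).indicator (fun y => singularKernel α (y ^ 2 + e)) ‖x‖ := by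
    rw [← integral_indicator measurableSet_ball]
    congr 1
    ext x
    simp [indicator]
  rw [h1, integral_fun_norm_addHaar]
  simp only [finrank_euclideanSpace, Fintype.card_fin, nsmul_eq_mul, smul_eq_mul]
  have h2 : ∫ y in Ioi (0 : ℝ), y ^ (3 - 1) * (Iio R).indicator
        (fun y => singularKernel α (y ^ 2 + e)) y
      = ∫ y in (0 : ℝ)..R, y ^ 2 * singularKernel α (y ^ 2 + e) := by
    rw [intervalIntegral.integral_of_le hR.le, integral_Ioc_eq_integral_Ioo,
      ← Ioi_inter_Iio, inter_comm, ← Measure.restrict_restrict measurableSet_Iio,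
      ← integral_indicator measurableSet_Iio (μ := volume.restrict (Ioi (0 : ℝ)))]
    · congr 1
      ext y
      by_cases hy : y < R <;> simp [indicator, hy]
  rw [h2]
  have := radial_integral_singularKernel_le hα hR he he1
  push_cast
  gcongr
end

/-! ### The Sobolev inequality for weakly differentiable functions. -/

noncomputable section

open Filter Topology in
-- Cauchy–Schwarz for the splitting `a b = √a · (√a b)`. It serves as the `L¹ * L²` convolution
-- inequality, both for mollification and for the decay potential.
lemma sq_lintegral_mul_le {X : Type*} [MeasurableSpace X] (m : Measure X) {a b : X → ENNReal}
    (ha : AEMeasurable a m) (hb : AEMeasurable b m) :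
    (∫⁻ x, a x * b x ∂m) ^ 2 ≤ (∫⁻ x, a x ∂m) * ∫⁻ x, a x * b x ^ 2 ∂m := by
  have hhalf : ∀ t : ENNReal, t ^ (1 / 2 : ℝ) * t ^ (1 / 2 : ℝ) = t := fun t => by
    rw [← ENNReal.rpow_add_of_nonneg _ _ (by norm_num) (by norm_num)]; norm_num
  have h := ENNReal.lintegral_mul_le_Lp_mul_Lq m Real.HolderConjugate.two_two
    (ha.pow_const (1 / 2 : ℝ)) ((ha.pow_const (1 / 2 : ℝ)).mul hb)
  have e1 : ∀ x, ((fun x => a x ^ (1 / 2 : ℝ)) * ((fun x => a x ^ (1 / 2 : ℝ)) * b)) x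
      = a x * b x := fun x => by
    simp only [Pi.mul_apply]; rw [← mul_assoc, hhalf]
  have e2 : ∀ x, (a x ^ (1 / 2 : ℝ)) ^ (2 : ℝ) = a x := fun x => by
    rw [← ENNReal.rpow_mul]; norm_num
  have e3 : ∀ x, ((fun x => a x ^ (1 / 2 : ℝ)) * b) x ^ (2 : ℝ) = a x * b x ^ 2 := fun x => by
    simp only [Pi.mul_apply]
    rw [ENNReal.mul_rpow_of_nonneg _ _ (by norm_num), e2]; norm_num
  simp only [e1, e2, e3] at h
  calc _ ≤ ((∫⁻ x, a x ∂m) ^ (1 / 2 : ℝ) * (∫⁻ x, a x * b x ^ 2 ∂m) ^ (1 / 2 : ℝ)) ^ 2 := by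
        gcongr
    _ = _ := by rw [mul_pow, sq, sq, hhalf, hhalf]

lemma enorm_sq_le_sum_basis (L : Space3 →L[ℝ] ℝ) :
    ‖L‖ₑ ^ 2 ≤ ∑ j : Fin 3, ‖L (EuclideanSpace.single j (1 : ℝ))‖ₑ ^ 2 := by
  have h : ‖L‖ ^ 2 ≤ ∑ j : Fin 3, ‖L (EuclideanSpace.single j (1 : ℝ))‖ ^ 2 := by
    set S := ∑ j : Fin 3, ‖L (EuclideanSpace.single j (1 : ℝ))‖ ^ 2 with hS
    have hS0 : 0 ≤ S := by positivity
    have : ‖L‖ ≤ √S := by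
      refine L.opNorm_le_bound (Real.sqrt_nonneg _) fun x => ?_
      have hx : x = ∑ j : Fin 3, x j • (EuclideanSpace.single j (1 : ℝ) : Space3) := by
        ext i; simp [Fin.sum_univ_three]; fin_cases i <;> simp
      have hLx : L x = ∑ j : Fin 3, x j * L (EuclideanSpace.single j (1 : ℝ)) := by
        conv_lhs => rw [hx]
        simp
      have hcs := Finset.sum_mul_sq_le_sq_mul_sq Finset.univ (fun j : Fin 3 => x j)
        (fun j => L (EuclideanSpace.single j (1 : ℝ)))
      rw [← hLx] at hcs
      have hn : ∑ j : Fin 3, x j ^ 2 = ‖x‖ ^ 2 := by simp [EuclideanSpace.norm_sq_eq]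
      rw [hn] at hcs
      rw [Real.norm_eq_abs]
      apply abs_le_of_sq_le_sq _ (by positivity)
      rw [mul_pow, Real.sq_sqrt hS0, mul_comm]
      simpa [hS] using hcs
    calc ‖L‖ ^ 2 ≤ √S ^ 2 := by gcongr
      _ = S := Real.sq_sqrt hS0
  simp only [← ofReal_norm, ← ENNReal.ofReal_pow (norm_nonneg _)]
  rw [← ENNReal.ofReal_sum_of_nonneg fun _ _ => by positivity]
  exact ENNReal.ofReal_le_ofReal h

/-- Mollification does not increase the `L²` norm. -/
lemma lintegral_sq_mollify_le (φ : ContDiffBump (0 : Space3)) {g : Space3 → ℝ}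
    (hg : AEMeasurable g) :
    ∫⁻ x, ‖∫ t, φ.normed volume (x - t) * g t‖ₑ ^ 2 ≤ ∫⁻ t, ‖g t‖ₑ ^ 2 := by
  have hφ : ∫⁻ t, ‖φ.normed volume t‖ₑ = 1 := by
    have : ∀ t, ‖φ.normed volume t‖ₑ = ENNReal.ofReal (φ.normed volume t) := fun t => by
      rw [← ofReal_norm, Real.norm_of_nonneg (φ.nonneg_normed t)]
    simp_rw [this]
    rw [← ofReal_integral_eq_lintegral_ofReal φ.integrable_normed
      (ae_of_all _ fun t => φ.nonneg_normed t), φ.integral_normed, ENNReal.ofReal_one]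
  have hmeas : Measurable fun t => ‖φ.normed volume t‖ₑ :=
    φ.continuous_normed.measurable.enorm
  have hm1 : ∀ x, Measurable fun t => ‖φ.normed volume (x - t)‖ₑ := fun x =>
    hmeas.comp (measurable_const.sub measurable_id)
  have hm2 : ∀ t, Measurable fun x => ‖φ.normed volume (x - t)‖ₑ := fun t =>
    hmeas.comp (measurable_id.sub measurable_const)
  calc _ ≤ ∫⁻ x, (∫⁻ t, ‖φ.normed volume (x - t)‖ₑ * ‖g t‖ₑ) ^ 2 := by
        gcongr with x
        refine (enorm_integral_le_lintegral_enorm _).trans_eq ?_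
        simp_rw [enorm_mul]
    _ ≤ ∫⁻ x, ∫⁻ t, ‖φ.normed volume (x - t)‖ₑ * ‖g t‖ₑ ^ 2 := by
        gcongr with x
        refine (sq_lintegral_mul_le volume (hm1 x).aemeasurable hg.enorm).trans_eq ?_
        rw [lintegral_sub_left_eq_self (fun t => ‖φ.normed volume t‖ₑ) x, hφ, one_mul]
    _ = ∫⁻ t, ∫⁻ x, ‖φ.normed volume (x - t)‖ₑ * ‖g t‖ₑ ^ 2 := by
        have h1 : AEMeasurable (fun p : Space3 × Space3 => ‖φ.normed volume (p.1 - p.2)‖ₑ)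
            (volume.prod volume) := (hmeas.comp (measurable_fst.sub measurable_snd)).aemeasurable
        exact lintegral_lintegral_swap (h1.mul (hg.enorm.pow_const 2).comp_snd)
    _ = _ := by
        congr 1
        ext t
        rw [lintegral_mul_const _ (hm2 t),
          lintegral_sub_right_eq_self (fun x => ‖φ.normed volume x‖ₑ) t, hφ, one_mul]

open Filter Topology Convolution in
/-- Sobolev inequality `‖v‖_{L⁶} ≤ C ‖∇v‖_{L²}` for weakly differentiable functions. -/
lemma exists_sobolev_weak : ∃ C : NNReal, ∀ (v : Space3 → ℝ) (g : Fin 3 → Space3 → ℝ),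
    Integrable v → (∀ j, Integrable (g j)) → HasCompactSupport v →
    (∀ φ : Space3 → ℝ, ContDiff ℝ ∞ φ → HasCompactSupport φ → ∀ j,
      ∫ x, v x * fderiv ℝ φ x (EuclideanSpace.single j (1 : ℝ)) = -∫ x, g j x * φ x) →
    ∫⁻ x, ‖v x‖ₑ ^ 6 ≤ C * (∑ j, ∫⁻ x, ‖g j x‖ₑ ^ 2) ^ 3 := by
  refine ⟨SNormLESNormFDerivOfEqConst ℝ (volume : Measure Space3) ((2 : NNReal) : ℝ) ^ 6,
    fun v g hv hg hvc hw => ?_⟩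
  -- The ratio of the outer to the inner radius stays equal to 2, as required for convergence at
  -- almost every point.
  set φ : ℕ → ContDiffBump (0 : Space3) := fun n =>
    ⟨1 / ((n : ℝ) + 1), 2 / ((n : ℝ) + 1), by positivity, by gcongr; norm_num⟩ with hφ
  set vn : ℕ → Space3 → ℝ := fun n => (φ n).normed volume ⋆[ContinuousLinearMap.lsmul ℝ ℝ] v
    with hvn
  have hlim : ∀ᵐ x, Tendsto (fun n => vn n x) atTop (𝓝 (v x)) := by
    refine ContDiffBump.ae_convolution_tendsto_right_of_locallyIntegrable (K := 2) ?_
      (Eventually.of_forall fun n => ?_) hv.locallyIntegrable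
    · have := (tendsto_one_div_add_atTop_nhds_zero_nat (𝕜 := ℝ)).const_mul 2
      simpa [hφ, div_eq_mul_inv] using this
    · simp [hφ]; ring_nf; rfl
  have hφs : ∀ n, ContDiff ℝ ∞ ((φ n).normed volume) := fun n => (φ n).contDiff_normed
  have hφc : ∀ n, HasCompactSupport ((φ n).normed volume) := fun n =>
    (φ n).hasCompactSupport_normed
  have hsmooth : ∀ n, ContDiff ℝ 1 (vn n) := fun n =>
    ((hφc n).contDiff_convolution_left _ (hφs n) hv.locallyIntegrable).of_le (by simp)
  -- Testing the weak identity with the reflected and translated bump shows that the gradient of the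
  -- mollified function is the mollified weak gradient.
  have hder : ∀ n x j, fderiv ℝ (vn n) x (EuclideanSpace.single j (1 : ℝ))
      = ∫ t, (φ n).normed volume (x - t) * g j t := by
    intro n x j
    have h1 := ((hφc n).hasFDerivAt_convolution_left (ContinuousLinearMap.lsmul ℝ ℝ)
      ((hφs n).of_le (by simp)) hv.locallyIntegrable x).fderiv
    have hfc : HasCompactSupport (fderiv ℝ ((φ n).normed volume)) := (hφc n).fderiv ℝ
    have hfcont : Continuous (fderiv ℝ ((φ n).normed volume)) :=
      (hφs n).continuous_fderiv (by simp)
    have hex := hfc.convolutionExists_left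
      ((ContinuousLinearMap.lsmul ℝ ℝ).precompL Space3) hfcont hv.locallyIntegrable x
    change fderiv ℝ ((φ n).normed volume ⋆[ContinuousLinearMap.lsmul ℝ ℝ] v) x _ = _
    rw [h1, convolution_eq_swap, ContinuousLinearMap.integral_apply]
    · have h2 := hw (fun t => (φ n).normed volume (x - t))
        ((hφs n).comp (contDiff_const.sub contDiff_id))
        ((hφc n).comp_homeomorph (Homeomorph.subLeft x)) j
      have h3 : ∀ t, fderiv ℝ (fun t => (φ n).normed volume (x - t)) t
            (EuclideanSpace.single j (1 : ℝ))
          = -fderiv ℝ ((φ n).normed volume) (x - t) (EuclideanSpace.single j (1 : ℝ)) := by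
        intro t
        have hd := (((hφs n).differentiable (by simp)) (x - t)).hasFDerivAt.comp t
          ((hasFDerivAt_id t).const_sub x)
        have : fderiv ℝ (fun t => (φ n).normed volume (x - t)) t = _ := hd.fderiv
        rw [this]; simp
      simp_rw [h3, mul_neg, integral_neg, neg_inj] at h2
      simp only [ContinuousLinearMap.precompL_apply, ContinuousLinearMap.lsmul_apply, smul_eq_mul]
      simp_rw [mul_comm (fderiv ℝ ((φ n).normed volume) _ _), h2, mul_comm]
    · have := hex.integrable_swap
      exact this
  have hn : ∀ n, ∫⁻ x, ‖vn n x‖ₑ ^ 6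
      ≤ ((SNormLESNormFDerivOfEqConst ℝ (volume : Measure Space3) ((2 : NNReal) : ℝ) ^ 6 : NNReal)
        : ENNReal) * (∑ j, ∫⁻ x, ‖g j x‖ₑ ^ 2) ^ 3 := by
    intro n
    -- In dimension 3 the Sobolev exponent conjugate to 2 is 6.
    have h1 := eLpNorm_le_eLpNorm_fderiv_of_eq (volume : Measure Space3) (hsmooth n)
      (HasCompactSupport.convolution _ (hφc n) hvc) (p := 2) (p' := 6) (by norm_num)
      (by simp) (by simp; norm_num)
    have h6 := eLpNorm_nnreal_pow_eq_lintegral (f := vn n) (μ := volume) (p := 6) (by norm_num)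
    have h2 := eLpNorm_nnreal_pow_eq_lintegral (f := fderiv ℝ (vn n)) (μ := volume) (p := 2)
      (by norm_num)
    have e6 : ∀ t : ENNReal, t ^ ((6 : NNReal) : ℝ) = t ^ 6 := fun t => by
      rw [← ENNReal.rpow_natCast]; norm_num
    have e2 : ∀ t : ENNReal, t ^ ((2 : NNReal) : ℝ) = t ^ 2 := fun t => by
      rw [← ENNReal.rpow_natCast]; norm_num
    simp only [e6] at h6
    simp only [e2] at h2
    rw [← h6]
    have h3 : ∫⁻ x, ‖fderiv ℝ (vn n) x‖ₑ ^ 2 ≤ ∑ j, ∫⁻ x, ‖g j x‖ₑ ^ 2 := by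
      calc _ ≤ ∫⁻ x, ∑ j, ‖fderiv ℝ (vn n) x (EuclideanSpace.single j (1 : ℝ))‖ₑ ^ 2 :=
            lintegral_mono fun x => enorm_sq_le_sum_basis _
        _ = ∑ j, ∫⁻ x, ‖fderiv ℝ (vn n) x (EuclideanSpace.single j (1 : ℝ))‖ₑ ^ 2 := by
            refine lintegral_finsetSum _ fun j _ => ?_
            have : Continuous fun x => fderiv ℝ (vn n) x (EuclideanSpace.single j (1 : ℝ)) :=
              ((hsmooth n).continuous_fderiv (by simp)).clm_apply continuous_const
            exact this.measurable.enorm.pow_const 2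
        _ ≤ _ := by
            refine Finset.sum_le_sum fun j _ => ?_
            simp_rw [hder]
            exact lintegral_sq_mollify_le (φ n) (hg j).aemeasurable
    calc _ ≤ (SNormLESNormFDerivOfEqConst ℝ (volume : Measure Space3) ((2 : NNReal) : ℝ)
            * eLpNorm (fderiv ℝ (vn n)) 2 volume) ^ 6 := by
          gcongr
          exact h1
      _ = _ * (eLpNorm (fderiv ℝ (vn n)) 2 volume ^ 2) ^ 3 := by
          rw [mul_pow, ← pow_mul]
      _ ≤ _ := by
          rw [ENNReal.coe_pow]
          gcongr
          exact h2.trans_le h3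
  -- The bound is uniform in the mollification, so Fatou's lemma transfers it to the limit.
  calc ∫⁻ x, ‖v x‖ₑ ^ 6 = ∫⁻ x, liminf (fun n => ‖vn n x‖ₑ ^ 6) atTop := by
        refine lintegral_congr_ae ?_
        filter_upwards [hlim] with x hx
        exact (((ENNReal.continuous_pow 6).tendsto _).comp hx.enorm).liminf_eq.symm
    _ ≤ liminf (fun n => ∫⁻ x, ‖vn n x‖ₑ ^ 6) atTop :=
        lintegral_liminf_le fun n => (hsmooth n).continuous.measurable.enorm.pow_const 6
    _ ≤ _ := liminf_le_of_frequently_le' (Frequently.of_forall hn)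
end

/-! ### The Sobolev inequality for cut-off velocities. -/

noncomputable section

lemma integrable_mul_of_tsupport {Ω : Set Space3} {χ w : Space3 → ℝ} (hχ : Continuous χ)
    (hχc : HasCompactSupport χ) (hχΩ : tsupport χ ⊆ Ω) (hw : LocallyIntegrableOn w Ω) :
    Integrable fun x => χ x * w x := by
  have h1 : IntegrableOn w (tsupport χ) := hw.integrableOn_compact_subset hχΩ hχc
  have h2 : IntegrableOn (fun x => χ x * w x) (tsupport χ) := by
    exact h1.continuousOn_mul hχ.continuousOn hχc
  rw [integrableOn_iff_integrable_of_support_subset] at h2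
  · exact h2
  · intro x hx
    refine subset_tsupport χ ?_
    rw [Function.mem_support] at hx ⊢
    exact left_ne_zero_of_mul hx

/-- No regularity of the boundary is available, so the inequality is applied to `χ w_i`, extended by
zero. Testing with `χ φ` identifies its weak gradient as `χ ∇w_i + w_i ∇χ`. The constant depends on
the cut-off only through `K` and therefore serves all time slices at once. -/
lemma exists_sobolev_cutoff (K : ℝ) : ∃ C : NNReal, ∀ (Ω : Set Space3) (w : Space3 → Space3)
    (Dw : Space3 → Matrix (Fin 3) (Fin 3) ℝ) (χ : Space3 → ℝ), IsOpen Ω →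
    HasWeakGradient Ω w Dw → IsTestFunction Ω χ → (∀ x, |χ x| ≤ K) →
    (∀ x j, |fderiv ℝ χ x (EuclideanSpace.single j (1 : ℝ))| ≤ K) →
    ∫⁻ x in Ω, ENNReal.ofReal ((|χ x| * ‖w x‖) ^ 6)
      ≤ C * (∫⁻ x in Ω, ENNReal.ofReal (‖w x‖ ^ 2 + ∑ i, ∑ j, Dw x i j ^ 2)) ^ 3 := by
  obtain ⟨C₀, hC₀⟩ := exists_sobolev_weak
  -- `9` comes from `(a + b + c)³ ≤ 9 (a³ + b³ + c³)`, `3` from the number of components, and `6 K²`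
  -- from the square of the gradient of `χ w_i`, summed over three directions.
  refine ⟨9 * (3 * (C₀ * (Real.toNNReal (6 * K ^ 2)) ^ 3)),
    fun Ω w Dw χ hΩ hwD ⟨hχs, hχc, hχΩ⟩ hK hK' => ?_⟩
  set I := ∫⁻ x in Ω, ENNReal.ofReal (‖w x‖ ^ 2 + ∑ i, ∑ j, Dw x i j ^ 2) with hI
  have hχd : ∀ j, Continuous fun x => fderiv ℝ χ x (EuclideanSpace.single j (1 : ℝ)) := fun j =>
    (hχs.continuous_fderiv (by simp)).clm_apply continuous_const
  have hχdc : ∀ j, HasCompactSupport fun x => fderiv ℝ χ x (EuclideanSpace.single j (1 : ℝ)) :=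
    fun j => hχc.fderiv_apply ℝ _
  have hχdΩ : ∀ j, tsupport (fun x => fderiv ℝ χ x (EuclideanSpace.single j (1 : ℝ))) ⊆ Ω :=
    fun j => (tsupport_fderiv_apply_subset ℝ _).trans hχΩ
  have hwi : ∀ i, LocallyIntegrableOn (fun x => w x i) Ω := fun i x hx => by
    obtain ⟨s, hs, hs'⟩ := hwD.locallyIntegrable x hx
    exact ⟨s, hs, (EuclideanSpace.proj (𝕜 := ℝ) i).integrable_comp hs'⟩
  set v : Fin 3 → Space3 → ℝ := fun i x => χ x * w x i with hv
  set g : Fin 3 → Fin 3 → Space3 → ℝ := fun i j x =>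
    χ x * Dw x i j + fderiv ℝ χ x (EuclideanSpace.single j (1 : ℝ)) * w x i with hg
  have hvi : ∀ i, Integrable (v i) := fun i =>
    integrable_mul_of_tsupport hχs.continuous hχc hχΩ (hwi i)
  have hg1 : ∀ i j, Integrable fun x => χ x * Dw x i j := fun i j =>
    integrable_mul_of_tsupport hχs.continuous hχc hχΩ (hwD.locallyIntegrable_grad i j)
  have hg2 : ∀ i j, Integrable fun x => fderiv ℝ χ x (EuclideanSpace.single j (1 : ℝ)) * w x i :=
    fun i j => integrable_mul_of_tsupport (hχd j) (hχdc j) (hχdΩ j) (hwi i)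
  have hgi : ∀ i j, Integrable (g i j) := fun i j => (hg1 i j).add (hg2 i j)
  have hvc : ∀ i, HasCompactSupport (v i) := fun i => hχc.mul_right
  have hχ0 : ∀ x ∉ Ω, χ x = 0 := fun x hx => image_eq_zero_of_notMem_tsupport fun h => hx (hχΩ h)
  have hχd0 : ∀ j, ∀ x ∉ Ω, fderiv ℝ χ x (EuclideanSpace.single j (1 : ℝ)) = 0 := fun j x hx =>
    image_eq_zero_of_notMem_tsupport (f := fun x => fderiv ℝ χ x (EuclideanSpace.single j (1 : ℝ)))
      fun h => hx (hχdΩ j h)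
  have hweak : ∀ i (φ : Space3 → ℝ), ContDiff ℝ ∞ φ → HasCompactSupport φ → ∀ j,
      ∫ x, v i x * fderiv ℝ φ x (EuclideanSpace.single j (1 : ℝ)) = -∫ x, g i j x * φ x := by
    intro i φ hφ hφc j
    have hbd : ∀ (f : Space3 → ℝ), Integrable f → ∀ ψ : Space3 → ℝ, Continuous ψ →
        HasCompactSupport ψ → Integrable fun x => f x * ψ x := by
      intro f hf ψ hψ hψc
      obtain ⟨c, hc⟩ := hψc.exists_bound_of_continuous hψ
      exact hf.mul_bdd (c := c) hψ.aestronglyMeasurable (ae_of_all _ hc)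
    have hφd : Continuous fun x => fderiv ℝ φ x (EuclideanSpace.single j (1 : ℝ)) :=
      (hφ.continuous_fderiv (by simp)).clm_apply continuous_const
    have h := hwD.integral_eq (fun x => χ x * φ x)
      ⟨hχs.mul hφ, hχc.mul_right, (tsupport_mul_subset_left).trans hχΩ⟩ i j
    have hd : ∀ x, fderiv ℝ (fun x => χ x * φ x) x (EuclideanSpace.single j (1 : ℝ))
        = χ x * fderiv ℝ φ x (EuclideanSpace.single j (1 : ℝ))
          + φ x * fderiv ℝ χ x (EuclideanSpace.single j (1 : ℝ)) := by
      intro x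
      rw [fderiv_fun_mul ((hχs.differentiable (by simp)) x) ((hφ.differentiable (by simp)) x)]
      simp
    rw [setIntegral_eq_integral_of_forall_compl_eq_zero (fun x hx => by
        rw [hd, hχ0 x hx, hχd0 j x hx]; ring),
      setIntegral_eq_integral_of_forall_compl_eq_zero (fun x hx => by rw [hχ0 x hx]; ring)] at h
    have i1 : Integrable fun x => v i x * fderiv ℝ φ x (EuclideanSpace.single j (1 : ℝ)) :=
      hbd _ (hvi i) _ hφd (hφc.fderiv_apply ℝ _)
    have i2 := hbd _ (hg2 i j) φ hφ.continuous hφc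
    have i3 := hbd _ (hg1 i j) φ hφ.continuous hφc
    have e1 : ∫ x, w x i * fderiv ℝ (fun x => χ x * φ x) x (EuclideanSpace.single j (1 : ℝ))
        = (∫ x, v i x * fderiv ℝ φ x (EuclideanSpace.single j (1 : ℝ)))
          + ∫ x, fderiv ℝ χ x (EuclideanSpace.single j (1 : ℝ)) * w x i * φ x := by
      rw [← integral_add i1 i2]
      congr 1; ext x; rw [hd]; simp only [hv]; ring
    have e2 : ∫ x, g i j x * φ x = (∫ x, χ x * Dw x i j * φ x)
        + ∫ x, fderiv ℝ χ x (EuclideanSpace.single j (1 : ℝ)) * w x i * φ x := by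
      rw [← integral_add i3 i2]
      congr 1; ext x; simp only [hg]; ring
    have e3 : ∫ x, Dw x i j * (χ x * φ x) = ∫ x, χ x * Dw x i j * φ x := by
      congr 1; ext x; ring
    rw [e1, e3] at h
    rw [e2]; linarith
  have hsob : ∀ i, ∫⁻ x, ‖v i x‖ₑ ^ 6 ≤ C₀ * (ENNReal.ofReal (6 * K ^ 2) * I) ^ 3 := by
    intro i
    refine (hC₀ (v i) (g i) (hvi i) (hgi i) (hvc i) (hweak i)).trans ?_
    gcongr
    calc ∑ j, ∫⁻ x, ‖g i j x‖ₑ ^ 2 = ∫⁻ x, ∑ j, ‖g i j x‖ₑ ^ 2 :=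
          (lintegral_finsetSum' _ fun j _ => (hgi i j).aemeasurable.enorm.pow_const 2).symm
      _ = ∫⁻ x in Ω, ∑ j, ‖g i j x‖ₑ ^ 2 := by
          refine (setLIntegral_eq_of_support_subset fun x hx => ?_).symm
          by_contra hxΩ
          exact hx (by simp [hg, hχ0 x hxΩ, hχd0 _ x hxΩ])
      _ ≤ ∫⁻ x in Ω, ENNReal.ofReal (6 * K ^ 2)
            * ENNReal.ofReal (‖w x‖ ^ 2 + ∑ i, ∑ j, Dw x i j ^ 2) := by
          refine lintegral_mono fun x => ?_
          dsimp only
          rw [← ENNReal.ofReal_mul (by positivity)]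
          simp only [← ofReal_norm, ← ENNReal.ofReal_pow (norm_nonneg _)]
          rw [← ENNReal.ofReal_sum_of_nonneg fun _ _ => by positivity]
          refine ENNReal.ofReal_le_ofReal ?_
          have hwn : w x i ^ 2 ≤ ‖w x‖ ^ 2 := by
            rw [EuclideanSpace.real_norm_sq_eq]
            exact Finset.single_le_sum (f := fun i => w x i ^ 2) (fun _ _ => sq_nonneg _)
              (Finset.mem_univ i)
          have hDn : ∑ j, Dw x i j ^ 2 ≤ ∑ i, ∑ j, Dw x i j ^ 2 :=
            Finset.single_le_sum (f := fun i => ∑ j, Dw x i j ^ 2)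
              (fun _ _ => Finset.sum_nonneg fun _ _ => sq_nonneg _) (Finset.mem_univ i)
          have hj : ∀ j, ‖g i j x‖ ^ 2 ≤ 2 * K ^ 2 * (Dw x i j ^ 2 + w x i ^ 2) := by
            intro j
            rw [Real.norm_eq_abs, sq_abs]
            have a1 : χ x ^ 2 ≤ K ^ 2 := by rw [← sq_abs]; have := hK x; gcongr
            have a2 : fderiv ℝ χ x (EuclideanSpace.single j (1 : ℝ)) ^ 2 ≤ K ^ 2 := by
              rw [← sq_abs]; have := hK' x j; gcongr
            have b1 := mul_le_mul_of_nonneg_right a1 (sq_nonneg (Dw x i j))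
            have b2 := mul_le_mul_of_nonneg_right a2 (sq_nonneg (w x i))
            have := add_sq_le (a := χ x * Dw x i j)
              (b := fderiv ℝ χ x (EuclideanSpace.single j (1 : ℝ)) * w x i)
            simp only [hg]
            nlinarith
          calc ∑ j, ‖g i j x‖ ^ 2 ≤ ∑ j, 2 * K ^ 2 * (Dw x i j ^ 2 + w x i ^ 2) :=
                Finset.sum_le_sum fun j _ => hj j
            _ = 2 * K ^ 2 * (∑ j, Dw x i j ^ 2) + 6 * K ^ 2 * w x i ^ 2 := by
                rw [← Finset.mul_sum, Finset.sum_add_distrib]; simp; ring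
            _ ≤ _ := by
                have hK2 := sq_nonneg K
                have : 0 ≤ ∑ i, ∑ j, Dw x i j ^ 2 :=
                  Finset.sum_nonneg fun _ _ => Finset.sum_nonneg fun _ _ => sq_nonneg _
                nlinarith [mul_le_mul_of_nonneg_left hwn hK2, mul_le_mul_of_nonneg_left hDn hK2,
                  mul_nonneg hK2 this]
      _ = ENNReal.ofReal (6 * K ^ 2) * I := lintegral_const_mul' _ _ ENNReal.ofReal_ne_top
  calc ∫⁻ x in Ω, ENNReal.ofReal ((|χ x| * ‖w x‖) ^ 6)
      ≤ ∫⁻ x in Ω, 9 * ∑ i, ‖v i x‖ₑ ^ 6 := by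
        refine lintegral_mono fun x => ?_
        dsimp only
        simp only [← ofReal_norm, ← ENNReal.ofReal_pow (norm_nonneg _)]
        rw [← ENNReal.ofReal_sum_of_nonneg fun _ _ => by positivity,
          show (9 : ENNReal) = ENNReal.ofReal 9 by norm_num, ← ENNReal.ofReal_mul (by norm_num)]
        refine ENNReal.ofReal_le_ofReal ?_
        have h1 : (|χ x| * ‖w x‖) ^ 2 = ∑ i, v i x ^ 2 := by
          rw [mul_pow, sq_abs, EuclideanSpace.real_norm_sq_eq, Finset.mul_sum]
          simp only [hv, mul_pow]
        have h3 := pow_sum_div_card_le_sum_pow (s := (Finset.univ : Finset (Fin 3)))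
          (f := fun i => v i x ^ 2) (fun i _ => sq_nonneg _) 2
        have h4 : ∀ i, ‖v i x‖ ^ 6 = (v i x ^ 2) ^ 3 := fun i => by
          rw [Real.norm_eq_abs, ← sq_abs (v i x), ← pow_mul]
        rw [show (|χ x| * ‖w x‖) ^ 6 = ((|χ x| * ‖w x‖) ^ 2) ^ 3 by ring, h1]
        simp only [h4]
        simp only [Finset.card_univ, Fintype.card_fin] at h3
        norm_num at h3 ⊢
        linarith
    _ ≤ ∫⁻ x, 9 * ∑ i, ‖v i x‖ₑ ^ 6 := lintegral_mono' Measure.restrict_le_self le_rfl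
    _ = 9 * ∑ i, ∫⁻ x, ‖v i x‖ₑ ^ 6 := by
        rw [lintegral_const_mul' _ _ (by norm_num),
          lintegral_finsetSum' _ fun i _ => (hvi i).aemeasurable.enorm.pow_const 6]
    _ ≤ 9 * ∑ i : Fin 3, C₀ * (ENNReal.ofReal (6 * K ^ 2) * I) ^ 3 := by
        gcongr with i
        exact hsob i
    _ = _ := by
        simp only [Finset.sum_const, Finset.card_univ, Fintype.card_fin, nsmul_eq_mul]
        push_cast
        rw [mul_pow]
        simp only [ENNReal.ofReal]
        ring
end

/-! ### Doubling of variables in the balance laws. -/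

noncomputable section

lemma IsTestFunction.mul_smul {F : Type*} [NormedAddCommGroup F] [NormedSpace ℝ F]
    {U : Set SpaceTime} {η : SpaceTime → ℝ} (hη : IsTestFunction U η) {τ : ℝ → ℝ}
    (hτ : ContDiff ℝ ∞ τ) {a : Space3 → F} (ha : ContDiff ℝ ∞ a) :
    IsTestFunction U fun z => (η z * τ z.2) • a z.1 := by
  obtain ⟨h1, h2, h3⟩ := hη
  refine ⟨(h1.mul (hτ.comp contDiff_snd)).smul (ha.comp contDiff_fst), ?_, ?_⟩
  · exact (h2.mul_right (f' := fun z : SpaceTime => τ z.2)).smul_right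
  · refine (closure_mono ?_).trans h3
    intro z hz
    rw [Function.mem_support] at hz ⊢
    intro h0
    exact hz (by simp [h0])

lemma hasFDerivAt_mul_smul {F : Type*} [NormedAddCommGroup F] [NormedSpace ℝ F]
    {η : SpaceTime → ℝ} (hη : ContDiff ℝ ∞ η) {τ : ℝ → ℝ}
    (hτ : ContDiff ℝ ∞ τ) {a : Space3 → F} (ha : ContDiff ℝ ∞ a) (z v : SpaceTime) :
    fderiv ℝ (fun z : SpaceTime => (η z * τ z.2) • a z.1) z v
      = (fderiv ℝ η z v * τ z.2 + η z * (deriv τ z.2 * v.2)) • a z.1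
        + (η z * τ z.2) • fderiv ℝ a z.1 v.1 := by
  have h1 := ((hη.differentiable (by simp)) z).hasFDerivAt
  have h2 := ((hτ.differentiable (by simp)) z.2).hasDerivAt.comp_hasFDerivAt z
    (hasFDerivAt_snd (𝕜 := ℝ) (E := Space3) (F := ℝ))
  have h3 := ((ha.differentiable (by simp)) z.1).hasFDerivAt.comp z
    (hasFDerivAt_fst (𝕜 := ℝ) (E := Space3) (F := ℝ))
  have h4 := (h1.mul h2).smul h3
  have h5 : fderiv ℝ (fun z : SpaceTime => (η z * τ z.2) • a z.1) z = _ := h4.fderiv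
  rw [h5]
  simp [add_comm, mul_comm]

/-- A weak solution with everywhere measurable representatives, including the `L⁶` bound of the
localized velocity. -/
structure IsMeasurableFlow (Ω : Set Space3) (T ν₁ ν₂ m ε E F S : ℝ) (κ : SpaceTime → ℝ)
    (f : SpaceTime → Space3) (dens : SpaceTime → ℝ) (u : SpaceTime → Space3)
    (Du : SpaceTime → Matrix (Fin 3) (Fin 3) ℝ) : Prop where
  measurable_dens : Measurable dens
  measurable_u : Measurable u
  measurable_Du : ∀ i j, Measurable fun z => Du z i j
  measurable_f : Measurable f
  dens_nonneg : ∀ z, 0 ≤ dens z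
  norm_f_le : ∀ z, ‖f z‖ ≤ F
  pressure_le : ∀ᵐ t ∂(volume.restrict (Ioo (0 : ℝ) T)),
    ∫⁻ x in Ω, ENNReal.ofReal (pressure m ε (dens (x, t))) ≤ ENNReal.ofReal E
  kinetic_le : ∀ᵐ t ∂(volume.restrict (Ioo (0 : ℝ) T)),
    ∫⁻ x in Ω, ENNReal.ofReal (dens (x, t) * ‖u (x, t)‖ ^ 2) ≤ ENNReal.ofReal E
  dissipation_le :
    ∫⁻ z in spaceTimeCylinder Ω T, ENNReal.ofReal (‖u z‖ ^ 2 + ∑ i, ∑ j, Du z i j ^ 2)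
      ≤ ENNReal.ofReal (E ^ 2)
  sobolev_le : ∀ᵐ t ∂(volume.restrict (Ioo (0 : ℝ) T)),
    ∫⁻ x in Ω, ENNReal.ofReal ((κ (x, t) * ‖u (x, t)‖) ^ 6)
      ≤ ENNReal.ofReal S * (∫⁻ x in Ω, ENNReal.ofReal
        (‖u (x, t)‖ ^ 2 + ∑ i, ∑ j, Du (x, t) i j ^ 2)) ^ 3
  momentum : ∀ ξ : SpaceTime → Space3, IsTestFunction (spaceTimeCylinder Ω T) ξ →
    ∫ z in spaceTimeCylinder Ω T,
      (dens z * inner ℝ (u z) (timeDeriv ξ z)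
        + ∑ i, ∑ j,
            (dens z * u z i * u z j
                + pressure m ε (dens z) * (1 : Matrix (Fin 3) (Fin 3) ℝ) i j
                - viscousStress ν₁ ν₂ (Du z) i j) * spaceDeriv j ξ z i
        + dens z * inner ℝ (f z) (ξ z)) = 0
  mass : ∀ ψ : SpaceTime → ℝ, IsTestFunction (spaceTimeCylinder Ω T) ψ →
    ∫ z in spaceTimeCylinder Ω T,
      (dens z * timeDeriv ψ z + ∑ j, dens z * u z j * spaceDeriv j ψ z) = 0

/-- Pairs of points of space-time. -/
abbrev SpaceTimePair : Type := SpaceTime × SpaceTime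

/-- The `j`-th partial derivative of the vector field `b` at the difference of positions. -/
def pairDeriv (b : Space3 → Space3) (q : SpaceTimePair) (j : Fin 3) : Space3 :=
  fderiv ℝ b (q.1.1 - q.2.1) (EuclideanSpace.single j (1 : ℝ))

/-- The momentum balance at the first point of a pair, weighted with the mass at the second. -/
def pairMomentum (ν₁ ν₂ m ε : ℝ) (f : SpaceTime → Space3) (dens : SpaceTime → ℝ)
    (u : SpaceTime → Space3) (Du : SpaceTime → Matrix (Fin 3) (Fin 3) ℝ) (η : SpaceTime → ℝ)
    (θ : ℝ → ℝ) (b : Space3 → Space3) (q : SpaceTimePair) : ℝ :=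
  η q.2 * dens q.2 *
    (dens q.1 * (timeDeriv η q.1 * θ (q.1.2 - q.2.2) + η q.1 * deriv θ (q.1.2 - q.2.2))
        * inner ℝ (u q.1) (b (q.1.1 - q.2.1))
      + ∑ i, ∑ j, (dens q.1 * u q.1 i * u q.1 j
          + pressure m ε (dens q.1) * (1 : Matrix (Fin 3) (Fin 3) ℝ) i j
          - viscousStress ν₁ ν₂ (Du q.1) i j) * (θ (q.1.2 - q.2.2)
            * (spaceDeriv j η q.1 * b (q.1.1 - q.2.1) i + η q.1 * pairDeriv b q j i))
      + dens q.1 * (η q.1 * θ (q.1.2 - q.2.2)) * inner ℝ (f q.1) (b (q.1.1 - q.2.1)))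

/-- The mass balance at the second point of a pair, weighted with the momentum at the first. -/
def pairMass (dens : SpaceTime → ℝ) (u : SpaceTime → Space3) (η : SpaceTime → ℝ)
    (θ : ℝ → ℝ) (b : Space3 → Space3) (q : SpaceTimePair) : ℝ :=
  η q.1 * dens q.1 *
    (dens q.2 * ((timeDeriv η q.2 * θ (q.1.2 - q.2.2) - η q.2 * deriv θ (q.1.2 - q.2.2))
        * inner ℝ (u q.1) (b (q.1.1 - q.2.1)))
      + ∑ j, dens q.2 * u q.2 j * (θ (q.1.2 - q.2.2)
        * (spaceDeriv j η q.2 * inner ℝ (u q.1) (b (q.1.1 - q.2.1))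
          - η q.2 * inner ℝ (u q.1) (pairDeriv b q j))))

section

variable {Ω : Set Space3} {T ν₁ ν₂ m ε E F S : ℝ} {κ : SpaceTime → ℝ}
    {f : SpaceTime → Space3} {dens : SpaceTime → ℝ} {u : SpaceTime → Space3}
    {Du : SpaceTime → Matrix (Fin 3) (Fin 3) ℝ}

/-- With the second point frozen, the test field `η(z) θ(t - s) b(x - y)` takes its compact support
from `η`, so `θ` and `b` only have to be smooth. -/
lemma IsMeasurableFlow.integral_pairMomentum
    (h : IsMeasurableFlow Ω T ν₁ ν₂ m ε E F S κ f dens u Du) {η : SpaceTime → ℝ}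
    (hη : IsTestFunction (spaceTimeCylinder Ω T) η) {θ : ℝ → ℝ} (hθ : ContDiff ℝ ∞ θ)
    {b : Space3 → Space3} (hb : ContDiff ℝ ∞ b) (w : SpaceTime) :
    ∫ z in spaceTimeCylinder Ω T, pairMomentum ν₁ ν₂ m ε f dens u Du η θ b (z, w) = 0 := by
  have hτ : ContDiff ℝ ∞ fun t => θ (t - w.2) := hθ.comp (contDiff_id.sub contDiff_const)
  have ha : ContDiff ℝ ∞ fun x => b (x - w.1) := hb.comp (contDiff_id.sub contDiff_const)
  have hm := h.momentum _ (hη.mul_smul hτ ha)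
  have ht : ∀ z, timeDeriv (fun z : SpaceTime => (η z * θ (z.2 - w.2)) • b (z.1 - w.1)) z
      = (timeDeriv η z * θ (z.2 - w.2) + η z * deriv θ (z.2 - w.2)) • b (z.1 - w.1) := by
    intro z
    unfold timeDeriv
    rw [hasFDerivAt_mul_smul hη.1 hτ ha]
    simp [deriv_comp_sub_const]
  have hs : ∀ j z, spaceDeriv j (fun z : SpaceTime => (η z * θ (z.2 - w.2)) • b (z.1 - w.1)) z
      = (spaceDeriv j η z * θ (z.2 - w.2)) • b (z.1 - w.1)
        + (η z * θ (z.2 - w.2)) • pairDeriv b (z, w) j := by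
    intro j z
    unfold spaceDeriv pairDeriv
    rw [hasFDerivAt_mul_smul hη.1 hτ ha]
    simp [fderiv_comp_sub]
  simp_rw [ht, hs] at hm
  refine Eq.trans ?_ ((congrArg (fun r => η w * dens w * r) hm).trans (mul_zero _))
  rw [← integral_const_mul]
  congr 1
  ext z
  unfold pairMomentum
  congr 1
  simp only [inner_smul_right, PiLp.add_apply, PiLp.smul_apply, smul_eq_mul]
  congr 1
  · congr 1
    · ring
    · refine Finset.sum_congr rfl fun i _ => Finset.sum_congr rfl fun j _ => ?_
      ring
  · ring

/-- With the first point frozen, `u z` is a constant vector. This is why the merely measurable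
velocity may enter the test function of the mass balance. -/
lemma IsMeasurableFlow.integral_pairMass
    (h : IsMeasurableFlow Ω T ν₁ ν₂ m ε E F S κ f dens u Du) {η : SpaceTime → ℝ}
    (hη : IsTestFunction (spaceTimeCylinder Ω T) η) {θ : ℝ → ℝ} (hθ : ContDiff ℝ ∞ θ)
    {b : Space3 → Space3} (hb : ContDiff ℝ ∞ b) (z : SpaceTime) :
    ∫ w in spaceTimeCylinder Ω T, pairMass dens u η θ b (z, w) = 0 := by
  have hτ : ContDiff ℝ ∞ fun t => θ (z.2 - t) := hθ.comp (contDiff_const.sub contDiff_id)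
  have ha : ContDiff ℝ ∞ fun y => inner ℝ (u z) (b (z.1 - y)) :=
    contDiff_const.inner ℝ (hb.comp (contDiff_const.sub contDiff_id))
  have hm := h.mass _ (hη.mul_smul hτ ha)
  have hda : ∀ y v, fderiv ℝ (fun y => inner ℝ (u z) (b (z.1 - y))) y v
      = -inner ℝ (u z) (fderiv ℝ b (z.1 - y) v) := by
    intro y v
    have h1 := ((hb.differentiable (by simp)) (z.1 - y)).hasFDerivAt.comp y
      ((hasFDerivAt_id y).const_sub z.1)
    have h2 : HasFDerivAt (fun y => inner ℝ (u z) (b (z.1 - y))) _ y :=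
      (innerSL ℝ (u z)).hasFDerivAt.comp y h1
    rw [h2.fderiv]
    simp
  have ht : ∀ w, timeDeriv (fun w : SpaceTime => (η w * θ (z.2 - w.2))
        • inner ℝ (u z) (b (z.1 - w.1))) w
      = (timeDeriv η w * θ (z.2 - w.2) - η w * deriv θ (z.2 - w.2))
        * inner ℝ (u z) (b (z.1 - w.1)) := by
    intro w
    unfold timeDeriv
    rw [hasFDerivAt_mul_smul hη.1 hτ ha, deriv_comp_const_sub]
    simp [sub_eq_add_neg]
  have hs : ∀ j w, spaceDeriv j (fun w : SpaceTime => (η w * θ (z.2 - w.2))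
        • inner ℝ (u z) (b (z.1 - w.1))) w
      = θ (z.2 - w.2) * (spaceDeriv j η w * inner ℝ (u z) (b (z.1 - w.1))
          - η w * inner ℝ (u z) (pairDeriv b (z, w) j)) := by
    intro j w
    unfold spaceDeriv pairDeriv
    rw [hasFDerivAt_mul_smul hη.1 hτ ha, hda]
    simp
    ring
  simp_rw [ht, hs] at hm
  refine Eq.trans ?_ ((congrArg (fun r => η z * dens z * r) hm).trans (mul_zero _))
  rw [← integral_const_mul]
  rfl
end
end

/-! ### Pointwise bounds for the doubled integrands. -/

noncomputable section

lemma abs_coord_le (x : Space3) (i : Fin 3) : |x i| ≤ ‖x‖ := by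
  simpa using PiLp.norm_apply_le x i

lemma abs_convective_pairing_le {r p : ℝ} (hr : 0 ≤ r) (hp : 0 ≤ p) (u : Space3)
    (a : Fin 3 → Space3) :
    |∑ i, ∑ j, (r * u i * u j + p * (1 : Matrix (Fin 3) (Fin 3) ℝ) i j) * a j i|
      ≤ (r * ‖u‖ ^ 2 + p) * ∑ j, ‖a j‖ := by
  have h : ∑ i, ∑ j, (r * u i * u j + p * (1 : Matrix (Fin 3) (Fin 3) ℝ) i j) * a j i
      = ∑ j, (r * u j * inner ℝ u (a j) + p * a j j) := by
    rw [Finset.sum_comm]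
    refine Finset.sum_congr rfl fun j _ => ?_
    simp only [PiLp.inner_apply, RCLike.inner_apply, conj_trivial, add_mul,
      Finset.sum_add_distrib, Finset.mul_sum]
    congr 1
    · exact Finset.sum_congr rfl fun i _ => by ring
    · simp [Matrix.one_apply]
  rw [h, Finset.mul_sum]
  refine (Finset.abs_sum_le_sum_abs _ _).trans (Finset.sum_le_sum fun j _ => ?_)
  have h1 : |r * u j * inner ℝ u (a j)| ≤ r * ‖u‖ * (‖u‖ * ‖a j‖) := by
    rw [abs_mul, abs_mul, abs_of_nonneg hr]
    gcongr
    · exact abs_coord_le u j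
    · exact abs_real_inner_le_norm u (a j)
  have h2 : |p * a j j| ≤ p * ‖a j‖ := by
    rw [abs_mul, abs_of_nonneg hp]
    gcongr
    exact abs_coord_le _ j
  refine (abs_add_le _ _).trans ?_
  linarith

lemma abs_entry_le (D : Matrix (Fin 3) (Fin 3) ℝ) (i j : Fin 3) :
    |D i j| ≤ √(∑ i, ∑ j, D i j ^ 2) := by
  rw [← Real.sqrt_sq_eq_abs]
  refine Real.sqrt_le_sqrt ?_
  calc D i j ^ 2 ≤ ∑ j, D i j ^ 2 :=
        Finset.single_le_sum (f := fun j => D i j ^ 2) (fun _ _ => sq_nonneg _) (Finset.mem_univ j)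
    _ ≤ _ := Finset.single_le_sum (f := fun i => ∑ j, D i j ^ 2)
        (fun _ _ => Finset.sum_nonneg fun _ _ => sq_nonneg _) (Finset.mem_univ i)

lemma abs_viscous_pairing_le (ν₁ ν₂ : ℝ) (D : Matrix (Fin 3) (Fin 3) ℝ) (a : Fin 3 → Space3) :
    |∑ i, ∑ j, viscousStress ν₁ ν₂ D i j * a j i|
      ≤ 3 * (2 * |ν₁| + 3 * |ν₂|) * √(∑ i, ∑ j, D i j ^ 2) * ∑ j, ‖a j‖ := by
  set g := √(∑ i, ∑ j, D i j ^ 2) with hg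
  have hg0 : 0 ≤ g := Real.sqrt_nonneg _
  have hS : ∀ i j, |viscousStress ν₁ ν₂ D i j| ≤ (2 * |ν₁| + 3 * |ν₂|) * g := by
    intro i j
    have h1 : |D i j + D j i| ≤ 2 * g := by
      linarith [abs_add_le (D i j) (D j i), abs_entry_le D i j, abs_entry_le D j i]
    have h2 : |D.trace| ≤ 3 * g := by
      rw [Matrix.trace, Fin.sum_univ_three]
      simp only [Matrix.diag_apply]
      linarith [abs_add_three (D 0 0) (D 1 1) (D 2 2), abs_entry_le D 0 0, abs_entry_le D 1 1,
        abs_entry_le D 2 2]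
    have h3 : |(1 : Matrix (Fin 3) (Fin 3) ℝ) i j| ≤ 1 := by
      by_cases h : i = j <;> simp [Matrix.one_apply, h]
    unfold viscousStress
    simp only [Matrix.add_apply, Matrix.smul_apply, Matrix.transpose_apply, smul_eq_mul]
    calc _ ≤ |ν₁ * (D i j + D j i)| + |ν₂ * D.trace * (1 : Matrix (Fin 3) (Fin 3) ℝ) i j| :=
          abs_add_le _ _
      _ ≤ |ν₁| * (2 * g) + |ν₂| * (3 * g) * 1 := by
          rw [abs_mul, abs_mul, abs_mul]
          gcongr
      _ = _ := by ring
  calc _ ≤ ∑ i : Fin 3, ∑ j : Fin 3, (2 * |ν₁| + 3 * |ν₂|) * g * ‖a j‖ := by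
        refine (Finset.abs_sum_le_sum_abs _ _).trans (Finset.sum_le_sum fun i _ =>
          (Finset.abs_sum_le_sum_abs _ _).trans (Finset.sum_le_sum fun j _ => ?_))
        rw [abs_mul]
        gcongr
        · exact hS i j
        · exact abs_coord_le _ i
    _ = _ := by
        rw [Finset.sum_const, ← Finset.mul_sum]; simp; ring

/-- Density of the quantities controlled by the energy estimate. -/
def energyDensity (m ε : ℝ) (dens : SpaceTime → ℝ) (u : SpaceTime → Space3)
    (Du : SpaceTime → Matrix (Fin 3) (Fin 3) ℝ) (z : SpaceTime) : ℝ :=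
  1 + pressure m ε (dens z) + dens z * ‖u z‖ ^ 2 + (‖u z‖ ^ 2 + ∑ i, ∑ j, Du z i j ^ 2)

lemma rpow_le_pressure {m ε r : ℝ} (hε : 0 < ε) (hr : 0 ≤ r) :
    r ^ (3 / 2 : ℝ) ≤ pressure m ε r := by
  unfold pressure
  refine le_mul_of_one_le_right (by positivity) ?_
  have : 0 ≤ ε * r ^ m := by positivity
  linarith

lemma pressure_nonneg {m ε r : ℝ} (hε : 0 < ε) (hr : 0 ≤ r) : 0 ≤ pressure m ε r :=
  (Real.rpow_nonneg hr _).trans (rpow_le_pressure hε hr)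

lemma le_one_add_pressure {m ε r : ℝ} (hε : 0 < ε) (hr : 0 ≤ r) : r ≤ 1 + pressure m ε r := by
  have h := rpow_le_pressure (m := m) hε hr
  rcases le_total r 1 with h1 | h1
  · linarith [pressure_nonneg (m := m) hε hr]
  · have : r ^ (1 : ℝ) ≤ r ^ (3 / 2 : ℝ) := Real.rpow_le_rpow_of_exponent_le h1 (by norm_num)
    rw [Real.rpow_one] at this
    linarith

section

variable {m ε : ℝ} {dens : SpaceTime → ℝ} {u : SpaceTime → Space3}
    {Du : SpaceTime → Matrix (Fin 3) (Fin 3) ℝ}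

/-- Lower-order quantities are absorbed by the summand `1` and the quadratic terms: `dens ≤ 1 + p`,
`dens |u| ≤ dens + dens |u|²`, `|∇u| ≤ 1 + |∇u|²`. -/
lemma energyDensity_bounds (hε : 0 < ε) (hd : ∀ z, 0 ≤ dens z) (z : SpaceTime) :
    1 ≤ energyDensity m ε dens u Du z ∧ dens z ≤ energyDensity m ε dens u Du z
      ∧ dens z * ‖u z‖ ≤ energyDensity m ε dens u Du z
      ∧ dens z * ‖u z‖ ^ 2 + pressure m ε (dens z) ≤ energyDensity m ε dens u Du z
      ∧ √(∑ i, ∑ j, Du z i j ^ 2) ≤ energyDensity m ε dens u Du z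
      ∧ ∑ i, ∑ j, Du z i j ^ 2 ≤ energyDensity m ε dens u Du z := by
  have h1 := pressure_nonneg (m := m) hε (hd z)
  have h2 := le_one_add_pressure (m := m) hε (hd z)
  have h3 : 0 ≤ dens z * ‖u z‖ ^ 2 := mul_nonneg (hd z) (sq_nonneg _)
  have h4 : 0 ≤ ∑ i, ∑ j, Du z i j ^ 2 :=
    Finset.sum_nonneg fun _ _ => Finset.sum_nonneg fun _ _ => sq_nonneg _
  have h5 := sq_nonneg ‖u z‖
  have h6 : √(∑ i, ∑ j, Du z i j ^ 2) ≤ 1 + ∑ i, ∑ j, Du z i j ^ 2 := by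
    nlinarith [Real.sq_sqrt h4, sq_nonneg (√(∑ i, ∑ j, Du z i j ^ 2) - 1),
      Real.sqrt_nonneg (∑ i, ∑ j, Du z i j ^ 2)]
  have h7 : dens z * ‖u z‖ ≤ dens z + dens z * ‖u z‖ ^ 2 := by
    have := hd z
    nlinarith [sq_nonneg (‖u z‖ - 1), norm_nonneg (u z), mul_nonneg this (sq_nonneg (‖u z‖ - 1)),
      mul_nonneg this (norm_nonneg (u z))]
  unfold energyDensity
  refine ⟨?_, ?_, ?_, ?_, ?_, ?_⟩ <;> linarith

/-- Crude bound that makes the doubled momentum balance integrable. -/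
lemma abs_pairMomentum_le {ν₁ ν₂ F K B Θ : ℝ} {f : SpaceTime → Space3} {η : SpaceTime → ℝ}
    {θ : ℝ → ℝ} {b : Space3 → Space3} (hε : 0 < ε) (hd : ∀ z, 0 ≤ dens z)
    (hF : ∀ z, ‖f z‖ ≤ F) (hη : ∀ z, |η z| ≤ K) (hηt : ∀ z, |timeDeriv η z| ≤ K)
    (hηs : ∀ j z, |spaceDeriv j η z| ≤ K) (hθ : ∀ t, |θ t| ≤ Θ) (hθ' : ∀ t, |deriv θ t| ≤ Θ)
    (hb : ∀ x, ‖b x‖ ≤ B) (hb' : ∀ q j, ‖pairDeriv b q j‖ ≤ B) (q : SpaceTimePair) :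
    |pairMomentum ν₁ ν₂ m ε f dens u Du η θ b q|
      ≤ K * (2 * K * Θ * B + 6 * Θ * K * B * (1 + 3 * (2 * |ν₁| + 3 * |ν₂|)) + K * Θ * (F * B))
        * (energyDensity m ε dens u Du q.1 * energyDensity m ε dens u Du q.2) := by
  obtain ⟨e1, e2, e3, e4, e5, -⟩ := energyDensity_bounds (u := u) (Du := Du) (m := m) hε hd q.1
  obtain ⟨f1, f2, -⟩ := energyDensity_bounds (u := u) (Du := Du) (m := m) hε hd q.2
  set H := energyDensity m ε dens u Du q.1
  set H' := energyDensity m ε dens u Du q.2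
  set bq := b (q.1.1 - q.2.1)
  set t := q.1.2 - q.2.2
  have hK : 0 ≤ K := (abs_nonneg _).trans (hη q.1)
  have hΘ : 0 ≤ Θ := (abs_nonneg _).trans (hθ 0)
  have hB : 0 ≤ B := (norm_nonneg _).trans (hb 0)
  have hF0 : 0 ≤ F := (norm_nonneg _).trans (hF q.1)
  have hdq := hd q.1
  have t1 : |dens q.1 * (timeDeriv η q.1 * θ t + η q.1 * deriv θ t) * inner ℝ (u q.1) bq|
      ≤ 2 * K * Θ * B * H := by
    have a1 : |timeDeriv η q.1 * θ t + η q.1 * deriv θ t| ≤ K * Θ + K * Θ := by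
      refine (abs_add_le _ _).trans ?_
      rw [abs_mul, abs_mul]
      gcongr
      exacts [hηt _, hθ _, hη _, hθ' _]
    have a2 : |inner ℝ (u q.1) bq| ≤ ‖u q.1‖ * B := by
      refine (abs_real_inner_le_norm _ _).trans ?_
      gcongr
      exact hb _
    rw [abs_mul, abs_mul, abs_of_nonneg hdq]
    calc _ ≤ dens q.1 * (K * Θ + K * Θ) * (‖u q.1‖ * B) := by gcongr
      _ = 2 * K * Θ * B * (dens q.1 * ‖u q.1‖) := by ring
      _ ≤ _ := by gcongr
  set a : Fin 3 → Space3 := fun j => θ t • (spaceDeriv j η q.1 • bq + η q.1 • pairDeriv b q j)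
    with ha
  have ha' : ∀ j, ‖a j‖ ≤ 2 * Θ * K * B := by
    intro j
    simp only [ha]
    rw [norm_smul]
    have : ‖spaceDeriv j η q.1 • bq + η q.1 • pairDeriv b q j‖ ≤ K * B + K * B := by
      refine (norm_add_le _ _).trans ?_
      rw [norm_smul, norm_smul]
      gcongr
      exacts [hηs _ _, hb _, hη _, hb' _ _]
    calc _ ≤ Θ * (K * B + K * B) := by
          gcongr
          exact hθ t
      _ = _ := by ring
  have hsum : ∑ j, ‖a j‖ ≤ 6 * Θ * K * B := by
    rw [Fin.sum_univ_three]; linarith [ha' 0, ha' 1, ha' 2]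
  have t2 : ∑ i, ∑ j, (dens q.1 * u q.1 i * u q.1 j
          + pressure m ε (dens q.1) * (1 : Matrix (Fin 3) (Fin 3) ℝ) i j
          - viscousStress ν₁ ν₂ (Du q.1) i j) * (θ t
            * (spaceDeriv j η q.1 * bq i + η q.1 * pairDeriv b q j i))
      = ∑ i, ∑ j, (dens q.1 * u q.1 i * u q.1 j
          + pressure m ε (dens q.1) * (1 : Matrix (Fin 3) (Fin 3) ℝ) i j) * a j i
        - ∑ i, ∑ j, viscousStress ν₁ ν₂ (Du q.1) i j * a j i := by
    rw [← Finset.sum_sub_distrib]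
    refine Finset.sum_congr rfl fun i _ => ?_
    rw [← Finset.sum_sub_distrib]
    refine Finset.sum_congr rfl fun j _ => ?_
    simp only [ha, PiLp.smul_apply, PiLp.add_apply, smul_eq_mul]
    ring
  have t3 := abs_convective_pairing_le hdq (pressure_nonneg (m := m) hε hdq) (u q.1) a
  have t4 := abs_viscous_pairing_le ν₁ ν₂ (Du q.1) a
  have t5 : (dens q.1 * ‖u q.1‖ ^ 2 + pressure m ε (dens q.1)) * ∑ j, ‖a j‖
      ≤ H * (6 * Θ * K * B) := by
    have := Finset.sum_nonneg (s := Finset.univ) fun (j : Fin 3) _ => norm_nonneg (a j)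
    gcongr
  have t6 : 3 * (2 * |ν₁| + 3 * |ν₂|) * √(∑ i, ∑ j, Du q.1 i j ^ 2) * ∑ j, ‖a j‖
      ≤ 3 * (2 * |ν₁| + 3 * |ν₂|) * H * (6 * Θ * K * B) := by
    gcongr
  have t7 : |dens q.1 * (η q.1 * θ t) * inner ℝ (f q.1) bq| ≤ K * Θ * (F * B) * H := by
    rw [abs_mul, abs_mul, abs_mul, abs_of_nonneg hdq]
    calc _ ≤ H * (K * Θ) * (F * B) := by
          gcongr
          · exact hη _
          · exact hθ _
          · refine (abs_real_inner_le_norm _ _).trans ?_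
            gcongr
            exacts [hF _, hb _]
      _ = _ := by ring
  unfold pairMomentum
  rw [abs_mul, abs_mul, abs_of_nonneg (hd q.2), t2]
  calc _ ≤ K * H' * (2 * K * Θ * B * H + (H * (6 * Θ * K * B)
        + 3 * (2 * |ν₁| + 3 * |ν₂|) * H * (6 * Θ * K * B)) + K * Θ * (F * B) * H) := by
        have hd2 := hd q.2
        have hη2 := hη q.2
        refine mul_le_mul (by gcongr) ?_ (abs_nonneg _) (by positivity)
        refine (abs_add_le _ _).trans (add_le_add ((abs_add_le _ _).trans (add_le_add t1
          ((abs_sub _ _).trans (add_le_add (t3.trans t5) (t4.trans t6))))) t7)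
    _ = _ := by ring

/-- Crude bound that makes the doubled mass balance integrable. -/
lemma abs_pairMass_le {K B Θ : ℝ} {η : SpaceTime → ℝ}
    {θ : ℝ → ℝ} {b : Space3 → Space3} (hε : 0 < ε) (hd : ∀ z, 0 ≤ dens z)
    (hη : ∀ z, |η z| ≤ K) (hηt : ∀ z, |timeDeriv η z| ≤ K)
    (hηs : ∀ j z, |spaceDeriv j η z| ≤ K) (hθ : ∀ t, |θ t| ≤ Θ) (hθ' : ∀ t, |deriv θ t| ≤ Θ)
    (hb : ∀ x, ‖b x‖ ≤ B) (hb' : ∀ q j, ‖pairDeriv b q j‖ ≤ B) (q : SpaceTimePair) :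
    |pairMass dens u η θ b q| ≤ 8 * K ^ 2 * Θ * B
        * (energyDensity m ε dens u Du q.1 * energyDensity m ε dens u Du q.2) := by
  obtain ⟨e1, e2, e3, -⟩ := energyDensity_bounds (u := u) (Du := Du) (m := m) hε hd q.1
  obtain ⟨f1, f2, f3, -⟩ := energyDensity_bounds (u := u) (Du := Du) (m := m) hε hd q.2
  set H := energyDensity m ε dens u Du q.1
  set H' := energyDensity m ε dens u Du q.2
  set bq := b (q.1.1 - q.2.1)
  set t := q.1.2 - q.2.2
  have hK : 0 ≤ K := (abs_nonneg _).trans (hη q.1)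
  have hΘ : 0 ≤ Θ := (abs_nonneg _).trans (hθ 0)
  have hB : 0 ≤ B := (norm_nonneg _).trans (hb 0)
  have hd1 := hd q.1
  have hd2 := hd q.2
  have hin : ∀ x : Space3, ‖x‖ ≤ B → |inner ℝ (u q.1) x| ≤ ‖u q.1‖ * B := fun x hx =>
    (abs_real_inner_le_norm _ _).trans (by gcongr)
  have t1 : |dens q.2 * ((timeDeriv η q.2 * θ t - η q.2 * deriv θ t) * inner ℝ (u q.1) bq)|
      ≤ H' * (2 * K * Θ * (‖u q.1‖ * B)) := by
    rw [abs_mul, abs_mul, abs_of_nonneg hd2]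
    have a1 : |timeDeriv η q.2 * θ t - η q.2 * deriv θ t| ≤ 2 * K * Θ := by
      refine (abs_sub _ _).trans ?_
      rw [abs_mul, abs_mul]
      have : |timeDeriv η q.2| * |θ t| ≤ K * Θ := by gcongr; exacts [hηt _, hθ _]
      have : |η q.2| * |deriv θ t| ≤ K * Θ := by gcongr; exacts [hη _, hθ' _]
      linarith
    gcongr
    exact hin _ (hb _)
  have t2 : ∀ j, |dens q.2 * u q.2 j * (θ t * (spaceDeriv j η q.2 * inner ℝ (u q.1) bq
          - η q.2 * inner ℝ (u q.1) (pairDeriv b q j)))|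
      ≤ H' * (2 * K * Θ * (‖u q.1‖ * B)) := by
    intro j
    rw [abs_mul, abs_mul, abs_mul, abs_of_nonneg hd2]
    have a0 : dens q.2 * |u q.2 j| ≤ H' :=
      (mul_le_mul_of_nonneg_left (abs_coord_le _ j) hd2).trans f3
    have a1 : |spaceDeriv j η q.2 * inner ℝ (u q.1) bq
          - η q.2 * inner ℝ (u q.1) (pairDeriv b q j)| ≤ 2 * K * (‖u q.1‖ * B) := by
      refine (abs_sub _ _).trans ?_
      rw [abs_mul, abs_mul]
      have : |spaceDeriv j η q.2| * |inner ℝ (u q.1) bq| ≤ K * (‖u q.1‖ * B) := by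
        gcongr; exacts [hηs _ _, hin _ (hb _)]
      have : |η q.2| * |inner ℝ (u q.1) (pairDeriv b q j)| ≤ K * (‖u q.1‖ * B) := by
        gcongr; exacts [hη _, hin _ (hb' _ _)]
      linarith
    calc _ ≤ H' * (Θ * (2 * K * (‖u q.1‖ * B))) := by
          gcongr
          exact hθ _
      _ = _ := by ring
  unfold pairMass
  rw [abs_mul, abs_mul, abs_of_nonneg hd1]
  calc _ ≤ K * dens q.1 * (H' * (2 * K * Θ * (‖u q.1‖ * B))
        + ∑ _j : Fin 3, H' * (2 * K * Θ * (‖u q.1‖ * B))) := by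
        have hη1 := hη q.1
        refine mul_le_mul (by gcongr) ?_ (abs_nonneg _) (by positivity)
        exact (abs_add_le _ _).trans (add_le_add t1
          ((Finset.abs_sum_le_sum_abs _ _).trans (Finset.sum_le_sum fun j _ => t2 j)))
    _ = 8 * K ^ 2 * Θ * B * ((dens q.1 * ‖u q.1‖) * H') := by
        simp; ring
    _ ≤ _ := by gcongr
end
end

/-! ### Cancellations in the sum of the doubled balance laws. -/

noncomputable section

/-- The part of the doubled convective term that becomes a quadratic form in the velocity
difference after symmetrization. -/
def convexTerm (dens : SpaceTime → ℝ) (u : SpaceTime → Space3) (η : SpaceTime → ℝ) (θ : ℝ → ℝ)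
    (b : Space3 → Space3) (q : SpaceTimePair) : ℝ :=
  θ (q.1.2 - q.2.2) * (η q.1 * η q.2 * (dens q.1 * dens q.2)
    * inner ℝ (u q.1) (fderiv ℝ b (q.1.1 - q.2.1) (u q.1 - u q.2)))

lemma fderiv_eq_sum_pairDeriv (b : Space3 → Space3) (q : SpaceTimePair) (w : Space3) :
    fderiv ℝ b (q.1.1 - q.2.1) w = ∑ j, w j • pairDeriv b q j := by
  have hx : w = ∑ j : Fin 3, w j • (EuclideanSpace.single j (1 : ℝ) : Space3) := by
    ext i; simp [Fin.sum_univ_three]; fin_cases i <;> simp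
  conv_lhs => rw [hx]
  simp [pairDeriv]

section

variable {m ε : ℝ} {dens : SpaceTime → ℝ} {u : SpaceTime → Space3}
    {Du : SpaceTime → Matrix (Fin 3) (Fin 3) ℝ}

set_option maxHeartbeats 1000000 in
-- Apart from the convective form and the divergence term, every contribution contains a derivative
-- of the cut-off, the force, or the viscous stress. The first two see only the size `Λ` of the
-- field; the viscous stress also meets its gradient, of size `k`, but is linear in `∇u`.
lemma abs_doubled_remainder_le {ν₁ ν₂ F K Λ k : ℝ} {f : SpaceTime → Space3} {η : SpaceTime → ℝ}
    {θ : ℝ → ℝ} {b : Space3 → Space3} (hε : 0 < ε) (hd : ∀ z, 0 ≤ dens z)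
    (hF : ∀ z, ‖f z‖ ≤ F) (hη : ∀ z, |η z| ≤ K) (hηt : ∀ z, |timeDeriv η z| ≤ K)
    (hηs : ∀ j z, |spaceDeriv j η z| ≤ K) (hθ : ∀ t, 0 ≤ θ t) (q : SpaceTimePair)
    (hb : ‖b (q.1.1 - q.2.1)‖ ≤ Λ) (hb' : ∀ j, ‖pairDeriv b q j‖ ≤ 3 * k) :
    |pairMomentum ν₁ ν₂ m ε f dens u Du η θ b q + pairMass dens u η θ b q
        - convexTerm dens u η θ b q
        - θ (q.1.2 - q.2.2) * (η q.1 * η q.2 * (pressure m ε (dens q.1) * dens q.2)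
          * ∑ j, pairDeriv b q j j)|
      ≤ K ^ 2 * (11 + 36 * (2 * |ν₁| + 3 * |ν₂|) + F) * (θ (q.1.2 - q.2.2)
        * (energyDensity m ε dens u Du q.1 * (dens q.2 * Λ)
          + energyDensity m ε dens u Du q.2 * (dens q.1 * Λ)
          + √(∑ i, ∑ j, Du q.1 i j ^ 2) * (dens q.2 * k))) := by
  obtain ⟨e1, e2, e3, e4, e5, -⟩ := energyDensity_bounds (u := u) (Du := Du) (m := m) hε hd q.1
  obtain ⟨f1, f2, f3, f4, -⟩ := energyDensity_bounds (u := u) (Du := Du) (m := m) hε hd q.2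
  have hp1 := pressure_nonneg (m := m) hε (hd q.1)
  have hp2 := pressure_nonneg (m := m) hε (hd q.2)
  set H := energyDensity m ε dens u Du q.1
  set H' := energyDensity m ε dens u Du q.2
  set bq := b (q.1.1 - q.2.1) with hbq
  set t := q.1.2 - q.2.2 with ht
  set g := √(∑ i, ∑ j, Du q.1 i j ^ 2) with hg
  have hg0 : 0 ≤ g := Real.sqrt_nonneg _
  have hK : 0 ≤ K := (abs_nonneg _).trans (hη q.1)
  have hΛ : 0 ≤ Λ := (norm_nonneg _).trans hb
  have hk : 0 ≤ k := by linarith [(norm_nonneg _).trans (hb' 0)]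
  have hF0 : 0 ≤ F := (norm_nonneg _).trans (hF q.1)
  have hd1 := hd q.1
  have hd2 := hd q.2
  have hη1 := hη q.1
  have hη2 := hη q.2
  set c := 2 * |ν₁| + 3 * |ν₂| with hc
  have hc0 : 0 ≤ c := by positivity
  set a₁ : Fin 3 → Space3 := fun j => spaceDeriv j η q.1 • bq with ha₁
  set a₂ : Fin 3 → Space3 := fun j => spaceDeriv j η q.1 • bq + η q.1 • pairDeriv b q j with ha₂
  set R1 := η q.2 * dens q.2 * (dens q.1 * timeDeriv η q.1 * inner ℝ (u q.1) bq) with hR1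
  set R2 := η q.2 * dens q.2 * ∑ i, ∑ j, (dens q.1 * u q.1 i * u q.1 j
    + pressure m ε (dens q.1) * (1 : Matrix (Fin 3) (Fin 3) ℝ) i j) * a₁ j i with hR2
  set R3 := η q.2 * dens q.2 * ∑ i, ∑ j, viscousStress ν₁ ν₂ (Du q.1) i j * a₂ j i with hR3
  set R4 := η q.2 * dens q.2 * (dens q.1 * η q.1 * inner ℝ (f q.1) bq) with hR4
  set R5 := η q.1 * dens q.1 * (dens q.2 * (timeDeriv η q.2 * inner ℝ (u q.1) bq)) with hR5
  set R6 := η q.1 * dens q.1 * ∑ j, dens q.2 * u q.2 j * (spaceDeriv j η q.2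
    * inner ℝ (u q.1) bq) with hR6
  -- `θ'` enters the two balance laws with opposite signs and drops out. Of the remainder, `R1` and
  -- `R5` stem from the time derivative of the cut-off, `R2` and `R6` from its space derivatives,
  -- `R3` from the viscous stress and `R4` from the force.
  have hdecomp : pairMomentum ν₁ ν₂ m ε f dens u Du η θ b q + pairMass dens u η θ b q
        - convexTerm dens u η θ b q
        - θ t * (η q.1 * η q.2 * (pressure m ε (dens q.1) * dens q.2) * ∑ j, pairDeriv b q j j)
      = θ t * (R1 + R2 - R3 + R4 + R5 + R6) := by
    unfold convexTerm pairMomentum pairMass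
    rw [fderiv_eq_sum_pairDeriv]
    simp only [hR1, hR2, hR3, hR4, hR5, hR6, ha₁, ha₂, ← ht, ← hbq, Fin.sum_univ_three,
      PiLp.inner_apply, RCLike.inner_apply, conj_trivial, PiLp.add_apply, PiLp.smul_apply,
      PiLp.sub_apply, smul_eq_mul, Matrix.one_apply]
    simp
    ring
  have hin : |inner ℝ (u q.1) bq| ≤ ‖u q.1‖ * Λ :=
    (abs_real_inner_le_norm _ _).trans (by gcongr)
  have b1 : |R1| ≤ K ^ 2 * (H * (dens q.2 * Λ)) := by
    rw [hR1, abs_mul, abs_mul, abs_mul, abs_mul, abs_of_nonneg hd1, abs_of_nonneg hd2]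
    calc _ ≤ K * dens q.2 * (dens q.1 * K * (‖u q.1‖ * Λ)) := by
          gcongr
          exact hηt _
      _ = K ^ 2 * ((dens q.1 * ‖u q.1‖) * (dens q.2 * Λ)) := by ring
      _ ≤ _ := by gcongr
  have hsa₁ : ∑ j, ‖a₁ j‖ ≤ 3 * (K * Λ) := by
    have : ∀ j, ‖a₁ j‖ ≤ K * Λ := fun j => by
      simp only [ha₁]; rw [norm_smul]; gcongr; exact hηs _ _
    rw [Fin.sum_univ_three]; linarith [this 0, this 1, this 2]
  have hsa₂ : ∑ j, ‖a₂ j‖ ≤ 3 * (K * Λ + K * (3 * k)) := by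
    have : ∀ j, ‖a₂ j‖ ≤ K * Λ + K * (3 * k) := fun j => by
      simp only [ha₂]
      refine (norm_add_le _ _).trans ?_
      rw [norm_smul, norm_smul]
      gcongr
      exacts [hηs _ _, hη1, hb' j]
    rw [Fin.sum_univ_three]; linarith [this 0, this 1, this 2]
  have b2 : |R2| ≤ 3 * K ^ 2 * (H * (dens q.2 * Λ)) := by
    rw [hR2, abs_mul, abs_mul, abs_of_nonneg hd2]
    calc _ ≤ K * dens q.2 * (H * (3 * (K * Λ))) := by
          gcongr
          refine (abs_convective_pairing_le hd1 hp1 (u q.1) a₁).trans ?_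
          gcongr
      _ = _ := by ring
  have b3 : |R3| ≤ 9 * c * K ^ 2 * (H * (dens q.2 * Λ)) + 27 * c * K ^ 2 * (g * (dens q.2 * k)) := by
    rw [hR3, abs_mul, abs_mul, abs_of_nonneg hd2]
    calc _ ≤ K * dens q.2 * (3 * c * g * (3 * (K * Λ + K * (3 * k)))) := by
          gcongr
          refine (abs_viscous_pairing_le ν₁ ν₂ (Du q.1) a₂).trans ?_
          gcongr
      _ = 9 * c * K ^ 2 * (g * (dens q.2 * Λ)) + 27 * c * K ^ 2 * (g * (dens q.2 * k)) := by ring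
      _ ≤ _ := by gcongr
  have b4 : |R4| ≤ F * K ^ 2 * (H * (dens q.2 * Λ)) := by
    rw [hR4, abs_mul, abs_mul, abs_mul, abs_mul, abs_of_nonneg hd1, abs_of_nonneg hd2]
    calc _ ≤ K * dens q.2 * (H * K * (F * Λ)) := by
          gcongr
          refine (abs_real_inner_le_norm _ _).trans ?_
          gcongr
          exact hF _
      _ = _ := by ring
  have b5 : |R5| ≤ K ^ 2 * (H * (dens q.2 * Λ)) := by
    rw [hR5, abs_mul, abs_mul, abs_mul, abs_mul, abs_of_nonneg hd1, abs_of_nonneg hd2]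
    calc _ ≤ K * dens q.1 * (dens q.2 * (K * (‖u q.1‖ * Λ))) := by
          gcongr
          exact hηt _
      _ = K ^ 2 * ((dens q.1 * ‖u q.1‖) * (dens q.2 * Λ)) := by ring
      _ ≤ _ := by gcongr
  -- This is the only remainder with both velocities. Their product is split so that each square
  -- meets the density at its own point, whence the term with `H'`.
  have b6 : |R6| ≤ 3 * K ^ 2 * (H * (dens q.2 * Λ) + H' * (dens q.1 * Λ)) := by
    rw [hR6, abs_mul, abs_mul, abs_of_nonneg hd1]
    have hj : ∀ j, |dens q.2 * u q.2 j * (spaceDeriv j η q.2 * inner ℝ (u q.1) bq)|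
        ≤ dens q.2 * ‖u q.2‖ * (K * (‖u q.1‖ * Λ)) := by
      intro j
      rw [abs_mul, abs_mul, abs_mul, abs_of_nonneg hd2]
      gcongr
      exacts [abs_coord_le _ j, hηs _ _]
    have hsum : |∑ j, dens q.2 * u q.2 j * (spaceDeriv j η q.2 * inner ℝ (u q.1) bq)|
        ≤ 3 * (dens q.2 * ‖u q.2‖ * (K * (‖u q.1‖ * Λ))) := by
      refine (Finset.abs_sum_le_sum_abs _ _).trans ?_
      rw [Fin.sum_univ_three]; linarith [hj 0, hj 1, hj 2]
    calc _ ≤ K * dens q.1 * (3 * (dens q.2 * ‖u q.2‖ * (K * (‖u q.1‖ * Λ)))) := by gcongr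
      _ = 3 * K ^ 2 * Λ * (dens q.1 * dens q.2) * (‖u q.1‖ * ‖u q.2‖) := by ring
      _ ≤ 3 * K ^ 2 * Λ * (dens q.1 * dens q.2) * (‖u q.1‖ ^ 2 + ‖u q.2‖ ^ 2) := by
          gcongr
          nlinarith [sq_nonneg (‖u q.1‖ - ‖u q.2‖), sq_nonneg (‖u q.1‖ + ‖u q.2‖)]
      _ = 3 * K ^ 2 * ((dens q.1 * ‖u q.1‖ ^ 2) * (dens q.2 * Λ)
            + (dens q.2 * ‖u q.2‖ ^ 2) * (dens q.1 * Λ)) := by ring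
      _ ≤ _ := by
          gcongr <;> linarith
  rw [hdecomp, abs_mul, abs_of_nonneg (hθ t), mul_left_comm]
  refine mul_le_mul_of_nonneg_left ?_ (hθ t)
  have hsum : |R1 + R2 - R3 + R4 + R5 + R6| ≤ |R1| + |R2| + |R3| + |R4| + |R5| + |R6| := by
    have h1 := abs_add_le (R1 + R2 - R3 + R4 + R5) R6
    have h2 := abs_add_le (R1 + R2 - R3 + R4) R5
    have h3 := abs_add_le (R1 + R2 - R3) R4
    have h4 := abs_sub (R1 + R2) R3
    have h5 := abs_add_le R1 R2
    linarith
  have p1 : 0 ≤ K ^ 2 * (H * (dens q.2 * Λ)) := by positivity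
  have p2 : 0 ≤ K ^ 2 * (H' * (dens q.1 * Λ)) := by positivity
  have p3 : 0 ≤ K ^ 2 * (g * (dens q.2 * k)) := by positivity
  nlinarith [mul_nonneg hc0 p1, mul_nonneg hc0 p2, mul_nonneg hc0 p3, mul_nonneg hF0 p2,
    mul_nonneg hF0 p3]
end
end

/-! ### Absorption of the kinetic terms by the pressure. -/

noncomputable section

/-- Young's inequality for the weights 2/5 and 3/5, stated with fifth powers to avoid fractional
exponents. -/
lemma le_of_pow_five_le {X G S c δ M : ℝ} (hG : 0 ≤ G) (hS : 0 ≤ S) (hδ : 0 ≤ δ)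
    (hM : 0 ≤ M) (hX : X ^ 5 ≤ c * G ^ 2 * S ^ 3) (hc : c ≤ δ ^ 2 * M ^ 3) :
    X ≤ δ * G + M * S := by
  by_contra! h
  have h1 : (δ * G + M * S) ^ 5 < X ^ 5 := by gcongr
  have h2 : (δ * G) ^ 2 * (M * S) ^ 3 ≤ (δ * G + M * S) ^ 5 := by
    have a : δ * G ≤ δ * G + M * S := by have : 0 ≤ M * S := by positivity
                                         linarith
    have b : M * S ≤ δ * G + M * S := by have : 0 ≤ δ * G := by positivity
                                         linarith
    calc _ ≤ (δ * G + M * S) ^ 2 * (δ * G + M * S) ^ 3 := by gcongr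
      _ = _ := by ring
  have h3 : c * (G ^ 2 * S ^ 3) ≤ δ ^ 2 * M ^ 3 * (G ^ 2 * S ^ 3) := by gcongr
  nlinarith

/-- Young's inequality for the exponents 3/2 and 3, by comparing `b` with `√a`. -/
lemma mul_le_rpow_add_cube {a b : ℝ} (ha : 0 ≤ a) (hb : 0 ≤ b) :
    a * b ≤ a ^ (3 / 2 : ℝ) + b ^ 3 := by
  have h32 : a ^ (3 / 2 : ℝ) = a * √a := by
    rw [Real.sqrt_eq_rpow, show (3 / 2 : ℝ) = 1 + 1 / 2 by norm_num,
      Real.rpow_add_of_nonneg ha (by norm_num) (by norm_num), Real.rpow_one]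
  rcases le_total b (√a) with h | h
  · have : a * b ≤ a * √a := by gcongr
    rw [h32]; have : 0 ≤ b ^ 3 := by positivity
    linarith
  · have h1 : a ≤ b ^ 2 := by
      rw [← Real.sq_sqrt ha]; gcongr
    have h2 : a * b ≤ b ^ 2 * b := by gcongr
    have : 0 ≤ a ^ (3 / 2 : ℝ) := by positivity
    nlinarith

/-- Both remainders are subcritical: only the part `s⁻¹` of the kernel is needed, since logarithms
cost less than any power. The first bound is Young's inequality with `logWeight ^ (3α) ≤ C s⁻¹`. The
second splits the product of `g` and the profile with weights `s ^ (-1/8)` and `s ^ (1/8)`; then `(s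
^ (-1/4))³` and `logWeight ^ (2α) s ^ (-3/4)` are both at most `C s⁻¹` for `s ≤ D`. -/
lemma exists_kernel_absorption {α : ℝ} (hα : 0 < α) (D : ℝ) : ∃ C : ℝ, 0 ≤ C ∧
    ∀ s, 0 < s → s ≤ D → ∀ r p g : ℝ, 0 ≤ r → r ^ (3 / 2 : ℝ) ≤ p → 0 ≤ g →
      r * logWeight s ^ α ≤ C * (p + singularKernel α s) ∧
      g * (r * radialProfile α s)
        ≤ C * (g ^ 2 * (p + singularKernel α s) + r * singularKernel α s) := by
  obtain ⟨C₁, hC₁, h₁⟩ := exists_logWeight_rpow_le (α := 3 * α) (τ := 1) (by linarith) one_pos D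
  obtain ⟨C₂, hC₂, h₂⟩ := exists_logWeight_rpow_le (α := 2 * α) (τ := 1 / 4) (by linarith)
    (by norm_num) D
  refine ⟨1 + C₁ + C₂ + (1 + |D|), by positivity, fun s hs hsD r p g hr hp hg => ?_⟩
  have hL := logWeight_pos hs
  have hD : 0 < D := hs.trans_le hsD
  have hk : s⁻¹ ≤ singularKernel α s := by
    unfold singularKernel
    have : 0 ≤ s ^ (-(3 / 2) : ℝ) * logWeight s ^ (3 * α - 5) := by positivity
    linarith
  have hk0 := singularKernel_pos α hs
  have hp0 : 0 ≤ p := (Real.rpow_nonneg hr _).trans hp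
  have hinv : s ^ (-1 : ℝ) = s⁻¹ := Real.rpow_neg_one s
  rw [abs_of_pos hD]
  constructor
  · have h3 : (logWeight s ^ α) ^ 3 ≤ C₁ * singularKernel α s := by
      rw [← Real.rpow_natCast, ← Real.rpow_mul hL.le, mul_comm]
      refine (h₁ s hs hsD).trans ?_
      rw [hinv]; gcongr
    have h4 := mul_le_rpow_add_cube hr (Real.rpow_nonneg hL.le α)
    nlinarith [mul_nonneg hC₁.le hp0, mul_nonneg hC₂.le hp0, mul_nonneg hC₂.le hk0.le,
      mul_nonneg hD.le hk0.le, mul_nonneg hD.le hp0]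
  · have h5 : r * s ^ (-(1 / 4) : ℝ) ≤ p + (1 + D) * singularKernel α s := by
      have h6 := mul_le_rpow_add_cube hr (Real.rpow_nonneg hs.le (-(1 / 4) : ℝ))
      have h7 : (s ^ (-(1 / 4) : ℝ)) ^ 3 ≤ (1 + D) * s⁻¹ := by
        rw [← Real.rpow_natCast, ← Real.rpow_mul hs.le, ← hinv,
          show (-(1 / 4) : ℝ) * ((3 : ℕ) : ℝ) = -1 + 1 / 4 by norm_num, Real.rpow_add hs, mul_comm]
        gcongr
        calc s ^ (1 / 4 : ℝ) ≤ (1 + D) ^ (1 / 4 : ℝ) := by gcongr; linarith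
          _ ≤ (1 + D) ^ (1 : ℝ) := Real.rpow_le_rpow_of_exponent_le (by linarith) (by norm_num)
          _ = 1 + D := Real.rpow_one _
      have h8 : (1 + D) * s⁻¹ ≤ (1 + D) * singularKernel α s := by gcongr
      linarith
    have h9 : radialProfile α s ^ 2 * s ^ (1 / 4 : ℝ) ≤ C₂ * singularKernel α s := by
      unfold radialProfile
      have e1 : (logWeight s ^ α) ^ 2 = logWeight s ^ (2 * α) := by
        rw [← Real.rpow_natCast, ← Real.rpow_mul hL.le, mul_comm]; norm_num
      have e2 : (s ^ (-(1 / 2) : ℝ)) ^ 2 * s ^ (1 / 4 : ℝ) = s ^ (1 / 4 : ℝ) * s⁻¹ := by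
        rw [← Real.rpow_natCast, ← Real.rpow_mul hs.le, ← hinv, mul_comm]; norm_num
      rw [mul_pow, e1, mul_assoc, e2]
      calc _ ≤ C₂ * s ^ (-(1 / 4) : ℝ) * (s ^ (1 / 4 : ℝ) * s⁻¹) := by
            gcongr
            exact h₂ s hs hsD
        _ = C₂ * (s ^ (-(1 / 4) : ℝ) * s ^ (1 / 4 : ℝ)) * s⁻¹ := by ring
        _ = C₂ * s⁻¹ := by rw [← Real.rpow_add hs]; norm_num
        _ ≤ _ := by gcongr
    have h10 : g * radialProfile α s ≤ g ^ 2 * s ^ (-(1 / 4) : ℝ)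
        + radialProfile α s ^ 2 * s ^ (1 / 4 : ℝ) := by
      have e3 : s ^ (-(1 / 4) : ℝ) * s ^ (1 / 4 : ℝ) = 1 := by
        rw [← Real.rpow_add hs]; norm_num
      set A := s ^ (-(1 / 8) : ℝ) with hA
      set B := s ^ (1 / 8 : ℝ) with hB
      have e4 : A * B = 1 := by rw [hA, hB, ← Real.rpow_add hs]; norm_num
      have e5 : s ^ (-(1 / 4) : ℝ) = A ^ 2 := by
        rw [hA, ← Real.rpow_natCast, ← Real.rpow_mul hs.le]; norm_num
      have e6 : s ^ (1 / 4 : ℝ) = B ^ 2 := by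
        rw [hB, ← Real.rpow_natCast, ← Real.rpow_mul hs.le]; norm_num
      rw [e5, e6]
      have hpos := (radialProfile_pos α hs).le
      calc g * radialProfile α s = (g * A) * (radialProfile α s * B) := by
            rw [show (g * A) * (radialProfile α s * B) = g * radialProfile α s * (A * B) by ring,
              e4, mul_one]
        _ ≤ (g * A) ^ 2 + (radialProfile α s * B) ^ 2 := by
            nlinarith [sq_nonneg (g * A - radialProfile α s * B),
              sq_nonneg (g * A + radialProfile α s * B)]
        _ = _ := by ring
    calc g * (r * radialProfile α s) = r * (g * radialProfile α s) := by ring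
      _ ≤ r * (g ^ 2 * s ^ (-(1 / 4) : ℝ) + radialProfile α s ^ 2 * s ^ (1 / 4 : ℝ)) := by gcongr
      _ = g ^ 2 * (r * s ^ (-(1 / 4) : ℝ)) + r * (radialProfile α s ^ 2 * s ^ (1 / 4 : ℝ)) := by
          ring
      _ ≤ g ^ 2 * (p + (1 + D) * singularKernel α s) + r * (C₂ * singularKernel α s) := by gcongr
      _ ≤ _ := by
          have q1 : 0 ≤ g ^ 2 * p := by positivity
          have q2 : 0 ≤ g ^ 2 * singularKernel α s := by positivity
          have q3 : 0 ≤ r * singularKernel α s := by positivity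
          nlinarith [mul_nonneg hC₁.le q1, mul_nonneg hC₂.le q1, mul_nonneg hD.le q1,
            mul_nonneg hC₁.le q2, mul_nonneg hC₂.le q2, mul_nonneg hC₁.le q3, mul_nonneg hD.le q3]

/-- Distribution of exponents: of `r⁵ r'⁵ n¹⁰`, the pressure factor squared takes `r³ ≤ p²` and
`r'²`; the velocity density takes `(r n²)² n⁶`, in which the powers of `N` cancel; and `r'³ ≤ p'²`
is left for the second point. The cut-offs require 18 powers of `κ` and 8 of `κ'` out of 20 each, so
`κ² κ'¹² ≤ K¹⁴` remains. The fourth power of the cut-off leaves this room. -/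
lemma pow_five_kinetic_le {α s κ κ' K r r' p p' n N : ℝ} (hs : 0 < s) (hκ : 0 ≤ κ) (hκK : κ ≤ K)
    (hκ' : 0 ≤ κ') (hκK' : κ' ≤ K) (hr : 0 ≤ r) (hr' : 0 ≤ r') (hp : r ^ (3 / 2 : ℝ) ≤ p)
    (hp' : r' ^ (3 / 2 : ℝ) ≤ p') (hN : 0 < N) :
    (κ ^ 4 * κ' ^ 4 * (r * r') * n ^ 2 * radialProfile (α - 1) s) ^ 5
      ≤ K ^ 14 * (κ ^ 4 * κ' ^ 4 * (p * r') * radialProfile α s) ^ 2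
        * ((N * (r * (κ * n) ^ 2) + (κ * n) ^ 6 / N ^ 2) * (p' + singularKernel α s)) ^ 3 := by
  have hL := logWeight_pos hs
  have hK : 0 ≤ K := hκ.trans hκK
  set a := N * (r * (κ * n) ^ 2) with ha
  set b := (κ * n) ^ 6 / N ^ 2 with hb
  set d := s ^ (-(3 / 2) : ℝ) * logWeight s ^ (3 * α - 5) with hd
  have ha0 : 0 ≤ a := by positivity
  have hb0 : 0 ≤ b := by positivity
  have hd0 : 0 ≤ d := by positivity
  have hdk : d ≤ singularKernel α s := by
    unfold singularKernel
    have : 0 ≤ s⁻¹ := by positivity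
    linarith
  have hp0 : 0 ≤ p := (Real.rpow_nonneg hr _).trans hp
  have hp0' : 0 ≤ p' := (Real.rpow_nonneg hr' _).trans hp'
  have hsq : ∀ {x y : ℝ}, 0 ≤ x → x ^ (3 / 2 : ℝ) ≤ y → x ^ 3 ≤ y ^ 2 := by
    intro x y hx hxy
    calc x ^ 3 = (x ^ (3 / 2 : ℝ)) ^ 2 := by
          rw [← Real.rpow_natCast, ← Real.rpow_natCast, ← Real.rpow_mul hx]; norm_num
      _ ≤ y ^ 2 := by gcongr
  have h1 : a ^ 2 * b ≤ (a + b) ^ 3 := by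
    have : (a + b) ^ 3 = a ^ 2 * b + (a ^ 3 + 2 * (a ^ 2 * b) + 3 * (a * b ^ 2) + b ^ 3) := by ring
    rw [this]; have : 0 ≤ a ^ 3 + 2 * (a ^ 2 * b) + 3 * (a * b ^ 2) + b ^ 3 := by positivity
    linarith
  have h2 : p' ^ 2 * d ≤ (p' + singularKernel α s) ^ 3 := by
    have hk0 := (singularKernel_pos α hs).le
    calc p' ^ 2 * d ≤ (p' + singularKernel α s) ^ 2 * (p' + singularKernel α s) := by
          gcongr <;> linarith
      _ = _ := by ring
  -- This identity dictates the second summand of `singularKernel`: `5 (α - 1) = 2α + (3α - 5)` for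
  -- the logarithm and `-5/2 = -1 - 3/2` for the power.
  have h3 : radialProfile (α - 1) s ^ 5 = radialProfile α s ^ 2 * d := by
    unfold radialProfile
    simp only [hd, mul_pow]
    simp only [← Real.rpow_natCast]
    rw [← Real.rpow_mul hL.le, ← Real.rpow_mul hs.le, ← Real.rpow_mul hL.le, ← Real.rpow_mul hs.le]
    have e1 : logWeight s ^ ((α - 1) * ((5 : ℕ) : ℝ))
        = logWeight s ^ (α * ((2 : ℕ) : ℝ)) * logWeight s ^ (3 * α - 5) := by
      rw [← Real.rpow_add hL]; congr 1; push_cast; ring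
    have e2 : s ^ (-(1 / 2) * ((5 : ℕ) : ℝ)) = s ^ (-(1 / 2) * ((2 : ℕ) : ℝ)) * s ^ (-(3 / 2) : ℝ) := by
      rw [← Real.rpow_add hs]; congr 1; push_cast; ring
    rw [e1, e2]; ring
  have h4 : a ^ 2 * b = r ^ 2 * κ ^ 10 * n ^ 10 := by
    simp only [ha, hb]; field_simp
  have h5 := (radialProfile_pos α hs).le
  calc (κ ^ 4 * κ' ^ 4 * (r * r') * n ^ 2 * radialProfile (α - 1) s) ^ 5
      = (κ ^ 2 * κ' ^ 12) * ((κ ^ 8 * κ' ^ 8 * r' ^ 2 * radialProfile α s ^ 2)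
          * r ^ 3 * ((r ^ 2 * κ ^ 10 * n ^ 10) * (r' ^ 3 * d))) := by
        rw [mul_pow, h3]; ring
    _ ≤ (K ^ 2 * K ^ 12) * ((κ ^ 8 * κ' ^ 8 * r' ^ 2 * radialProfile α s ^ 2)
          * p ^ 2 * ((a ^ 2 * b) * (p' ^ 2 * d))) := by
        rw [h4]
        gcongr
        · exact hsq hr hp
        · exact hsq hr' hp'
    _ ≤ (K ^ 2 * K ^ 12) * ((κ ^ 8 * κ' ^ 8 * r' ^ 2 * radialProfile α s ^ 2)
          * p ^ 2 * ((a + b) ^ 3 * (p' + singularKernel α s) ^ 3)) := by gcongr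
    _ = _ := by ring

/-- The doubled pressure term, which the doubled momentum balance controls. -/
def pressureTerm (α e m ε : ℝ) (dens : SpaceTime → ℝ) (η : SpaceTime → ℝ) (θ : ℝ → ℝ)
    (q : SpaceTimePair) : ℝ :=
  θ (q.1.2 - q.2.2) * (η q.1 * η q.2 * (pressure m ε (dens q.1) * dens q.2)
    * radialProfile α (‖q.1.1 - q.2.1‖ ^ 2 + e))

/-- The energy density together with the weighted densities of the localized velocity. -/
def controlDensity (m ε : ℝ) (κ N dens : SpaceTime → ℝ) (u : SpaceTime → Space3)
    (Du : SpaceTime → Matrix (Fin 3) (Fin 3) ℝ) (z : SpaceTime) : ℝ :=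
  energyDensity m ε dens u Du z
    + (N z * (dens z * (κ z * ‖u z‖) ^ 2) + (κ z * ‖u z‖) ^ 6 / N z ^ 2)

/-- The doubled density that dominates all remaining terms. -/
def controlTerm (α e m ε : ℝ) (κ N dens : SpaceTime → ℝ) (u : SpaceTime → Space3)
    (Du : SpaceTime → Matrix (Fin 3) (Fin 3) ℝ) (θ : ℝ → ℝ) (q : SpaceTimePair) : ℝ :=
  θ (q.1.2 - q.2.2) * (controlDensity m ε κ N dens u Du q.1
    * (pressure m ε (dens q.2) + singularKernel α (‖q.1.1 - q.2.1‖ ^ 2 + e)))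

lemma norm_sub_sq_le_two_mul (x y : Space3) : ‖x - y‖ ^ 2 ≤ 2 * (‖x‖ ^ 2 + ‖y‖ ^ 2) := by
  have h1 := parallelogram_law_with_norm ℝ x y
  have h2 := mul_self_nonneg ‖x + y‖
  simp only [sq]
  linarith

/-- The field is odd, so its gradient is even, and exchanging the points replaces `u·Db(u - u')` by
`-u'·Db(u - u')`. The sum is the quadratic form in `u - u'`, to which `testField_quadratic` applies.
-/
lemma neg_le_convexTerm_add_swap {α e : ℝ} {dens η : SpaceTime → ℝ} {u : SpaceTime → Space3}
    {θ : ℝ → ℝ} (hα : 0 ≤ α) (he : 0 < e) (hd : ∀ z, 0 ≤ dens z)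
    (q : SpaceTimePair) (hη : 0 ≤ η q.1 * η q.2) (hθ : ∀ t, 0 ≤ θ t) (hθe : ∀ t, θ (-t) = θ t) :
    -(2 * α * (θ (q.1.2 - q.2.2) * (η q.1 * η q.2 * (dens q.1 * dens q.2)
        * radialProfile (α - 1) (‖q.1.1 - q.2.1‖ ^ 2 + e) * (‖u q.1‖ ^ 2 + ‖u q.2‖ ^ 2))))
      ≤ convexTerm dens u η θ (testField α e) q
        + convexTerm dens u η θ (testField α e) q.swap := by
  set t := q.1.2 - q.2.2 with ht
  have htw : θ (q.2.2 - q.1.2) = θ t := by rw [← hθe]; congr 1; rw [ht]; ring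
  have heven : ∀ x w, fderiv ℝ (testField α e) (-x) w = fderiv ℝ (testField α e) x w := by
    intro x w
    rw [fderiv_testField α he, fderiv_testField α he]
    simp
  have hsum : convexTerm dens u η θ (testField α e) q
      + convexTerm dens u η θ (testField α e) q.swap
      = θ t * (η q.1 * η q.2 * (dens q.1 * dens q.2)
        * inner ℝ (u q.1 - u q.2)
          (fderiv ℝ (testField α e) (q.1.1 - q.2.1) (u q.1 - u q.2))) := by
    unfold convexTerm
    simp only [Prod.fst_swap, Prod.snd_swap, htw]
    rw [← neg_sub q.1.1 q.2.1, heven, ← neg_sub (u q.1) (u q.2), map_neg, inner_neg_right,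
      inner_sub_left]
    ring
  rw [hsum]
  have hq := testField_quadratic hα he (q.1.1 - q.2.1) (u q.1 - u q.2)
  have hpar := norm_sub_sq_le_two_mul (u q.1) (u q.2)
  have hrp := radialProfile_pos (α - 1) (normSq_add_pos he (q.1.1 - q.2.1))
  set k := radialProfile (α - 1) (‖q.1.1 - q.2.1‖ ^ 2 + e)
  have hq2 : -(2 * α * (k * (‖u q.1‖ ^ 2 + ‖u q.2‖ ^ 2)))
      ≤ inner ℝ (u q.1 - u q.2)
          (fderiv ℝ (testField α e) (q.1.1 - q.2.1) (u q.1 - u q.2)) := by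
    refine le_trans ?_ hq
    rw [neg_le_neg_iff]
    calc _ ≤ α * k * (2 * (‖u q.1‖ ^ 2 + ‖u q.2‖ ^ 2)) := by gcongr
      _ = _ := by ring
  have hd1 := hd q.1
  have hd2 := hd q.2
  have hθt := hθ t
  have hq3 := mul_le_mul_of_nonneg_left hq2
    (show 0 ≤ θ t * (η q.1 * η q.2 * (dens q.1 * dens q.2)) by positivity)
  calc _ = θ t * (η q.1 * η q.2 * (dens q.1 * dens q.2)) *
        -(2 * α * (k * (‖u q.1‖ ^ 2 + ‖u q.2‖ ^ 2))) := by ring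
    _ ≤ _ := hq3
    _ = _ := by ring

set_option maxHeartbeats 1000000 in
-- The antisymmetric correction turns the convective term into half of its symmetrized version,
-- which loses at most `α (X + X') ≤ 2 (X + X')`. Absorbing each of `X`, `X'` with weight 1/8 costs
-- a quarter of the pressure term at each order of the points, so 3/4 and -1/4 remain.
lemma exists_doubled_lower_bound (ν₁ ν₂ : ℝ) {α : ℝ} (hα : 0 < α) (hα2 : α < 4 / 3) (D : ℝ)
    {K F : ℝ} (hK : 0 < K) (hF0 : 0 ≤ F) : ∃ C : ℝ, 0 ≤ C ∧
    ∀ (m ε e : ℝ) (κ N dens : SpaceTime → ℝ) (u f : SpaceTime → Space3)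
      (Du : SpaceTime → Matrix (Fin 3) (Fin 3) ℝ) (η : SpaceTime → ℝ) (θ : ℝ → ℝ)
      (q : SpaceTimePair), 0 < ε → 0 < e → (∀ z, 0 ≤ dens z) → (∀ z, ‖f z‖ ≤ F) →
      (∀ z, 0 ≤ κ z) → (∀ z, κ z ≤ K) → (∀ z, η z = κ z ^ 4) → (∀ z, |η z| ≤ K) →
      (∀ z, |timeDeriv η z| ≤ K) → (∀ j z, |spaceDeriv j η z| ≤ K) → (∀ t, 0 ≤ θ t) →
      (∀ t, θ (-t) = θ t) → (∀ z, 0 < N z) → ‖q.1.1 - q.2.1‖ ^ 2 + e ≤ D →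
      3 / 4 * pressureTerm α e m ε dens η θ q - 1 / 4 * pressureTerm α e m ε dens η θ q.swap
          - C * (controlTerm α e m ε κ N dens u Du θ q
            + controlTerm α e m ε κ N dens u Du θ q.swap)
        ≤ pairMomentum ν₁ ν₂ m ε f dens u Du η θ (testField α e) q
          + pairMass dens u η θ (testField α e) q
          + (convexTerm dens u η θ (testField α e) q.swap
            - convexTerm dens u η θ (testField α e) q) / 2 := by
  obtain ⟨C₁, hC₁, hker⟩ := exists_kernel_absorption hα D
  set c := K ^ 2 * (11 + 36 * (2 * |ν₁| + 3 * |ν₂|) + F) with hc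
  have hc0 : 0 ≤ c := by positivity
  -- Chosen so that `K ^ 14 ≤ (1/8)² M³`, the condition for absorption with weight 1/8; `M ≥ 1`
  -- gives `M ≤ M³`.
  set M := (64 * K ^ 14) + 1 with hM
  have hM0 : 1 ≤ M := by rw [hM]; have : 0 ≤ 64 * K ^ 14 := by positivity
                         linarith
  refine ⟨3 * c * C₁ + 2 * M, by positivity, ?_⟩
  intro m ε e κ N dens u f Du η θ q hε he hd hF hκ hκK hηκ hη hηt hηs hθ hθe hN hD
  set s := ‖q.1.1 - q.2.1‖ ^ 2 + e with hs
  have hs0 : 0 < s := normSq_add_pos he _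
  set t := q.1.2 - q.2.2 with ht
  have hsw : ‖q.2.1 - q.1.1‖ ^ 2 + e = s := by rw [hs, norm_sub_rev]
  have htw : θ (q.2.2 - q.1.2) = θ t := by rw [← hθe]; congr 1; rw [ht]; ring
  obtain ⟨e1, e2, e3, e4, e5, e6⟩ :=
    energyDensity_bounds (u := u) (Du := Du) (m := m) hε hd q.1
  obtain ⟨f1, f2, f3, f4, f5, f6⟩ :=
    energyDensity_bounds (u := u) (Du := Du) (m := m) hε hd q.2
  have hrem := abs_doubled_remainder_le (u := u) (Du := Du) (m := m) (ν₁ := ν₁) (ν₂ := ν₂)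
    hε hd hF hη hηt hηs hθ q (b := testField α e) (norm_testField_le α he _)
    (k := radialProfile α s) (fun j => by
      have := norm_fderiv_testField_le hα.le (by linarith) he (q.1.1 - q.2.1)
        (EuclideanSpace.single j (1 : ℝ))
      simpa [pairDeriv] using this)
  have hdiv : radialProfile α s ≤ ∑ j, pairDeriv (testField α e) q j j :=
    testField_div hα.le (by linarith) he _
  have hp1 := pressure_nonneg (m := m) hε (hd q.1)
  have hp2 := pressure_nonneg (m := m) hε (hd q.2)
  have hpp1 := rpow_le_pressure (m := m) hε (hd q.1)
  have hpp2 := rpow_le_pressure (m := m) hε (hd q.2)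
  have hd1 := hd q.1
  have hd2 := hd q.2
  have hη1 : 0 ≤ η q.1 := by rw [hηκ]; have := hκ q.1; positivity
  have hη2 : 0 ≤ η q.2 := by rw [hηκ]; have := hκ q.2; positivity
  have hθt := hθ t
  have hk0 := singularKernel_pos α hs0
  set H := energyDensity m ε dens u Du q.1
  set H' := energyDensity m ε dens u Du q.2
  set g := √(∑ i, ∑ j, Du q.1 i j ^ 2) with hg
  set V := N q.1 * (dens q.1 * (κ q.1 * ‖u q.1‖) ^ 2) + (κ q.1 * ‖u q.1‖) ^ 6 / N q.1 ^ 2 with hV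
  set V' := N q.2 * (dens q.2 * (κ q.2 * ‖u q.2‖) ^ 2) + (κ q.2 * ‖u q.2‖) ^ 6 / N q.2 ^ 2 with hV'
  set P := pressure m ε (dens q.1)
  set P' := pressure m ε (dens q.2)
  set kk := singularKernel α s
  set W := (H + V) * (P' + kk) with hW
  set W' := (H' + V') * (P + kk) with hW'
  have hV0 : 0 ≤ V := by have := hN q.1; have := hκ q.1; positivity
  have hV0' : 0 ≤ V' := by have := hN q.2; have := hκ q.2; positivity
  have hg2 : g ^ 2 ≤ H := by
    exact (Real.sq_sqrt (Finset.sum_nonneg fun _ _ =>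
      Finset.sum_nonneg fun _ _ => sq_nonneg _)).le.trans e6
  have hC1 : controlTerm α e m ε κ N dens u Du θ q = θ t * W := rfl
  have hC2 : controlTerm α e m ε κ N dens u Du θ q.swap = θ t * W' := by
    simp only [controlTerm, Prod.fst_swap, Prod.snd_swap, hsw, htw]
    rfl
  have hG1 : pressureTerm α e m ε dens η θ q
      = θ t * (η q.1 * η q.2 * (P * dens q.2) * radialProfile α s) := rfl
  have hG2 : pressureTerm α e m ε dens η θ q.swap
      = θ t * (η q.1 * η q.2 * (P' * dens q.1) * radialProfile α s) := by
    simp only [pressureTerm, Prod.fst_swap, Prod.snd_swap, hsw, htw]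
    ring
  -- the remainder
  have hWk : H * (P' + kk) ≤ W := by rw [hW]; gcongr; linarith
  have hWk' : H' * (P + kk) ≤ W' := by rw [hW']; gcongr; linarith
  have r1 : H * (dens q.2 * logWeight s ^ α) ≤ C₁ * W := by
    calc _ ≤ H * (C₁ * (P' + kk)) :=
          mul_le_mul_of_nonneg_left (hker s hs0 hD (dens q.2) P' 0 hd2 hpp2 le_rfl).1 (by linarith)
      _ = C₁ * (H * (P' + kk)) := by ring
      _ ≤ _ := by gcongr
  have r2 : H' * (dens q.1 * logWeight s ^ α) ≤ C₁ * W' := by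
    calc _ ≤ H' * (C₁ * (P + kk)) :=
          mul_le_mul_of_nonneg_left (hker s hs0 hD (dens q.1) P 0 hd1 hpp1 le_rfl).1 (by linarith)
      _ = C₁ * (H' * (P + kk)) := by ring
      _ ≤ _ := by gcongr
  have r3 : g * (dens q.2 * radialProfile α s) ≤ C₁ * (W + W') := by
    refine (hker s hs0 hD (dens q.2) P' g hd2 hpp2 (Real.sqrt_nonneg _)).2.trans ?_
    gcongr
    · exact (mul_le_mul_of_nonneg_right hg2 (by positivity)).trans hWk
    · calc dens q.2 * kk ≤ H' * kk := by gcongr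
        _ ≤ H' * (P + kk) := by gcongr; linarith
        _ ≤ _ := hWk'
  have hconv := neg_le_convexTerm_add_swap (u := u) (η := η) (θ := θ) hα.le he hd q
    (by positivity) hθ hθe
  rw [← hs] at hconv
  -- the kinetic terms
  have hcM : K ^ 14 ≤ (1 / 8 : ℝ) ^ 2 * M ^ 3 := by
    have h1 : M ≤ M ^ 3 := le_self_pow₀ hM0 (by norm_num)
    have : 64 * K ^ 14 ≤ M := by rw [hM]; linarith
    linarith
  have k1 : η q.1 * η q.2 * (dens q.1 * dens q.2) * ‖u q.1‖ ^ 2 * radialProfile (α - 1) s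
      ≤ 1 / 8 * (η q.1 * η q.2 * (P * dens q.2) * radialProfile α s) + M * W := by
    have h := pow_five_kinetic_le (α := α) hs0 (hκ q.1) (hκK q.1) (hκ q.2) (hκK q.2) hd1 hd2 hpp1
      hpp2 (n := ‖u q.1‖) (hN q.1)
    have h2 := (radialProfile_pos α hs0).le
    rw [hηκ, hηκ]
    have hk1 := hκ q.1
    have hk2 := hκ q.2
    refine (le_of_pow_five_le (δ := 1 / 8) (M := M) (by positivity) (by positivity) (by norm_num)
      (by linarith) h hcM).trans ?_
    have : V * (P' + kk) ≤ W := by rw [hW]; gcongr; linarith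
    gcongr
  have k2 : η q.1 * η q.2 * (dens q.1 * dens q.2) * ‖u q.2‖ ^ 2 * radialProfile (α - 1) s
      ≤ 1 / 8 * (η q.1 * η q.2 * (P' * dens q.1) * radialProfile α s) + M * W' := by
    have h := pow_five_kinetic_le (α := α) hs0 (hκ q.2) (hκK q.2) (hκ q.1) (hκK q.1) hd2 hd1 hpp2
      hpp1 (n := ‖u q.2‖) (hN q.2)
    have h2 := (radialProfile_pos α hs0).le
    rw [hηκ, hηκ]
    have hk1 := hκ q.1
    have hk2 := hκ q.2
    have h3 := le_of_pow_five_le (δ := 1 / 8) (M := M) (by positivity) (by positivity)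
      (by norm_num) (by linarith) h hcM
    have : V' * (P + kk) ≤ W' := by rw [hW']; gcongr; linarith
    calc _ = κ q.2 ^ 4 * κ q.1 ^ 4 * (dens q.2 * dens q.1) * ‖u q.2‖ ^ 2
          * radialProfile (α - 1) s := by ring
      _ ≤ _ := h3
      _ ≤ 1 / 8 * (κ q.2 ^ 4 * κ q.1 ^ 4 * (P' * dens q.1) * radialProfile α s) + M * W' := by
          gcongr
      _ = _ := by ring
  have hrem2 : -(c * (θ t * (H * (dens q.2 * logWeight s ^ α) + H' * (dens q.1 * logWeight s ^ α)
      + g * (dens q.2 * radialProfile α s)))) ≤ _ := (abs_le.1 hrem).1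
  have hW0 : 0 ≤ W := by rw [hW]; positivity
  have hW0' : 0 ≤ W' := by rw [hW']; positivity
  have hr0 : H * (dens q.2 * logWeight s ^ α) + H' * (dens q.1 * logWeight s ^ α)
      + g * (dens q.2 * radialProfile α s) ≤ 2 * C₁ * (W + W') := by
    linarith
  have hr1 := mul_le_mul_of_nonneg_left (mul_le_mul_of_nonneg_left hr0 hθt) hc0
  have hG0 : θ t * (η q.1 * η q.2 * (P * dens q.2) * radialProfile α s)
      ≤ θ t * (η q.1 * η q.2 * (P * dens q.2) * ∑ j, pairDeriv (testField α e) q j j) := by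
    gcongr
  set X := η q.1 * η q.2 * (dens q.1 * dens q.2) * ‖u q.1‖ ^ 2 * radialProfile (α - 1) s with hX
  set X' := η q.1 * η q.2 * (dens q.1 * dens q.2) * ‖u q.2‖ ^ 2 * radialProfile (α - 1) s with hX'
  set G := η q.1 * η q.2 * (P * dens q.2) * radialProfile α s with hG
  set G' := η q.1 * η q.2 * (P' * dens q.1) * radialProfile α s with hG'
  have hXX : θ t * (η q.1 * η q.2 * (dens q.1 * dens q.2)
        * radialProfile (α - 1) s * (‖u q.1‖ ^ 2 + ‖u q.2‖ ^ 2)) = θ t * (X + X') := by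
    rw [hX, hX']; ring
  rw [hXX] at hconv
  have hX0 : 0 ≤ X + X' := by
    have := (radialProfile_pos (α - 1) hs0).le
    rw [hX, hX']; positivity
  have hkin : α * (θ t * (X + X')) ≤ θ t * (1 / 4 * G + 1 / 4 * G' + 2 * M * (W + W')) := by
    calc α * (θ t * (X + X')) ≤ 2 * (θ t * (X + X')) := by gcongr; linarith
      _ = θ t * (2 * (X + X')) := by ring
      _ ≤ _ := by gcongr; linarith
  rw [hC1, hC2, hG1, hG2]
  have hcC : 0 ≤ c * C₁ * (θ t * (W + W')) := by positivity
  linarith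
end

/-! ### Integrability of the control density. -/

noncomputable section

lemma measurable_logWeight : Measurable logWeight := by unfold logWeight; fun_prop

lemma measurable_radialProfile (α : ℝ) : Measurable (radialProfile α) := by
  have := measurable_logWeight
  unfold radialProfile; fun_prop

lemma measurable_singularKernel (α : ℝ) : Measurable (singularKernel α) := by
  have := measurable_logWeight
  unfold singularKernel; fun_prop

lemma measurable_pressure (m ε : ℝ) : Measurable (pressure m ε) := by
  unfold pressure; fun_prop

lemma volume_restrict_cylinder (Ω : Set Space3) (T : ℝ) :
    (volume : Measure SpaceTime).restrict (spaceTimeCylinder Ω T)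
      = (volume.restrict Ω).prod (volume.restrict (Ioo (0 : ℝ) T)) := by
  rw [spaceTimeCylinder, Measure.prod_restrict]; rfl

lemma lintegral_cylinder {Ω : Set Space3} {T : ℝ} {g : SpaceTime → ENNReal} (hg : Measurable g) :
    ∫⁻ z in spaceTimeCylinder Ω T, g z = ∫⁻ t in Ioo (0 : ℝ) T, ∫⁻ x in Ω, g (x, t) := by
  rw [volume_restrict_cylinder, lintegral_prod_symm' _ hg]

/-- The squared gradient and velocity. -/
def dissipationDensity (u : SpaceTime → Space3) (Du : SpaceTime → Matrix (Fin 3) (Fin 3) ℝ)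
    (z : SpaceTime) : ℝ := ‖u z‖ ^ 2 + ∑ i, ∑ j, Du z i j ^ 2

lemma dissipationDensity_nonneg (u : SpaceTime → Space3)
    (Du : SpaceTime → Matrix (Fin 3) (Fin 3) ℝ) (z : SpaceTime) :
    0 ≤ dissipationDensity u Du z :=
  add_nonneg (sq_nonneg _) (Finset.sum_nonneg fun _ _ => Finset.sum_nonneg fun _ _ => sq_nonneg _)

/-- `1 + ‖u(t)‖²_{W^{1,2}(Ω)}`, as a function on space-time. -/
def sobolevWeight (Ω : Set Space3) (u : SpaceTime → Space3)
    (Du : SpaceTime → Matrix (Fin 3) (Fin 3) ℝ) (z : SpaceTime) : ℝ :=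
  1 + (∫⁻ x in Ω, ENNReal.ofReal (dissipationDensity u Du (x, z.2))).toReal

lemma sobolevWeight_pos (Ω : Set Space3) (u : SpaceTime → Space3)
    (Du : SpaceTime → Matrix (Fin 3) (Fin 3) ℝ) (z : SpaceTime) : 0 < sobolevWeight Ω u Du z := by
  unfold sobolevWeight; positivity

section

variable {Ω : Set Space3} {T ν₁ ν₂ m ε E F S : ℝ} {κ : SpaceTime → ℝ}
    {f : SpaceTime → Space3} {dens : SpaceTime → ℝ} {u : SpaceTime → Space3}
    {Du : SpaceTime → Matrix (Fin 3) (Fin 3) ℝ}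

lemma IsMeasurableFlow.measurable_dissipationDensity
    (h : IsMeasurableFlow Ω T ν₁ ν₂ m ε E F S κ f dens u Du) :
    Measurable (dissipationDensity u Du) := by
  unfold dissipationDensity
  have h1 := h.measurable_u
  refine (h1.norm.pow_const 2).add (Finset.measurable_fun_sum _ fun i _ =>
    Finset.measurable_fun_sum _ fun j _ => (h.measurable_Du i j).pow_const 2)

lemma IsMeasurableFlow.measurable_sobolevWeight
    (h : IsMeasurableFlow Ω T ν₁ ν₂ m ε E F S κ f dens u Du) :
    Measurable (sobolevWeight Ω u Du) := by
  have h1 : Measurable fun t : ℝ =>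
      ∫⁻ x in Ω, ENNReal.ofReal (dissipationDensity u Du (x, t)) :=
    (h.measurable_dissipationDensity.ennreal_ofReal).lintegral_prod_left'
  exact measurable_const.add (h1.comp measurable_snd).ennreal_toReal

lemma IsMeasurableFlow.measurable_energyDensity
    (h : IsMeasurableFlow Ω T ν₁ ν₂ m ε E F S κ f dens u Du) :
    Measurable (energyDensity m ε dens u Du) := by
  have h1 := h.measurable_dens
  have h2 := h.measurable_u
  have h3 := (measurable_pressure m ε).comp h1
  exact ((measurable_const.add h3).add (h1.mul (h2.norm.pow_const 2))).add
    h.measurable_dissipationDensity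

lemma IsMeasurableFlow.measurable_controlDensity
    (h : IsMeasurableFlow Ω T ν₁ ν₂ m ε E F S κ f dens u Du) (hκ : Measurable κ) :
    Measurable (controlDensity m ε κ (sobolevWeight Ω u Du) dens u Du) := by
  have h1 := h.measurable_dens
  have h2 := h.measurable_u
  have h3 := h.measurable_sobolevWeight
  have h4 := h.measurable_energyDensity
  unfold controlDensity
  exact h4.add ((h3.mul (h1.mul ((hκ.mul h2.norm).pow_const 2))).add
    (((hκ.mul h2.norm).pow_const 6).div (h3.pow_const 2)))

/-- The weight `N = 1 + I` balances the two velocity densities: `N dens |κu|²` integrates to at most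
`K² E N` by the kinetic bound, and `|κu|⁶ / N²` to at most `S I³ / N² ≤ S N` by Sobolev. Both are
linear in `N`, hence integrable in time. -/
lemma IsMeasurableFlow.lintegral_controlDensity_slice_le
    (h : IsMeasurableFlow Ω T ν₁ ν₂ m ε E F S κ f dens u Du) (hε : 0 < ε) {K : ℝ}
    (hκm : Measurable κ) (hκ : ∀ z, 0 ≤ κ z) (hκK : ∀ z, κ z ≤ K) :
    ∀ᵐ t ∂(volume.restrict (Ioo (0 : ℝ) T)),
      ∫⁻ x in Ω, ENNReal.ofReal (controlDensity m ε κ (sobolevWeight Ω u Du) dens u Du (x, t))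
        ≤ (volume Ω + 2 * ENNReal.ofReal E)
          + (1 + ENNReal.ofReal (K ^ 2) * ENNReal.ofReal E + ENNReal.ofReal S)
            * (1 + ∫⁻ x in Ω, ENNReal.ofReal (dissipationDensity u Du (x, t))) := by
  -- `sobolevWeight` is defined through `toReal`, which sends `⊤` to 0; it equals `1 + I` only where
  -- `I` is finite.
  have hfin : ∀ᵐ t ∂(volume.restrict (Ioo (0 : ℝ) T)),
      ∫⁻ x in Ω, ENNReal.ofReal (dissipationDensity u Du (x, t)) < ⊤ := by
    have hm := h.measurable_dissipationDensity.ennreal_ofReal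
    refine ae_lt_top hm.lintegral_prod_left' ?_
    rw [← lintegral_cylinder hm]
    exact (h.dissipation_le.trans_lt ENNReal.ofReal_lt_top).ne
  filter_upwards [hfin, h.pressure_le, h.kinetic_le, h.sobolev_le] with t hI hp hk hs
  set I := ∫⁻ x in Ω, ENNReal.ofReal (dissipationDensity u Du (x, t)) with hIdef
  have hsN : ∀ x, ENNReal.ofReal (sobolevWeight Ω u Du (x, t)) = 1 + I := by
    intro x
    unfold sobolevWeight
    rw [ENNReal.ofReal_add (by norm_num) ENNReal.toReal_nonneg, ENNReal.ofReal_one,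
      ENNReal.ofReal_toReal hI.ne]
  have h1 := h.measurable_dens
  have h2 := h.measurable_u
  have hsl : ∀ {g : SpaceTime → ℝ}, Measurable g → Measurable fun x : Space3 => g (x, t) :=
    fun hg => hg.comp (measurable_id.prodMk measurable_const)
  have mP : Measurable fun x : Space3 => ENNReal.ofReal (pressure m ε (dens (x, t))) :=
    (hsl ((measurable_pressure m ε).comp h1)).ennreal_ofReal
  have mK : Measurable fun x : Space3 => ENNReal.ofReal (dens (x, t) * ‖u (x, t)‖ ^ 2) :=
    (hsl (h1.mul (h2.norm.pow_const 2))).ennreal_ofReal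
  have mV : Measurable fun x : Space3 => ENNReal.ofReal ((κ (x, t) * ‖u (x, t)‖) ^ 6) :=
    (hsl ((hκm.mul h2.norm).pow_const 6)).ennreal_ofReal
  have mI : Measurable fun x : Space3 => ENNReal.ofReal (dissipationDensity u Du (x, t)) :=
    (hsl h.measurable_dissipationDensity).ennreal_ofReal
  have hpt : ∀ x, ENNReal.ofReal (controlDensity m ε κ (sobolevWeight Ω u Du) dens u Du (x, t))
      ≤ ((((1 + ENNReal.ofReal (pressure m ε (dens (x, t))))
        + ENNReal.ofReal (dens (x, t) * ‖u (x, t)‖ ^ 2))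
        + ENNReal.ofReal (dissipationDensity u Du (x, t)))
        + (1 + I) * ENNReal.ofReal (K ^ 2) * ENNReal.ofReal (dens (x, t) * ‖u (x, t)‖ ^ 2))
        + ENNReal.ofReal ((κ (x, t) * ‖u (x, t)‖) ^ 6) / (1 + I) ^ 2 := by
    intro x
    have hN := sobolevWeight_pos Ω u Du (x, t)
    have hd := h.dens_nonneg (x, t)
    have hpp := pressure_nonneg (m := m) hε hd
    have hG := dissipationDensity_nonneg u Du (x, t)
    have hκx := hκ (x, t)
    have hκK2 := hκK (x, t)
    have e1 : ENNReal.ofReal ((κ (x, t) * ‖u (x, t)‖) ^ 6 / sobolevWeight Ω u Du (x, t) ^ 2)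
        = ENNReal.ofReal ((κ (x, t) * ‖u (x, t)‖) ^ 6) / (1 + I) ^ 2 := by
      rw [ENNReal.ofReal_div_of_pos (by positivity), ENNReal.ofReal_pow hN.le, hsN]
    have e2 : ENNReal.ofReal (sobolevWeight Ω u Du (x, t)
          * (K ^ 2 * (dens (x, t) * ‖u (x, t)‖ ^ 2)))
        = (1 + I) * ENNReal.ofReal (K ^ 2) * ENNReal.ofReal (dens (x, t) * ‖u (x, t)‖ ^ 2) := by
      rw [ENNReal.ofReal_mul hN.le, hsN, ENNReal.ofReal_mul (sq_nonneg K), mul_assoc]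
    rw [← e1, ← e2, ← ENNReal.ofReal_one, ← ENNReal.ofReal_add (by positivity) (by positivity),
      ← ENNReal.ofReal_add (by positivity) (by positivity),
      ← ENNReal.ofReal_add (by positivity) (by positivity),
      ← ENNReal.ofReal_add (by positivity) (by positivity),
      ← ENNReal.ofReal_add (by positivity) (by positivity)]
    refine ENNReal.ofReal_le_ofReal ?_
    have : sobolevWeight Ω u Du (x, t) * (dens (x, t) * (κ (x, t) * ‖u (x, t)‖) ^ 2)
        ≤ sobolevWeight Ω u Du (x, t) * (K ^ 2 * (dens (x, t) * ‖u (x, t)‖ ^ 2)) := by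
      rw [mul_pow, mul_left_comm (dens (x, t))]
      gcongr
    unfold controlDensity energyDensity
    unfold dissipationDensity
    linarith
  have hI1 : 1 + I ≠ 0 := by simp
  have hI2 : 1 + I ≠ ⊤ := by simp [hI.ne]
  calc _ ≤ _ := lintegral_mono hpt
    _ = volume Ω + (∫⁻ x in Ω, ENNReal.ofReal (pressure m ε (dens (x, t))))
        + (∫⁻ x in Ω, ENNReal.ofReal (dens (x, t) * ‖u (x, t)‖ ^ 2)) + I
        + (1 + I) * ENNReal.ofReal (K ^ 2)
          * (∫⁻ x in Ω, ENNReal.ofReal (dens (x, t) * ‖u (x, t)‖ ^ 2))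
        + (∫⁻ x in Ω, ENNReal.ofReal ((κ (x, t) * ‖u (x, t)‖) ^ 6)) / (1 + I) ^ 2 := by
        have hdiv : ∀ a : ENNReal, a / (1 + I) ^ 2 = ((1 + I) ^ 2)⁻¹ * a := fun a => by
          rw [div_eq_mul_inv, mul_comm]
        simp_rw [hdiv]
        rw [lintegral_add_right _ (mV.const_mul _), lintegral_add_right _ (mK.const_mul _),
          lintegral_add_right _ mI, lintegral_add_right _ mK, lintegral_add_right _ mP,
          lintegral_const_mul _ mK, lintegral_const_mul _ mV, ← hIdef]
        simp
    _ ≤ volume Ω + ENNReal.ofReal E + ENNReal.ofReal E + (1 + I)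
        + (1 + I) * ENNReal.ofReal (K ^ 2) * ENNReal.ofReal E
        + (1 + I) * ENNReal.ofReal S := by
        gcongr
        · exact le_add_self
        · rw [ENNReal.div_le_iff (by simp) (by simp [hI.ne])]
          refine hs.trans ?_
          calc ENNReal.ofReal S * I ^ 3 ≤ ENNReal.ofReal S * (1 + I) ^ 3 := by
                gcongr; exact le_add_self
            _ = _ := by ring
    _ = _ := by ring

lemma exists_lintegral_controlDensity_le {Ω : Set Space3} (hΩ : volume Ω ≠ ⊤) (T E K S : ℝ) : ∃ C : ℝ, 0 ≤ C ∧ ∀ {ν₁ ν₂ m ε F : ℝ} {κ : SpaceTime → ℝ}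
    {f : SpaceTime → Space3} {dens : SpaceTime → ℝ} {u : SpaceTime → Space3}
    {Du : SpaceTime → Matrix (Fin 3) (Fin 3) ℝ},
    IsMeasurableFlow Ω T ν₁ ν₂ m ε E F S κ f dens u Du → 0 < ε → Measurable κ →
    (∀ z, 0 ≤ κ z) → (∀ z, κ z ≤ K) →
    ∫⁻ z in spaceTimeCylinder Ω T,
        ENNReal.ofReal (controlDensity m ε κ (sobolevWeight Ω u Du) dens u Du z)
      ≤ ENNReal.ofReal C := by
  set B : ENNReal := (volume Ω + 2 * ENNReal.ofReal E) * ENNReal.ofReal T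
    + (1 + ENNReal.ofReal (K ^ 2) * ENNReal.ofReal E + ENNReal.ofReal S)
      * (ENNReal.ofReal T + ENNReal.ofReal (E ^ 2)) with hB
  have hBt : B ≠ ⊤ := by
    rw [hB]; finiteness
  refine ⟨B.toReal, ENNReal.toReal_nonneg, ?_⟩
  intro ν₁ ν₂ m ε F κ f dens u Du h hε hκm hκ hκK
  rw [ENNReal.ofReal_toReal hBt, lintegral_cylinder (h.measurable_controlDensity hκm).ennreal_ofReal]
  have hm := h.measurable_dissipationDensity.ennreal_ofReal
  have hm' : Measurable fun t : ℝ =>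
      1 + ∫⁻ x in Ω, ENNReal.ofReal (dissipationDensity u Du (x, t)) :=
    measurable_const.add hm.lintegral_prod_left'
  calc _ ≤ _ := lintegral_mono_ae
        (h.lintegral_controlDensity_slice_le hε hκm hκ hκK)
    _ = (volume Ω + 2 * ENNReal.ofReal E) * ENNReal.ofReal T
        + (1 + ENNReal.ofReal (K ^ 2) * ENNReal.ofReal E + ENNReal.ofReal S)
          * (ENNReal.ofReal T
            + ∫⁻ t in Ioo (0 : ℝ) T, ∫⁻ x in Ω, ENNReal.ofReal (dissipationDensity u Du (x, t))) := by
        rw [lintegral_add_left measurable_const, lintegral_const_mul _ hm',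
          lintegral_add_left measurable_const]
        simp
        ring
    _ ≤ _ := by
        rw [← lintegral_cylinder hm, hB]
        gcongr
        exact h.dissipation_le
end
end

/-! ### Bound of the doubled control term, and measurability. -/

noncomputable section

lemma logWeight_anti {s r : ℝ} (hs : 0 < s) (hsr : s ≤ r) : logWeight r ≤ logWeight s := by
  unfold logWeight
  have hr : 0 < r := hs.trans_le hsr
  have h : 1 / r ≤ 1 / s := one_div_le_one_div_of_le hs hsr
  have h2 : 0 < 1 / r := by positivity
  have := Real.log_le_log (show 0 < 1 + 1 / r by linarith)
    (show 1 + 1 / r ≤ 1 + 1 / s by linarith)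
  linarith

lemma radialProfile_anti {α s r : ℝ} (hα : 0 ≤ α) (hs : 0 < s) (hsr : s ≤ r) :
    radialProfile α r ≤ radialProfile α s := by
  unfold radialProfile
  have h1 := logWeight_anti hs hsr
  have h2 := logWeight_pos (hs.trans_le hsr)
  have h3 : r ^ (-(1 / 2) : ℝ) ≤ s ^ (-(1 / 2) : ℝ) :=
    Real.rpow_le_rpow_of_nonpos hs hsr (by norm_num)
  have h4 : 0 < r := hs.trans_le hsr
  have h5 := logWeight_pos hs
  gcongr

lemma IsTestFunction.exists_bound {U : Set SpaceTime} {η : SpaceTime → ℝ}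
    (hη : IsTestFunction U η) : ∃ K : ℝ, 0 < K ∧ (∀ z, |η z| ≤ K) ∧ (∀ z, |timeDeriv η z| ≤ K) ∧
      ∀ j z, |spaceDeriv j η z| ≤ K := by
  obtain ⟨h1, h2, -⟩ := hη
  obtain ⟨A, hA⟩ := h1.continuous.bounded_above_of_compact_support h2
  obtain ⟨B, hB⟩ := (h1.continuous_fderiv (by simp)).bounded_above_of_compact_support
    (h2.fderiv (𝕜 := ℝ))
  have hA0 : 0 ≤ A := (norm_nonneg _).trans (hA 0)
  have hB0 : 0 ≤ B := (norm_nonneg _).trans (hB 0)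
  have key : ∀ (v : SpaceTime) z, ‖v‖ ≤ 1 → |fderiv ℝ η z v| ≤ A + B + 1 := by
    intro v z hv
    calc |fderiv ℝ η z v| ≤ ‖fderiv ℝ η z‖ * ‖v‖ := (fderiv ℝ η z).le_opNorm v
      _ ≤ B * 1 := by gcongr; exact hB z
      _ ≤ _ := by linarith
  refine ⟨A + B + 1, by linarith, fun z => ?_, fun z => key _ z ?_, fun j z => key _ z ?_⟩
  · have := hA z
    rw [Real.norm_eq_abs] at this
    linarith
  · simp [Prod.norm_def]
  · simp [Prod.norm_def]

lemma IsTestFunction.pow {U : Set SpaceTime} {η : SpaceTime → ℝ}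
    (hη : IsTestFunction U η) {n : ℕ} (hn : n ≠ 0) : IsTestFunction U fun z => η z ^ n := by
  obtain ⟨h1, h2, h3⟩ := hη
  have hs : Function.support (fun z => η z ^ n) ⊆ Function.support η := by
    intro z hz h0
    exact hz (by simp [h0, hn])
  exact ⟨h1.pow n, h2.mono hs, (closure_mono hs).trans h3⟩

lemma IsTestFunction.continuous_fderiv_const {U : Set SpaceTime} {η : SpaceTime → ℝ}
    (hη : IsTestFunction U η) (v : SpaceTime) : Continuous fun z => fderiv ℝ η z v :=
  (hη.1.continuous_fderiv (by simp)).clm_apply continuous_const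

lemma lintegral_translated_kernel_le (g : ℝ → ENNReal) {Ω : Set Space3} {R : ℝ}
    (hΩR : Ω ⊆ Metric.ball 0 R) {x : Space3} (hx : x ∈ Ω) :
    ∫⁻ y in Ω, g ‖x - y‖ ≤ ∫⁻ y in Metric.ball (0 : Space3) (2 * R), g ‖y‖ := by
  have hsub : Ω ⊆ Metric.ball x (2 * R) := by
    intro y hy
    have h1 := hΩR hx
    have h2 := hΩR hy
    rw [mem_ball_zero_iff] at h1 h2
    rw [Metric.mem_ball, dist_eq_norm]
    linarith [norm_sub_le y x]
  calc _ ≤ ∫⁻ y in Metric.ball x (2 * R), g ‖x - y‖ := lintegral_mono_set hsub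
    _ = ∫⁻ y, (Metric.ball (0 : Space3) (2 * R)).indicator (fun y => g ‖y‖) (x - y) := by
        rw [← lintegral_indicator measurableSet_ball]
        congr 1
        ext y
        simp [indicator, dist_eq_norm, norm_sub_rev]
    _ = _ := by
        rw [lintegral_sub_left_eq_self (fun y : Space3 =>
          (Metric.ball (0 : Space3) (2 * R)).indicator (fun y => g ‖y‖) y) x,
          lintegral_indicator measurableSet_ball]

section

variable {Ω : Set Space3} {T ν₁ ν₂ m ε E F S : ℝ} {κ : SpaceTime → ℝ}
    {f : SpaceTime → Space3} {dens : SpaceTime → ℝ} {u : SpaceTime → Space3}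
    {Du : SpaceTime → Matrix (Fin 3) (Fin 3) ℝ}

lemma IsMeasurableFlow.measurable_controlTerm
    (h : IsMeasurableFlow Ω T ν₁ ν₂ m ε E F S κ f dens u Du) (hκ : Measurable κ) (α e : ℝ)
    {θ : ℝ → ℝ} (hθ : Measurable θ) :
    Measurable (controlTerm α e m ε κ (sobolevWeight Ω u Du) dens u Du θ) := by
  have h1 := h.measurable_controlDensity hκ
  have h2 := measurable_pressure m ε
  have h3 := measurable_singularKernel α
  have h4 := h.measurable_dens
  unfold controlTerm
  fun_prop

lemma energyDensity_le_controlDensity {N : SpaceTime → ℝ} (hd : ∀ z, 0 ≤ dens z)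
    (hN : ∀ z, 0 < N z) (z : SpaceTime) :
    energyDensity m ε dens u Du z ≤ controlDensity m ε κ N dens u Du z := by
  have := hd z
  have := hN z
  have h6 : 0 ≤ (κ z * ‖u z‖) ^ 6 := by
    rw [show (κ z * ‖u z‖) ^ 6 = ((κ z * ‖u z‖) ^ 2) ^ 3 by ring]; positivity
  unfold controlDensity
  have : 0 ≤ N z * (dens z * (κ z * ‖u z‖) ^ 2) + (κ z * ‖u z‖) ^ 6 / N z ^ 2 := by positivity
  linarith

/-- With the first point fixed, the space integral of the pressure plus the kernel at the second
point is bounded uniformly in time, and `θ` has mass at most one. Hence the constant depends neither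
on `e` nor on `θ`, nor on `m` and `ε`. -/
lemma exists_lintegral_controlTerm_le {Ω : Set Space3} (hΩm : MeasurableSet Ω) {R : ℝ} (hR : 0 < R)
    (hΩR : Ω ⊆ Metric.ball 0 R) {α : ℝ} (hα : α < 4 / 3) (T E K S : ℝ) :
    ∃ C : ℝ, 0 ≤ C ∧ ∀ {ν₁ ν₂ m ε F e : ℝ} {κ : SpaceTime → ℝ}
    {f : SpaceTime → Space3} {dens : SpaceTime → ℝ} {u : SpaceTime → Space3}
    {Du : SpaceTime → Matrix (Fin 3) (Fin 3) ℝ} {θ : ℝ → ℝ},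
    IsMeasurableFlow Ω T ν₁ ν₂ m ε E F S κ f dens u Du → 0 < ε → Measurable κ →
    (∀ z, 0 ≤ κ z) → (∀ z, κ z ≤ K) → 0 < e → e ≤ 1 → Measurable θ → (∀ t, 0 ≤ θ t) →
    ∫⁻ t, ENNReal.ofReal (θ t) ≤ 1 →
    ∫⁻ q, ENNReal.ofReal (controlTerm α e m ε κ (sobolevWeight Ω u Du) dens u Du θ q)
        ∂((volume.restrict (spaceTimeCylinder Ω T)).prod
          (volume.restrict (spaceTimeCylinder Ω T)))
      ≤ ENNReal.ofReal C := by
  have hΩ : volume Ω ≠ ⊤ := (measure_mono hΩR).trans_lt measure_ball_lt_top |>.ne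
  obtain ⟨C₁, hC₁, h1⟩ := exists_lintegral_controlDensity_le hΩ T E K S
  obtain ⟨C₂, hC₂, h2⟩ := exists_lintegral_ball_singularKernel_le hα
    (show 0 < 2 * R by positivity)
  -- `E` may be negative, in which case `ENNReal.ofReal E` is 0.
  refine ⟨C₁ * (max E 0 + C₂), by positivity, ?_⟩
  intro ν₁ ν₂ m ε F e κ f dens u Du θ h hε hκm hκ hκK he he1 hθm hθ hθ1
  have hcd := h.measurable_controlDensity hκm
  have mP := measurable_pressure m ε
  have md := h.measurable_dens
  have hcyl : MeasurableSet (spaceTimeCylinder Ω T) := hΩm.prod measurableSet_Ioo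
  have hcd0 : ∀ z, 0 ≤ controlDensity m ε κ (sobolevWeight Ω u Du) dens u Du z := fun z =>
    (zero_le_one.trans (energyDensity_bounds hε h.dens_nonneg z).1).trans
      (energyDensity_le_controlDensity h.dens_nonneg (sobolevWeight_pos Ω u Du) z)
  have hinner : ∀ z ∈ spaceTimeCylinder Ω T, ∫⁻ w in spaceTimeCylinder Ω T,
      ENNReal.ofReal (controlTerm α e m ε κ (sobolevWeight Ω u Du) dens u Du θ (z, w))
      ≤ ENNReal.ofReal (controlDensity m ε κ (sobolevWeight Ω u Du) dens u Du z)
        * (ENNReal.ofReal E + ENNReal.ofReal C₂) := by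
    intro z hz
    have hmeas : Measurable fun w : SpaceTime => ENNReal.ofReal (θ (z.2 - w.2))
        * (ENNReal.ofReal (pressure m ε (dens w))
          + ENNReal.ofReal (singularKernel α (‖z.1 - w.1‖ ^ 2 + e))) := by
      have h3 := measurable_singularKernel α
      fun_prop
    have e1 : ∀ w, ENNReal.ofReal
        (controlTerm α e m ε κ (sobolevWeight Ω u Du) dens u Du θ (z, w))
        = ENNReal.ofReal (controlDensity m ε κ (sobolevWeight Ω u Du) dens u Du z)
          * (ENNReal.ofReal (θ (z.2 - w.2)) * (ENNReal.ofReal (pressure m ε (dens w))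
            + ENNReal.ofReal (singularKernel α (‖z.1 - w.1‖ ^ 2 + e)))) := by
      intro w
      rw [← ENNReal.ofReal_add (pressure_nonneg hε (h.dens_nonneg w))
        (singularKernel_pos α (normSq_add_pos he _)).le, ← ENNReal.ofReal_mul (hθ _),
        ← ENNReal.ofReal_mul (hcd0 z)]
      congr 1
      unfold controlTerm
      ring
    simp_rw [e1]
    rw [lintegral_const_mul _ hmeas]
    gcongr
    rw [lintegral_cylinder hmeas]
    calc _ ≤ ∫⁻ t in Ioo (0 : ℝ) T, ENNReal.ofReal (θ (z.2 - t))
          * (ENNReal.ofReal E + ENNReal.ofReal C₂) := by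
          refine lintegral_mono_ae ?_
          filter_upwards [h.pressure_le] with t ht
          have m1 : Measurable fun x : Space3 => ENNReal.ofReal (pressure m ε (dens (x, t))) := by
            fun_prop
          have m2 : Measurable fun x : Space3 =>
              ENNReal.ofReal (singularKernel α (‖z.1 - x‖ ^ 2 + e)) := by
            have h3 := measurable_singularKernel α
            fun_prop
          rw [lintegral_const_mul _ (by fun_prop), lintegral_add_left m1]
          gcongr
          refine (lintegral_translated_kernel_le
            (fun r => ENNReal.ofReal (singularKernel α (r ^ 2 + e))) hΩR hz.1).trans
            (h2 e he he1)
      _ ≤ (∫⁻ t, ENNReal.ofReal (θ (z.2 - t))) * (ENNReal.ofReal E + ENNReal.ofReal C₂) := by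
          rw [lintegral_mul_const _ (by fun_prop)]
          gcongr
          exact Measure.restrict_le_self
      _ ≤ 1 * (ENNReal.ofReal E + ENNReal.ofReal C₂) := by
          gcongr
          rwa [lintegral_sub_left_eq_self (fun t => ENNReal.ofReal (θ t)) z.2]
      _ = _ := one_mul _
  rw [lintegral_prod _ (h.measurable_controlTerm hκm α e hθm).ennreal_ofReal.aemeasurable]
  calc _ ≤ ∫⁻ z in spaceTimeCylinder Ω T,
        ENNReal.ofReal (controlDensity m ε κ (sobolevWeight Ω u Du) dens u Du z)
        * (ENNReal.ofReal E + ENNReal.ofReal C₂) := setLIntegral_mono_ae'  hcyl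
          (ae_of_all _ hinner)
    _ ≤ ENNReal.ofReal C₁ * (ENNReal.ofReal E + ENNReal.ofReal C₂) := by
        rw [lintegral_mul_const _ hcd.ennreal_ofReal]
        gcongr
        exact h1 h hε hκm hκ hκK
    _ ≤ _ := by
        rw [ENNReal.ofReal_mul hC₁, ENNReal.ofReal_add (le_max_right _ _) hC₂]
        gcongr
        exact le_max_left _ _

lemma IsMeasurableFlow.integrable_energyDensity
    (h : IsMeasurableFlow Ω T ν₁ ν₂ m ε E F S κ f dens u Du) (hΩ : volume Ω ≠ ⊤) (hε : 0 < ε)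
    {K : ℝ} (hκm : Measurable κ) (hκ : ∀ z, 0 ≤ κ z) (hκK : ∀ z, κ z ≤ K) :
    Integrable (energyDensity m ε dens u Du) (volume.restrict (spaceTimeCylinder Ω T)) := by
  obtain ⟨C, -, hC⟩ := exists_lintegral_controlDensity_le hΩ T E K S
  refine ⟨h.measurable_energyDensity.aestronglyMeasurable, ?_⟩
  rw [hasFiniteIntegral_iff_ofReal (ae_of_all _ fun z =>
    zero_le_one.trans (energyDensity_bounds hε h.dens_nonneg z).1)]
  refine lt_of_le_of_lt (lintegral_mono fun z => ENNReal.ofReal_le_ofReal ?_)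
    ((hC h hε hκm hκ hκK).trans_lt ENNReal.ofReal_lt_top)
  exact energyDensity_le_controlDensity h.dens_nonneg (sobolevWeight_pos Ω u Du) z

lemma IsMeasurableFlow.measurable_pressureTerm
    (h : IsMeasurableFlow Ω T ν₁ ν₂ m ε E F S κ f dens u Du) (α e : ℝ) {η : SpaceTime → ℝ}
    (hη : Measurable η) {θ : ℝ → ℝ} (hθ : Measurable θ) :
    Measurable (pressureTerm α e m ε dens η θ) := by
  have h1 := h.measurable_dens
  have h2 := measurable_pressure m ε
  have h3 := measurable_radialProfile α
  unfold pressureTerm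
  fun_prop

lemma measurable_coord {X : Type*} [MeasurableSpace X] {v : X → Space3} (hv : Measurable v)
    (i : Fin 3) : Measurable fun x => v x i := by fun_prop

lemma measurable_pairDeriv {b : Space3 → Space3} (hb : ContDiff ℝ ∞ b) (j : Fin 3) :
    Measurable fun q => pairDeriv b q j := by
  have := hb.continuous_fderiv (by simp)
  unfold pairDeriv
  fun_prop

lemma IsMeasurableFlow.measurable_pairMomentum
    (h : IsMeasurableFlow Ω T ν₁ ν₂ m ε E F S κ f dens u Du) {η : SpaceTime → ℝ}
    (hη : IsTestFunction (spaceTimeCylinder Ω T) η) {θ : ℝ → ℝ} (hθ : ContDiff ℝ ∞ θ)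
    {b : Space3 → Space3} (hb : ContDiff ℝ ∞ b) :
    Measurable (pairMomentum ν₁ ν₂ m ε f dens u Du η θ b) := by
  have h1 := h.measurable_dens
  have h2 := h.measurable_u
  have h3 := h.measurable_f
  have h4 := measurable_pressure m ε
  have h5 := h.measurable_Du
  have h6 := hη.1.continuous.measurable
  have h7 : Measurable (timeDeriv η) := (hη.continuous_fderiv_const _).measurable
  have h8 : ∀ j, Measurable (spaceDeriv j η) := fun j => (hη.continuous_fderiv_const _).measurable
  have h9 := hθ.continuous.measurable
  have h10 : Measurable (deriv θ) := measurable_deriv θ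
  have h11 := hb.continuous.measurable
  have h12 := measurable_pairDeriv hb
  unfold pairMomentum
  simp only [viscousStress, Matrix.add_apply, Matrix.smul_apply, Matrix.transpose_apply,
    smul_eq_mul, Matrix.trace, Matrix.diag_apply]
  fun_prop

lemma IsMeasurableFlow.measurable_pairMass
    (h : IsMeasurableFlow Ω T ν₁ ν₂ m ε E F S κ f dens u Du) {η : SpaceTime → ℝ}
    (hη : IsTestFunction (spaceTimeCylinder Ω T) η) {θ : ℝ → ℝ} (hθ : ContDiff ℝ ∞ θ)
    {b : Space3 → Space3} (hb : ContDiff ℝ ∞ b) :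
    Measurable (pairMass dens u η θ b) := by
  have h1 := h.measurable_dens
  have h2 := h.measurable_u
  have h6 := hη.1.continuous.measurable
  have h7 : Measurable (timeDeriv η) := (hη.continuous_fderiv_const _).measurable
  have h8 : ∀ j, Measurable (spaceDeriv j η) := fun j => (hη.continuous_fderiv_const _).measurable
  have h9 := hθ.continuous.measurable
  have h10 : Measurable (deriv θ) := measurable_deriv θ
  have h11 := hb.continuous.measurable
  have h12 := measurable_pairDeriv hb
  unfold pairMass
  fun_prop

lemma IsMeasurableFlow.measurable_convexTerm
    (h : IsMeasurableFlow Ω T ν₁ ν₂ m ε E F S κ f dens u Du) {η : SpaceTime → ℝ}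
    (hη : Measurable η) {θ : ℝ → ℝ} (hθ : Measurable θ)
    {b : Space3 → Space3} (hb : ContDiff ℝ ∞ b) :
    Measurable (convexTerm dens u η θ b) := by
  have h1 := h.measurable_dens
  have h2 := h.measurable_u
  have h12 := measurable_pairDeriv hb
  have h13 := measurable_coord h2
  unfold convexTerm
  simp_rw [fderiv_eq_sum_pairDeriv]
  simp only [PiLp.sub_apply]
  fun_prop
end
end

/-! ### The estimate of the doubled pressure term. -/

noncomputable section

section

variable {Ω : Set Space3} {T ν₁ ν₂ m ε E F S : ℝ} {κ : SpaceTime → ℝ}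
    {f : SpaceTime → Space3} {dens : SpaceTime → ℝ} {u : SpaceTime → Space3}
    {Du : SpaceTime → Matrix (Fin 3) (Fin 3) ℝ}

/-- This bound and the next ones blow up as `e → 0`. They only justify Fubini's theorem at fixed `e`
and do not enter the final constants. -/
lemma norm_testField_le_const {α e : ℝ} (hα : 0 ≤ α) (he : 0 < e) (x : Space3) :
    ‖testField α e x‖ ≤ logWeight e ^ α := by
  have h0 : e ≤ ‖x‖ ^ 2 + e := by nlinarith [sq_nonneg ‖x‖]
  refine (norm_testField_le α he x).trans ?_
  have := logWeight_pos (normSq_add_pos he x)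
  have := logWeight_anti he h0
  gcongr

lemma norm_pairDeriv_testField_le_const {α e : ℝ} (hα : 0 ≤ α) (hα2 : α ≤ 2) (he : 0 < e)
    (q : SpaceTimePair) (j : Fin 3) :
    ‖pairDeriv (testField α e) q j‖ ≤ 3 * radialProfile α e := by
  have h0 : e ≤ ‖q.1.1 - q.2.1‖ ^ 2 + e := by nlinarith [sq_nonneg ‖q.1.1 - q.2.1‖]
  have h := norm_fderiv_testField_le hα hα2 he (q.1.1 - q.2.1) (EuclideanSpace.single j (1 : ℝ))
  have h2 := radialProfile_anti hα he h0
  simp only [PiLp.norm_single, norm_one, mul_one] at h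
  exact h.trans (by linarith)

lemma abs_pressureTerm_le {α e K Θ : ℝ} {η : SpaceTime → ℝ} {θ : ℝ → ℝ} (hα : 0 ≤ α) (he : 0 < e)
    (hε : 0 < ε) (hd : ∀ z, 0 ≤ dens z) (hη : ∀ z, |η z| ≤ K) (hθ : ∀ t, |θ t| ≤ Θ)
    (q : SpaceTimePair) :
    |pressureTerm α e m ε dens η θ q| ≤ Θ * K ^ 2 * radialProfile α e
      * (energyDensity m ε dens u Du q.1 * energyDensity m ε dens u Du q.2) := by
  obtain ⟨e1, e2, e3, e4, -⟩ := energyDensity_bounds (u := u) (Du := Du) (m := m) hε hd q.1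
  obtain ⟨f1, f2, -⟩ := energyDensity_bounds (u := u) (Du := Du) (m := m) hε hd q.2
  have h0 : e ≤ ‖q.1.1 - q.2.1‖ ^ 2 + e := by nlinarith [sq_nonneg ‖q.1.1 - q.2.1‖]
  have h2 := radialProfile_anti hα he h0
  have h3 := (radialProfile_pos α (normSq_add_pos he (q.1.1 - q.2.1))).le
  have hK : 0 ≤ K := (abs_nonneg _).trans (hη q.1)
  have hΘ : 0 ≤ Θ := (abs_nonneg _).trans (hθ 0)
  have hp := pressure_nonneg (m := m) hε (hd q.1)
  have hdq := hd q.2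
  have hk1 : 0 ≤ dens q.1 * ‖u q.1‖ ^ 2 := mul_nonneg (hd q.1) (sq_nonneg _)
  unfold pressureTerm
  rw [abs_mul, abs_mul, abs_mul, abs_mul, abs_mul, abs_of_nonneg h3, abs_of_nonneg hp,
    abs_of_nonneg hdq]
  have hpH : pressure m ε (dens q.1) ≤ energyDensity m ε dens u Du q.1 := by linarith
  calc _ ≤ Θ * (K * K * (energyDensity m ε dens u Du q.1 * energyDensity m ε dens u Du q.2)
        * radialProfile α e) := by
        gcongr
        exacts [hθ _, hη _, hη _]
    _ = _ := by ring

lemma abs_convexTerm_le {α e K Θ : ℝ} {η : SpaceTime → ℝ} {θ : ℝ → ℝ} (hα : 0 ≤ α) (hα2 : α ≤ 2)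
    (he : 0 < e) (hε : 0 < ε) (hd : ∀ z, 0 ≤ dens z) (hη : ∀ z, |η z| ≤ K) (hθ : ∀ t, |θ t| ≤ Θ)
    (q : SpaceTimePair) :
    |convexTerm dens u η θ (testField α e) q| ≤ 6 * Θ * K ^ 2 * radialProfile α e
      * (energyDensity m ε dens u Du q.1 * energyDensity m ε dens u Du q.2) := by
  obtain ⟨e1, e2, e3, e4, -⟩ := energyDensity_bounds (u := u) (Du := Du) (m := m) hε hd q.1
  obtain ⟨f1, f2, f3, -⟩ := energyDensity_bounds (u := u) (Du := Du) (m := m) hε hd q.2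
  have h0 : e ≤ ‖q.1.1 - q.2.1‖ ^ 2 + e := by nlinarith [sq_nonneg ‖q.1.1 - q.2.1‖]
  have h2 := radialProfile_anti hα he h0
  have h3 := (radialProfile_pos α he).le
  have hK : 0 ≤ K := (abs_nonneg _).trans (hη q.1)
  have hΘ : 0 ≤ Θ := (abs_nonneg _).trans (hθ 0)
  have hp := pressure_nonneg (m := m) hε (hd q.1)
  have hd1 := hd q.1
  have hd2 := hd q.2
  set H := energyDensity m ε dens u Du q.1
  set H' := energyDensity m ε dens u Du q.2
  have hin : |inner ℝ (u q.1) (fderiv ℝ (testField α e) (q.1.1 - q.2.1) (u q.1 - u q.2))|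
      ≤ ‖u q.1‖ * (3 * radialProfile α e * (‖u q.1‖ + ‖u q.2‖)) := by
    refine (abs_real_inner_le_norm _ _).trans ?_
    gcongr
    refine (norm_fderiv_testField_le hα hα2 he _ _).trans ?_
    gcongr
    exact norm_sub_le _ _
  unfold convexTerm
  rw [abs_mul, abs_mul, abs_mul, abs_mul, abs_mul, abs_of_nonneg hd1, abs_of_nonneg hd2]
  calc _ ≤ Θ * (K * K * (dens q.1 * dens q.2)
        * (‖u q.1‖ * (3 * radialProfile α e * (‖u q.1‖ + ‖u q.2‖)))) := by
        gcongr
        exacts [hθ _, hη _, hη _]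
    _ = 3 * Θ * K ^ 2 * radialProfile α e * (dens q.1 * ‖u q.1‖ ^ 2 * dens q.2
        + dens q.1 * ‖u q.1‖ * (dens q.2 * ‖u q.2‖)) := by ring
    _ ≤ 3 * Θ * K ^ 2 * radialProfile α e * (H * H' + H * H') := by
        have : dens q.1 * ‖u q.1‖ ^ 2 ≤ H := by linarith
        gcongr
    _ = _ := by ring

/-- On integration the balance laws vanish and `V' - V` cancels, so `(3/4 - 1/4) ∫ P ≤ 2 c ∫ C`. -/
lemma integral_le_of_symmetrized_le {X : Type*} [MeasurableSpace X] {μ : Measure X}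
    {P P' C C' M R V V' : X → ℝ} {c : ℝ} (hP : Integrable P μ) (hP' : Integrable P' μ)
    (hC : Integrable C μ) (hC' : Integrable C' μ) (hM : Integrable M μ) (hR : Integrable R μ)
    (hV : Integrable V μ) (hV' : Integrable V' μ) (zM : ∫ q, M q ∂μ = 0) (zR : ∫ q, R q ∂μ = 0)
    (sP : ∫ q, P' q ∂μ = ∫ q, P q ∂μ) (sC : ∫ q, C' q ∂μ = ∫ q, C q ∂μ)
    (sV : ∫ q, V' q ∂μ = ∫ q, V q ∂μ)
    (h : ∀ᵐ q ∂μ, 3 / 4 * P q - 1 / 4 * P' q - c * (C q + C' q)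
      ≤ M q + R q + (V' q - V q) / 2) : ∫ q, P q ∂μ ≤ 4 * c * ∫ q, C q ∂μ := by
  have i1 : Integrable (fun q => M q + R q) μ := hM.add hR
  have i2 : Integrable (fun q => V' q - V q) μ := hV'.sub hV
  have i3 : Integrable (fun q => (V' q - V q) / 2) μ := i2.div_const 2
  have i4 : Integrable (fun q => 3 / 4 * P q) μ := hP.const_mul _
  have i5 : Integrable (fun q => 1 / 4 * P' q) μ := hP'.const_mul _
  have i6 : Integrable (fun q => 3 / 4 * P q - 1 / 4 * P' q) μ := i4.sub i5
  have i7 : Integrable (fun q => c * (C q + C' q)) μ := (hC.add hC').const_mul _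
  have hmono := integral_mono_ae (i6.sub i7) (i1.add i3) h
  simp only [Pi.add_apply, Pi.sub_apply] at hmono
  rw [integral_sub i6 i7, integral_sub i4 i5, integral_const_mul, integral_const_mul,
    integral_const_mul, integral_add hC hC', integral_add i1 i3, integral_add hM hR, integral_div,
    integral_sub hV' hV, zM, zR, sP, sC, sV] at hmono
  linarith

set_option maxHeartbeats 1000000 in
lemma exists_lintegral_pressureTerm_le {Ω : Set Space3} (hΩm : MeasurableSet Ω) {R : ℝ}
    (hR : 0 < R) (hΩR : Ω ⊆ Metric.ball 0 R) {α : ℝ} (hα : 0 < α) (hα2 : α < 4 / 3)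
    (T ν₁ ν₂ E S : ℝ) {F : ℝ} (hF : 0 ≤ F)
    {κ : SpaceTime → ℝ} (hκ : IsTestFunction (spaceTimeCylinder Ω T) κ) (hκ0 : ∀ z, 0 ≤ κ z) :
    ∃ C : ℝ, 0 ≤ C ∧ ∀ {m ε e : ℝ}
    {f : SpaceTime → Space3} {dens : SpaceTime → ℝ} {u : SpaceTime → Space3}
    {Du : SpaceTime → Matrix (Fin 3) (Fin 3) ℝ} {θ : ℝ → ℝ},
    IsMeasurableFlow Ω T ν₁ ν₂ m ε E F S κ f dens u Du → 0 < ε → 0 < e → e ≤ 1 →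
    ContDiff ℝ ∞ θ → HasCompactSupport θ → (∀ t, 0 ≤ θ t) → (∀ t, θ (-t) = θ t) →
    ∫⁻ t, ENNReal.ofReal (θ t) ≤ 1 →
    ∫⁻ q, ENNReal.ofReal (pressureTerm α e m ε dens (fun z => κ z ^ 4) θ q)
        ∂((volume.restrict (spaceTimeCylinder Ω T)).prod
          (volume.restrict (spaceTimeCylinder Ω T)))
      ≤ ENNReal.ofReal C := by
  set η : SpaceTime → ℝ := fun z => κ z ^ 4 with hηdef
  have hη : IsTestFunction (spaceTimeCylinder Ω T) η := hκ.pow (by norm_num)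
  obtain ⟨K₁, hK₁, hκb, -, -⟩ := hκ.exists_bound
  obtain ⟨K₂, hK₂, hηb, hηt, hηs⟩ := hη.exists_bound
  set K := K₁ + K₂ with hK
  have hK0 : 0 < K := by positivity
  have hκK : ∀ z, κ z ≤ K := fun z => by linarith [le_abs_self (κ z), hκb z]
  replace hηb : ∀ z, |η z| ≤ K := fun z => by linarith [hηb z]
  replace hηt : ∀ z, |timeDeriv η z| ≤ K := fun z => by linarith [hηt z]
  replace hηs : ∀ j z, |spaceDeriv j η z| ≤ K := fun j z => by linarith [hηs j z]
  obtain ⟨C₁, hC₁, h1⟩ := exists_lintegral_controlTerm_le hΩm hR hΩR hα2 T E K S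
  obtain ⟨C₂, hC₂, h2⟩ := exists_doubled_lower_bound ν₁ ν₂ hα hα2 ((2 * R) ^ 2 + 1) hK0 hF
  refine ⟨4 * C₂ * C₁, by positivity, ?_⟩
  intro m ε e f dens u Du θ h hε he he1 hθ hθc hθ0 hθe hθ1
  obtain ⟨A, hA⟩ := hθ.continuous.bounded_above_of_compact_support hθc
  obtain ⟨A', hA'⟩ := (hθ.continuous_deriv (by simp)).bounded_above_of_compact_support hθc.deriv
  have hA0 : 0 ≤ A := (norm_nonneg _).trans (hA 0)
  have hA0' : 0 ≤ A' := (norm_nonneg _).trans (hA' 0)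
  set Θ := A + A' with hΘ
  have hθb : ∀ t, |θ t| ≤ Θ := fun t => by
    have := hA t
    rw [Real.norm_eq_abs] at this
    linarith
  have hθb' : ∀ t, |deriv θ t| ≤ Θ := fun t => by
    have := hA' t
    rw [Real.norm_eq_abs] at this
    linarith
  have hκm : Measurable κ := hκ.1.continuous.measurable
  have hηm : Measurable η := hη.1.continuous.measurable
  have hθm : Measurable θ := hθ.continuous.measurable
  have hb := contDiff_testField α he
  have hΩ : volume Ω ≠ ⊤ := (measure_mono hΩR).trans_lt measure_ball_lt_top |>.ne
  set b := testField α e with hbdef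
  set B := logWeight e ^ α + 3 * radialProfile α e with hB
  have hBL : 0 ≤ logWeight e ^ α := Real.rpow_nonneg (logWeight_pos he).le _
  have hBr : 0 ≤ radialProfile α e := (radialProfile_pos α he).le
  have hbB : ∀ x, ‖b x‖ ≤ B := fun x => by linarith [norm_testField_le_const hα.le he x]
  have hbB' : ∀ q j, ‖pairDeriv b q j‖ ≤ B := fun q j => by
    linarith [norm_pairDeriv_testField_le_const hα.le (by linarith) he q j]
  have hdn := h.dens_nonneg
  set N := sobolevWeight Ω u Du with hN
  set μ := (volume : Measure SpaceTime).restrict (spaceTimeCylinder Ω T) with hμ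
  have hH : Integrable (energyDensity m ε dens u Du) μ :=
    h.integrable_energyDensity hΩ hε hκm hκ0 hκK
  have hHH := hH.mul_prod hH
  have mM := h.measurable_pairMomentum hη hθ hb
  have mP := h.measurable_pressureTerm α e hηm hθm
  have mV := h.measurable_convexTerm hηm hθm hb
  have mR := h.measurable_pairMass hη hθ hb
  have mC := h.measurable_controlTerm hκm α e hθm
  -- Each balance law makes an integral over one of the two points vanish, so absolute integrability
  -- on the product is needed before the iterated integrals may be used.
  have iM : Integrable (pairMomentum ν₁ ν₂ m ε f dens u Du η θ b) (μ.prod μ) :=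
    (hHH.const_mul _).mono' mM.aestronglyMeasurable (ae_of_all _ fun q =>
      abs_pairMomentum_le hε hdn h.norm_f_le hηb hηt hηs hθb hθb' hbB hbB' q)
  have iR : Integrable (pairMass dens u η θ b) (μ.prod μ) :=
    (hHH.const_mul _).mono' mR.aestronglyMeasurable (ae_of_all _ fun q =>
      abs_pairMass_le hε hdn hηb hηt hηs hθb hθb' hbB hbB' q)
  have iP : Integrable (pressureTerm α e m ε dens η θ) (μ.prod μ) :=
    (hHH.const_mul _).mono' mP.aestronglyMeasurable (ae_of_all _ fun q =>
      abs_pressureTerm_le hα.le he hε hdn hηb hθb q)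
  have iV : Integrable (convexTerm dens u η θ b) (μ.prod μ) :=
    (hHH.const_mul _).mono' mV.aestronglyMeasurable (ae_of_all _ fun q =>
      abs_convexTerm_le hα.le (by linarith) he hε hdn hηb hθb q)
  have hP0 : ∀ q, 0 ≤ pressureTerm α e m ε dens η θ q := by
    intro q
    have h3 := (radialProfile_pos α (normSq_add_pos he (q.1.1 - q.2.1))).le
    have h4 := pressure_nonneg (m := m) hε (hdn q.1)
    have h5 := hdn q.2
    have h6 := hθ0 (q.1.2 - q.2.2)
    have h7 := hκ0 q.1
    have h8 := hκ0 q.2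
    simp only [pressureTerm, hηdef]
    positivity
  have hC0 : ∀ q, 0 ≤ controlTerm α e m ε κ N dens u Du θ q := by
    intro q
    have h3 := (singularKernel_pos α (normSq_add_pos he (q.1.1 - q.2.1))).le
    have h4 := pressure_nonneg (m := m) hε (hdn q.2)
    have h6 := hθ0 (q.1.2 - q.2.2)
    have h7 : 0 ≤ controlDensity m ε κ N dens u Du q.1 :=
      (zero_le_one.trans (energyDensity_bounds hε hdn q.1).1).trans
        (energyDensity_le_controlDensity hdn (sobolevWeight_pos Ω u Du) q.1)
    unfold controlTerm
    positivity
  have hCle := h1 h hε hκm hκ0 hκK he he1 hθm hθ0 hθ1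
  have iC : Integrable (controlTerm α e m ε κ N dens u Du θ) (μ.prod μ) := by
    refine ⟨mC.aestronglyMeasurable, ?_⟩
    rw [hasFiniteIntegral_iff_ofReal (ae_of_all _ hC0)]
    exact hCle.trans_lt ENNReal.ofReal_lt_top
  have hCint : ∫ q, controlTerm α e m ε κ N dens u Du θ q ∂(μ.prod μ) ≤ C₁ := by
    rw [integral_eq_lintegral_of_nonneg_ae (ae_of_all _ hC0) mC.aestronglyMeasurable]
    exact ENNReal.toReal_le_of_le_ofReal hC₁ hCle
  -- The momentum balance acts on the first point and the mass balance on the second, hence the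
  -- different orders of integration.
  have zM : ∫ q, pairMomentum ν₁ ν₂ m ε f dens u Du η θ b q ∂(μ.prod μ) = 0 := by
    rw [integral_prod_symm _ iM]
    simp_rw [hμ, h.integral_pairMomentum hη hθ hb]
    simp
  have zR : ∫ q, pairMass dens u η θ b q ∂(μ.prod μ) = 0 := by
    rw [integral_prod _ iR]
    simp_rw [hμ, h.integral_pairMass hη hθ hb]
    simp
  have sP := integral_prod_swap (μ := μ) (ν := μ) (pressureTerm α e m ε dens η θ)
  have sC := integral_prod_swap (μ := μ) (ν := μ) (controlTerm α e m ε κ N dens u Du θ)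
  have sV := integral_prod_swap (μ := μ) (ν := μ) (convexTerm dens u η θ b)
  have iPs := iP.swap
  have iCs := iC.swap
  have iVs := iV.swap
  -- The bound `D` of the kernel argument: two points of `Ω` are less than `2R` apart, and `e ≤ 1`.
  have hdom : ∀ᵐ q ∂(μ.prod μ), ‖q.1.1 - q.2.1‖ ^ 2 + e ≤ (2 * R) ^ 2 + 1 := by
    have hcyl : MeasurableSet (spaceTimeCylinder Ω T) := hΩm.prod measurableSet_Ioo
    rw [hμ, Measure.prod_restrict]
    filter_upwards [ae_restrict_mem (hcyl.prod hcyl)] with q hq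
    have a1 := hΩR hq.1.1
    have a2 := hΩR hq.2.1
    rw [mem_ball_zero_iff] at a1 a2
    have a3 : ‖q.1.1 - q.2.1‖ ≤ 2 * R := by linarith [norm_sub_le q.1.1 q.2.1]
    gcongr
  have hle := integral_le_of_symmetrized_le iP iPs iC iCs iM iR iV iVs zM zR sP sC sV
    (c := C₂) (by
      filter_upwards [hdom] with q hq
      exact h2 m ε e κ N dens u f Du η θ q hε he hdn h.norm_f_le hκ0 hκK (fun _ => rfl) hηb hηt
        hηs hθ0 hθe (sobolevWeight_pos Ω u Du) hq)
  rw [← ofReal_integral_eq_lintegral_ofReal iP (ae_of_all _ hP0)]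
  refine ENNReal.ofReal_le_ofReal (hle.trans ?_)
  gcongr
end
end

/-! ### Passage to equal times. -/

noncomputable section

open Filter Topology

lemma lintegral_spaceTime {g : SpaceTime → ENNReal} (hg : Measurable g) :
    ∫⁻ z, g z = ∫⁻ x, ∫⁻ t, g (x, t) := lintegral_prod _ hg.aemeasurable

lemma lintegral_spaceTime_symm {g : SpaceTime → ENNReal} (hg : Measurable g) :
    ∫⁻ z, g z = ∫⁻ t, ∫⁻ x, g (x, t) := lintegral_prod_symm' _ hg

/-- Bumps on the line that shrink to the origin. -/
def shrinkingBump (n : ℕ) : ContDiffBump (0 : ℝ) where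
  rIn := 1 / (n + 1)
  rOut := 2 / (n + 1)
  rIn_pos := by positivity
  rIn_lt_rOut := by gcongr; norm_num

/-- Normalized mollifiers on the line. -/
def timeMollifier (n : ℕ) : ℝ → ℝ := (shrinkingBump n).normed volume

lemma contDiff_timeMollifier (n : ℕ) : ContDiff ℝ ∞ (timeMollifier n) :=
  (shrinkingBump n).contDiff_normed

lemma timeMollifier_nonneg (n : ℕ) (t : ℝ) : 0 ≤ timeMollifier n t :=
  (shrinkingBump n).nonneg_normed t

lemma lintegral_timeMollifier (n : ℕ) : ∫⁻ t, ENNReal.ofReal (timeMollifier n t) ≤ 1 := by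
  unfold timeMollifier
  rw [← ofReal_integral_eq_lintegral_ofReal (shrinkingBump n).integrable_normed
    (ae_of_all _ (timeMollifier_nonneg n)), (shrinkingBump n).integral_normed, ENNReal.ofReal_one]

lemma ae_tendsto_time_mollification {h : SpaceTime → ℝ} (hm : Measurable h) (h0 : ∀ z, 0 ≤ h z)
    (hi : Integrable h) : ∀ᵐ w : SpaceTime, Tendsto (fun n => ∫⁻ s,
      ENNReal.ofReal (timeMollifier n (w.2 - s)) * ENNReal.ofReal (h (w.1, s))) atTop
      (𝓝 (ENNReal.ofReal (h w))) := by
  have hθ : ∀ n, Measurable (timeMollifier n) := fun n => (contDiff_timeMollifier n).continuous.measurable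
  -- Measurability of the convergence set allows arguing on almost every line parallel to the time
  -- axis, where the one-dimensional differentiation theorem applies.
  have hset : MeasurableSet {w : SpaceTime | Tendsto (fun n => ∫⁻ s,
      ENNReal.ofReal (timeMollifier n (w.2 - s)) * ENNReal.ofReal (h (w.1, s))) atTop
      (𝓝 (ENNReal.ofReal (h w)))} := by
    refine measurableSet_tendsto_fun (fun n => ?_) hm.ennreal_ofReal
    have hθn := hθ n
    refine Measurable.lintegral_prod_right' (f := fun p : SpaceTime × ℝ =>
      ENNReal.ofReal (timeMollifier n (p.1.2 - p.2)) * ENNReal.ofReal (h (p.1.1, p.2))) ?_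
    fun_prop
  rw [Measure.volume_eq_prod, Measure.ae_prod_iff_ae_ae hset]
  rw [Measure.volume_eq_prod] at hi
  filter_upwards [hi.prod_right_ae] with y hy
  have hlim := ContDiffBump.ae_convolution_tendsto_right_of_locallyIntegrable (μ := volume)
    (φ := shrinkingBump) (l := atTop) (K := 2) (g := fun s => h (y, s))
    (by
      have := (tendsto_one_div_add_atTop_nhds_zero_nat (𝕜 := ℝ)).const_mul 2
      simpa [shrinkingBump, div_eq_mul_inv] using this)
    (Eventually.of_forall fun n => by simp [shrinkingBump, div_eq_mul_inv]) hy.locallyIntegrable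
  filter_upwards [hlim] with t ht
  refine (ENNReal.tendsto_ofReal ht).congr fun n => ?_
  rw [convolution_lsmul_swap]
  have hθn := hθ n
  obtain ⟨A, hA⟩ := (contDiff_timeMollifier n).continuous.bounded_above_of_compact_support
    (shrinkingBump n).hasCompactSupport_normed
  have hint : Integrable fun s => timeMollifier n (t - s) * h (y, s) :=
    hy.bdd_mul (c := A) (hθn.comp (by fun_prop)).aestronglyMeasurable (ae_of_all _ fun s => hA _)
  refine (ofReal_integral_eq_lintegral_ofReal hint (ae_of_all _ fun s =>
    mul_nonneg (timeMollifier_nonneg n _) (h0 _))).trans ?_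
  exact lintegral_congr fun s => ENNReal.ofReal_mul (timeMollifier_nonneg n _)

/-- A bound for time-mollified interactions passes to the interaction at equal times. -/
lemma lintegral_interaction_le_of_mollified {g h : SpaceTime → ℝ} (hg : Measurable g)
    (hm : Measurable h) (h0 : ∀ z, 0 ≤ h z) (hi : Integrable h) {k : ℕ → Space3 → ℝ}
    {k₀ : Space3 → ℝ} (hk : ∀ n, Measurable (k n)) (hk₀ : Measurable k₀)
    (hlim : ∀ x, x ≠ 0 → Tendsto (fun n => k n x) atTop (𝓝 (k₀ x))) {C : ENNReal}
    (hC : ∀ n, ∫⁻ z : SpaceTime, ∫⁻ w : SpaceTime, ENNReal.ofReal (timeMollifier n (z.2 - w.2))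
      * (ENNReal.ofReal (g z) * ENNReal.ofReal (h w) * ENNReal.ofReal (k n (z.1 - w.1))) ≤ C) :
    ∫⁻ t : ℝ, ∫⁻ x : Space3, ∫⁻ y : Space3, ENNReal.ofReal (g (x, t)) * ENNReal.ofReal (h (y, t))
      * ENNReal.ofReal (k₀ (x - y)) ≤ C := by
  have hθ : ∀ n, Measurable (timeMollifier n) := fun n => (contDiff_timeMollifier n).continuous.measurable
  -- By Tonelli's theorem the mollifier is put entirely on `h`, so `g` has to be measurable but need
  -- not be integrable.
  set H : ℕ → SpaceTime → ENNReal := fun n w => ∫⁻ s,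
    ENNReal.ofReal (timeMollifier n (w.2 - s)) * ENNReal.ofReal (h (w.1, s)) with hH
  have hHm : ∀ n, Measurable (H n) := by
    intro n
    have hθn := hθ n
    refine Measurable.lintegral_prod_right' (f := fun p : SpaceTime × ℝ =>
      ENNReal.ofReal (timeMollifier n (p.1.2 - p.2)) * ENNReal.ofReal (h (p.1.1, p.2))) ?_
    fun_prop
  set Φ : ℕ → Space3 → SpaceTime → ENNReal := fun n x w =>
    ENNReal.ofReal (g (x, w.2)) * H n w * ENNReal.ofReal (k n (x - w.1)) with hΦ
  have hΦm : ∀ n, Measurable fun p : Space3 × SpaceTime => Φ n p.1 p.2 := by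
    intro n
    have := hHm n
    have := hk n
    simp only [hΦ]
    fun_prop
  have hΦle : ∀ n, ∫⁻ x, ∫⁻ w, Φ n x w ≤ C := by
    intro n
    refine le_trans (le_of_eq ?_) (hC n)
    have hθn := hθ n
    have hkn := hk n
    have hHn := hHm n
    have m1 : Measurable fun z : SpaceTime => ∫⁻ w : SpaceTime,
        ENNReal.ofReal (timeMollifier n (z.2 - w.2))
        * (ENNReal.ofReal (g z) * ENNReal.ofReal (h w) * ENNReal.ofReal (k n (z.1 - w.1))) := by
      refine Measurable.lintegral_prod_right' (f := fun p : SpaceTime × SpaceTime =>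
        ENNReal.ofReal (timeMollifier n (p.1.2 - p.2.2)) * (ENNReal.ofReal (g p.1)
          * ENNReal.ofReal (h p.2) * ENNReal.ofReal (k n (p.1.1 - p.2.1)))) ?_
      fun_prop
    rw [lintegral_spaceTime m1]
    refine lintegral_congr fun x => ?_
    have m2 : Measurable fun w : SpaceTime => Φ n x w := by
      simp only [hΦ]
      fun_prop
    rw [lintegral_spaceTime m2, lintegral_lintegral_swap (by fun_prop)]
    refine lintegral_congr fun t => ?_
    rw [lintegral_spaceTime (by fun_prop)]
    refine lintegral_congr fun y => ?_
    simp only [hΦ, hH]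
    rw [mul_right_comm, ← lintegral_const_mul _ (by fun_prop)]
    exact lintegral_congr fun s => by ring
  have hconv := ae_tendsto_time_mollification hm h0 hi
  have hpt : ∀ x : Space3, ∫⁻ w : SpaceTime, ENNReal.ofReal (g (x, w.2)) * ENNReal.ofReal (h w)
      * ENNReal.ofReal (k₀ (x - w.1)) ≤ liminf (fun n => ∫⁻ w, Φ n x w) atTop := by
    intro x
    refine le_trans ?_ (lintegral_liminf_le fun n => (hΦm n).comp measurable_prodMk_left)
    refine lintegral_mono_ae ?_
    -- The kernels converge only off the origin.
    have hne : ∀ᵐ w : SpaceTime, w.1 ≠ x := by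
      have : ∀ᵐ y : Space3, y ≠ x := by simp [ae_iff]
      rw [Measure.volume_eq_prod]
      exact Measure.quasiMeasurePreserving_fst.ae this
    filter_upwards [hconv, hne] with w hw hwx
    refine ge_of_eq (Tendsto.liminf_eq ?_)
    refine ENNReal.Tendsto.mul (ENNReal.Tendsto.const_mul hw (Or.inr ENNReal.ofReal_ne_top))
      (Or.inr ENNReal.ofReal_ne_top)
      (ENNReal.tendsto_ofReal (hlim _ (sub_ne_zero.2 hwx.symm))) (Or.inr ?_)
    exact ENNReal.mul_ne_top ENNReal.ofReal_ne_top ENNReal.ofReal_ne_top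
  have hfat : ∫⁻ x : Space3, ∫⁻ w : SpaceTime, ENNReal.ofReal (g (x, w.2)) * ENNReal.ofReal (h w)
      * ENNReal.ofReal (k₀ (x - w.1)) ≤ C := by
    -- Second use of Fatou's lemma, now in `x`; the first one, in `w`, is contained in `hpt`.
    refine (lintegral_mono hpt).trans ((lintegral_liminf_le fun n =>
      (hΦm n).lintegral_prod_right').trans ?_)
    exact liminf_le_of_le (by isBoundedDefault) fun b hb => by
      obtain ⟨n, hn⟩ := hb.exists
      exact hn.trans (hΦle n)
  have mΨ : Measurable fun p : (Space3 × ℝ) × Space3 => ENNReal.ofReal (g (p.1.1, p.1.2))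
      * ENNReal.ofReal (h (p.2, p.1.2)) * ENNReal.ofReal (k₀ (p.1.1 - p.2)) := by fun_prop
  have mΨ' := mΨ.lintegral_prod_right' (ν := (volume : Measure Space3))
  rw [← lintegral_lintegral_swap (f := fun (x : Space3) (t : ℝ) => ∫⁻ y : Space3,
    ENNReal.ofReal (g (x, t)) * ENNReal.ofReal (h (y, t)) * ENNReal.ofReal (k₀ (x - y)))
    mΨ'.aemeasurable]
  refine le_trans (le_of_eq (lintegral_congr fun x => ?_)) hfat
  rw [lintegral_spaceTime_symm (by fun_prop)]
end

/-! ### The interaction energy of the localized density. -/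

noncomputable section

open Filter Topology

lemma IsTestFunction.eq_zero_of_notMem {U : Set SpaceTime} {κ : SpaceTime → ℝ}
    (hκ : IsTestFunction U κ) {z : SpaceTime} (hz : z ∉ U) : κ z = 0 :=
  image_eq_zero_of_notMem_tsupport fun h => hz (hκ.2.2 h)

/-- The regularization `e = 1/(n+1)` and the time mollifier shrink together in the estimate of the
doubled pressure. The pressure is replaced by its minorant `dens ^ (3/2)`, which removes `m` and
`ε`. -/
lemma exists_interaction_le {Ω : Set Space3} (hΩm : MeasurableSet Ω) {R : ℝ}
    (hR : 0 < R) (hΩR : Ω ⊆ Metric.ball 0 R) {α : ℝ} (hα : 0 < α) (hα2 : α < 4 / 3)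
    (T ν₁ ν₂ E S : ℝ) {F : ℝ} (hF : 0 ≤ F)
    {κ : SpaceTime → ℝ} (hκ : IsTestFunction (spaceTimeCylinder Ω T) κ) (hκ0 : ∀ z, 0 ≤ κ z) :
    ∃ C : ℝ, 0 ≤ C ∧ ∀ {m ε : ℝ}
    {f : SpaceTime → Space3} {dens : SpaceTime → ℝ} {u : SpaceTime → Space3}
    {Du : SpaceTime → Matrix (Fin 3) (Fin 3) ℝ},
    IsMeasurableFlow Ω T ν₁ ν₂ m ε E F S κ f dens u Du → 0 < ε →
    ∫⁻ t : ℝ, ∫⁻ x : Space3, ∫⁻ y : Space3,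
      ENNReal.ofReal (κ (x, t) ^ 4 * dens (x, t) ^ (3 / 2 : ℝ))
        * ENNReal.ofReal (κ (y, t) ^ 4 * dens (y, t))
        * ENNReal.ofReal (radialProfile α (‖x - y‖ ^ 2)) ≤ ENNReal.ofReal C := by
  obtain ⟨C, hC, hC2⟩ := exists_lintegral_pressureTerm_le hΩm hR hΩR hα hα2 T ν₁ ν₂ E S hF hκ hκ0
  obtain ⟨K, hK, hκK, -, -⟩ := hκ.exists_bound
  refine ⟨C, hC, ?_⟩
  intro m ε f dens u Du h hε
  have hκm : Measurable κ := hκ.1.continuous.measurable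
  have hdm := h.measurable_dens
  have hd := h.dens_nonneg
  have hcyl : MeasurableSet (spaceTimeCylinder Ω T) := hΩm.prod measurableSet_Ioo
  have hΩ : volume Ω ≠ ⊤ := (measure_mono hΩR).trans_lt measure_ball_lt_top |>.ne
  have hrm := measurable_radialProfile α
  refine lintegral_interaction_le_of_mollified (g := fun z => κ z ^ 4 * dens z ^ (3 / 2 : ℝ))
    (h := fun z => κ z ^ 4 * dens z) (k := fun n x => radialProfile α (‖x‖ ^ 2 + 1 / (n + 1)))
    (k₀ := fun x => radialProfile α (‖x‖ ^ 2)) (by fun_prop) (by fun_prop)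
    (fun z => mul_nonneg (by have := hκ0 z; positivity) (hd z)) ?_ (by fun_prop) (by fun_prop)
    ?_ ?_
  · have hH := (h.integrable_energyDensity hΩ hε hκm hκ0
      (fun z => (le_abs_self _).trans (hκK z))).const_mul (K ^ 4)
    have hon : IntegrableOn (fun z => κ z ^ 4 * dens z) (spaceTimeCylinder Ω T) := by
      refine hH.mono' (by fun_prop) (ae_of_all _ fun z => ?_)
      obtain ⟨-, h2, -⟩ := energyDensity_bounds (u := u) (Du := Du) (m := m) hε hd z
      have h3 : κ z ≤ K := (le_abs_self _).trans (hκK z)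
      have h4 := hκ0 z
      have h5 := hd z
      rw [Real.norm_of_nonneg (by positivity)]
      gcongr
    refine (integrableOn_iff_integrable_of_support_subset fun z hz => ?_).1 hon
    by_contra hz2
    exact hz (by simp [hκ.eq_zero_of_notMem hz2])
  · intro x hx
    have hx2 : 0 < ‖x‖ ^ 2 := by have := norm_pos_iff.2 hx; positivity
    have h1 : Tendsto (fun n : ℕ => ‖x‖ ^ 2 + 1 / ((n : ℝ) + 1)) atTop (𝓝 (‖x‖ ^ 2)) := by
      simpa using (tendsto_one_div_add_atTop_nhds_zero_nat (𝕜 := ℝ)).const_add (‖x‖ ^ 2)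
    exact ((contDiffAt_radialProfile α hx2).continuousAt.tendsto).comp h1
  · intro n
    have he : (0 : ℝ) < 1 / (n + 1) := by positivity
    have he1 : (1 : ℝ) / (n + 1) ≤ 1 := by
      rw [div_le_one (by positivity)]; linarith [n.cast_nonneg (α := ℝ)]
    have hθ := contDiff_timeMollifier n
    have hθm := hθ.continuous.measurable
    refine le_trans ?_ (hC2 (θ := timeMollifier n) h hε he he1 hθ
      (shrinkingBump n).hasCompactSupport_normed (timeMollifier_nonneg n)
      (shrinkingBump n).normed_neg (lintegral_timeMollifier n))
    rw [lintegral_prod _ (h.measurable_pressureTerm α _ (by fun_prop)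
      hθm).ennreal_ofReal.aemeasurable, ← lintegral_indicator hcyl]
    refine lintegral_mono fun z => ?_
    by_cases hz : z ∈ spaceTimeCylinder Ω T
    · rw [indicator_of_mem hz, ← lintegral_indicator hcyl]
      refine lintegral_mono fun w => ?_
      by_cases hw : w ∈ spaceTimeCylinder Ω T
      · rw [indicator_of_mem hw]
        have h1 := hd z
        have h2 := hd w
        have h3 := hκ0 z
        have h4 := hκ0 w
        have h5 := timeMollifier_nonneg n (z.2 - w.2)
        have h6 := (radialProfile_pos α (normSq_add_pos he (z.1 - w.1))).le
        have h7 := rpow_le_pressure (m := m) hε h1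
        rw [← ENNReal.ofReal_mul (by positivity), ← ENNReal.ofReal_mul (by positivity),
          ← ENNReal.ofReal_mul (by positivity)]
        refine ENNReal.ofReal_le_ofReal ?_
        unfold pressureTerm
        simp only
        calc _ = timeMollifier n (z.2 - w.2) * (κ z ^ 4 * κ w ^ 4
              * (dens z ^ (3 / 2 : ℝ) * dens w)
              * radialProfile α (‖z.1 - w.1‖ ^ 2 + 1 / ((n : ℝ) + 1))) := by ring
          _ ≤ _ := by gcongr
      · simp [hκ.eq_zero_of_notMem hw]
    · simp [hκ.eq_zero_of_notMem hz]
end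

/-! ### Reduction to everywhere measurable representatives. -/

noncomputable section

lemma ae_ae_of_ae_cylinder {Ω : Set Space3} {T : ℝ} {p : SpaceTime → Prop}
    (h : ∀ᵐ z ∂(volume.restrict (spaceTimeCylinder Ω T)), p z) :
    ∀ᵐ t ∂(volume.restrict (Ioo (0 : ℝ) T)), ∀ᵐ x ∂(volume.restrict Ω), p (x, t) := by
  rw [volume_restrict_cylinder] at h
  exact Measure.ae_ae_of_ae_prod
    ((Measure.measurePreserving_swap (μ := volume.restrict (Ioo (0 : ℝ) T))
      (ν := volume.restrict Ω)).quasiMeasurePreserving.ae h)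

lemma IsTestFunction.slice {Ω : Set Space3} {T : ℝ} {κ : SpaceTime → ℝ}
    (hκ : IsTestFunction (spaceTimeCylinder Ω T) κ) (t : ℝ) :
    IsTestFunction Ω fun x => κ (x, t) := by
  obtain ⟨h1, h2, h3⟩ := hκ
  have hc : IsCompact (Prod.fst '' tsupport κ) := h2.image continuous_fst
  have hs : Function.support (fun x => κ (x, t)) ⊆ Prod.fst '' tsupport κ := fun x hx =>
    ⟨(x, t), subset_tsupport κ hx, rfl⟩
  have hts : tsupport (fun x => κ (x, t)) ⊆ Prod.fst '' tsupport κ :=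
    closure_minimal hs hc.isClosed
  refine ⟨h1.comp (contDiff_id.prodMk contDiff_const), hc.of_isClosed_subset isClosed_closure hts,
    hts.trans ?_⟩
  rintro x ⟨z, hz, rfl⟩
  exact (h3 hz).1

lemma fderiv_slice {κ : SpaceTime → ℝ} (hκ : ContDiff ℝ ∞ κ) (x : Space3) (t : ℝ) (j : Fin 3) :
    fderiv ℝ (fun x => κ (x, t)) x (EuclideanSpace.single j (1 : ℝ)) = spaceDeriv j κ (x, t) := by
  have h1 : HasFDerivAt (fun x : Space3 => (x, t)) (ContinuousLinearMap.inl ℝ Space3 ℝ) x :=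
    hasFDerivAt_prodMk_left x t
  have h2 := ((hκ.differentiable (by simp)) (x, t)).hasFDerivAt.comp x h1
  have h3 : fderiv ℝ (fun x => κ (x, t)) x = _ := h2.fderiv
  rw [h3]
  simp [spaceDeriv]

/-- All hypotheses are insensitive to null sets of `Q_T`, except that weak gradients are given on
time slices. The Sobolev bound is therefore derived for the original velocity on almost every slice
and carried over to the representatives. -/
lemma exists_isMeasurableFlow {Ω : Set Space3} (hΩ : IsOpen Ω) {T : ℝ} {κ : SpaceTime → ℝ}
    (hκ : IsTestFunction (spaceTimeCylinder Ω T) κ) (hκ0 : ∀ z, 0 ≤ κ z) (Cf : ℝ) :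
    ∃ S : ℝ, ∀ {ν₁ ν₂ m ε E : ℝ} {f : SpaceTime → Space3} {dens : SpaceTime → ℝ}
      {u : SpaceTime → Space3} {Du : SpaceTime → Matrix (Fin 3) (Fin 3) ℝ},
      AEMeasurable f (volume.restrict (spaceTimeCylinder Ω T)) →
      (∀ᵐ z ∂(volume.restrict (spaceTimeCylinder Ω T)), ‖f z‖ ≤ Cf) →
      IsEnergyWeakSolution Ω T ν₁ ν₂ m ε E f dens u Du →
      ∃ (f' : SpaceTime → Space3) (dens' : SpaceTime → ℝ) (u' : SpaceTime → Space3)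
        (Du' : SpaceTime → Matrix (Fin 3) (Fin 3) ℝ),
        IsMeasurableFlow Ω T ν₁ ν₂ m ε E (max Cf 0) S κ f' dens' u' Du' ∧
          dens =ᵐ[volume.restrict (spaceTimeCylinder Ω T)] dens' := by
  obtain ⟨K, hK, hκK, -, hκs⟩ := hκ.exists_bound
  obtain ⟨S, hS⟩ := exists_sobolev_cutoff K
  refine ⟨S, ?_⟩
  intro ν₁ ν₂ m ε E f dens u Du hf hfb h
  set μ := (volume : Measure SpaceTime).restrict (spaceTimeCylinder Ω T) with hμ
  -- The truncation changes the force only on a null set of `Q_T` and makes its bound hold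
  -- everywhere; the maximum with 0 admits the value zero.
  set f' : SpaceTime → Space3 := {z | ‖hf.mk f z‖ ≤ max Cf 0}.indicator (hf.mk f) with hf'
  set dens' : SpaceTime → ℝ := fun z => max (h.aemeasurable_dens.mk dens z) 0 with hdens'
  set u' := h.aemeasurable_u.mk u with hu'
  set Du' : SpaceTime → Matrix (Fin 3) (Fin 3) ℝ := fun z =>
    Matrix.of fun i j => (h.aemeasurable_Du i j).mk (fun z => Du z i j) z with hDu'
  have ef : f =ᵐ[μ] f' := by
    filter_upwards [hf.ae_eq_mk, hfb] with z h1 h2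
    rw [hf', indicator_of_mem, ← h1]
    rw [mem_ofPred_eq, ← h1]
    exact h2.trans (le_max_left _ _)
  have ed : dens =ᵐ[μ] dens' := by
    filter_upwards [h.aemeasurable_dens.ae_eq_mk, h.dens_nonneg] with z h1 h2
    simp only [hdens']
    rw [← h1, max_eq_left h2]
  have eu : u =ᵐ[μ] u' := h.aemeasurable_u.ae_eq_mk
  have eD : Du =ᵐ[μ] Du' := by
    have : ∀ᵐ z ∂μ, ∀ i j, Du z i j = (h.aemeasurable_Du i j).mk (fun z => Du z i j) z := by
      rw [ae_all_iff]
      intro i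
      rw [ae_all_iff]
      intro j
      exact (h.aemeasurable_Du i j).ae_eq_mk
    filter_upwards [this] with z hz
    ext i j
    exact hz i j
  have sd := ae_ae_of_ae_cylinder ed
  have su := ae_ae_of_ae_cylinder eu
  have sD := ae_ae_of_ae_cylinder eD
  have mf : Measurable f' :=
    hf.measurable_mk.indicator (measurableSet_le hf.measurable_mk.norm measurable_const)
  refine ⟨f', dens', u', Du', ?_, ed⟩
  exact
    { measurable_dens := h.aemeasurable_dens.measurable_mk.max measurable_const
      measurable_u := h.aemeasurable_u.measurable_mk
      measurable_Du := fun i j => (h.aemeasurable_Du i j).measurable_mk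
      measurable_f := mf
      dens_nonneg := fun z => le_max_right _ _
      norm_f_le := by
        intro z
        rw [hf']
        by_cases hz : ‖hf.mk f z‖ ≤ max Cf 0
        · rw [indicator_of_mem (show z ∈ {z | ‖hf.mk f z‖ ≤ max Cf 0} from hz)]
          exact hz
        · rw [indicator_of_notMem (show z ∉ {z | ‖hf.mk f z‖ ≤ max Cf 0} from hz)]
          simp
      pressure_le := by
        filter_upwards [h.pressure_le, sd] with t h1 h2
        rwa [lintegral_congr_ae (h2.mono fun x hx => by rw [← hx])]
      kinetic_le := by
        filter_upwards [h.kinetic_le, sd, su] with t h1 h2 h3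
        rwa [lintegral_congr_ae ((h2.and h3).mono fun x hx => by rw [← hx.1, ← hx.2])]
      dissipation_le := by
        rw [lintegral_congr_ae ((eu.and eD).mono fun x hx => by rw [← hx.1, ← hx.2])]
        exact h.dissipation_le
      sobolev_le := by
        filter_upwards [h.weakGradient, su, sD] with t h1 h2 h3
        have h4 := hS Ω _ _ _ hΩ h1 (hκ.slice t) (fun x => hκK (x, t)) (fun x j => by
          rw [fderiv_slice hκ.1]
          exact hκs j (x, t))
        rw [ENNReal.ofReal_coe_nnreal]
        have e1 : ∫⁻ x in Ω, ENNReal.ofReal ((κ (x, t) * ‖u' (x, t)‖) ^ 6)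
            = ∫⁻ x in Ω, ENNReal.ofReal ((|κ (x, t)| * ‖u (x, t)‖) ^ 6) :=
          lintegral_congr_ae (h2.mono fun x hx => by
            simp only
            rw [hx, abs_of_nonneg (hκ0 _)])
        have e2 : ∫⁻ x in Ω, ENNReal.ofReal (‖u' (x, t)‖ ^ 2 + ∑ i, ∑ j, Du' (x, t) i j ^ 2)
            = ∫⁻ x in Ω, ENNReal.ofReal (‖u (x, t)‖ ^ 2 + ∑ i, ∑ j, Du (x, t) i j ^ 2) :=
          lintegral_congr_ae ((h2.and h3).mono fun x hx => by
            simp only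
            rw [hx.1, hx.2])
        rw [e1, e2]
        exact h4
      momentum := by
        intro ξ hξ
        rw [← h.momentum ξ hξ]
        refine integral_congr_ae ?_
        filter_upwards [ef, ed, eu, eD] with z h1 h2 h3 h4
        rw [h1, h2, h3, h4]
      mass := by
        intro ψ hψ
        rw [← h.mass ψ hψ]
        refine integral_congr_ae ?_
        filter_upwards [ed, eu] with z h2 h3
        rw [h2, h3] }
end

/-! ### Logarithmic Riesz kernels and their composition. -/

noncomputable section

/-- The logarithmic factor `1 + |ln r|`. -/
def logFactor (r : ℝ) : ℝ := 1 + |Real.log r|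

lemma one_le_logFactor (r : ℝ) : 1 ≤ logFactor r := le_add_of_nonneg_right (abs_nonneg _)

lemma measurable_logFactor : Measurable logFactor := by unfold logFactor; fun_prop

/-- Submultiplicativity makes the kernel homogeneous under dilations up to a logarithmic factor. -/
lemma logFactor_mul_le {a b : ℝ} (ha : a ≠ 0) (hb : b ≠ 0) :
    logFactor (a * b) ≤ logFactor a * logFactor b := by
  unfold logFactor
  rw [Real.log_mul ha hb]
  nlinarith [abs_add_le (Real.log a) (Real.log b),
    mul_nonneg (abs_nonneg (Real.log a)) (abs_nonneg (Real.log b))]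

lemma logFactor_le_rpow {r τ : ℝ} (hr : 0 < r) (hτ : 0 < τ) :
    logFactor r ≤ (1 + 1 / τ) * (r ^ τ + r ^ (-τ)) := by
  have h1 : Real.log r ≤ r ^ τ / τ := Real.log_le_rpow_div hr.le hτ
  have h2 : Real.log r⁻¹ ≤ r⁻¹ ^ τ / τ := Real.log_le_rpow_div (by positivity) hτ
  rw [Real.log_inv, Real.inv_rpow hr.le, ← Real.rpow_neg hr.le] at h2
  have h3 : 0 < r ^ τ := by positivity
  have h4 : 0 < r ^ (-τ) := by positivity
  have h5 : r ^ τ * r ^ (-τ) = 1 := by rw [← Real.rpow_add hr]; simp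
  have h6 : 1 ≤ r ^ τ + r ^ (-τ) := by nlinarith [sq_nonneg (r ^ τ + r ^ (-τ) - 1)]
  have h7 : |Real.log r| ≤ r ^ τ / τ + r ^ (-τ) / τ := by
    have := div_pos h3 hτ
    have := div_pos h4 hτ
    rw [abs_le]; constructor <;> linarith
  calc logFactor r ≤ (r ^ τ + r ^ (-τ)) + (r ^ τ / τ + r ^ (-τ) / τ) := by
        unfold logFactor; linarith
    _ = _ := by ring

lemma logFactor_rpow_le {μ : ℝ} (hμ1 : μ ≤ 1) (r : ℝ) : logFactor r ^ μ ≤ logFactor r := by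
  simpa using Real.rpow_le_rpow_of_exponent_le (one_le_logFactor r) hμ1

/-- The kernel `|w|⁻² (1 + |ln |w||)^μ`. -/
def potentialKernel (μ : ℝ) (w : Space3) : ℝ := 1 / ‖w‖ ^ 2 * logFactor ‖w‖ ^ μ

lemma measurable_potentialKernel (μ : ℝ) : Measurable (potentialKernel μ) := by
  have := measurable_logFactor
  unfold potentialKernel; fun_prop

lemma potentialKernel_nonneg (μ : ℝ) (w : Space3) : 0 ≤ potentialKernel μ w := by
  have := one_le_logFactor ‖w‖
  unfold potentialKernel; positivity

/-- A quarter power pays for the logarithm on either side of 1: the exponent `9/4 < 3` is integrable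
at the origin, and twice `7/4` exceeds 3, so the kernel is square integrable at infinity. -/
lemma potentialKernel_le {μ : ℝ} (hμ1 : μ ≤ 1) {w : Space3} (hw : w ≠ 0) :
    potentialKernel μ w ≤ 5 * (‖w‖ ^ (-(7 / 4) : ℝ) + ‖w‖ ^ (-(9 / 4) : ℝ)) := by
  have hr : 0 < ‖w‖ := norm_pos_iff.2 hw
  have h1 : (1 : ℝ) / ‖w‖ ^ 2 = ‖w‖ ^ (-2 : ℝ) := by
    rw [Real.rpow_neg hr.le, Real.rpow_two, one_div]
  unfold potentialKernel
  rw [h1]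
  calc _ ≤ ‖w‖ ^ (-2 : ℝ) * (5 * (‖w‖ ^ (1 / 4 : ℝ) + ‖w‖ ^ (-(1 / 4) : ℝ))) := by
        gcongr
        refine (logFactor_rpow_le hμ1 _).trans ((logFactor_le_rpow hr
          (show (0 : ℝ) < 1 / 4 by norm_num)).trans_eq ?_)
        norm_num
    _ = 5 * (‖w‖ ^ (-2 : ℝ) * ‖w‖ ^ (1 / 4 : ℝ) + ‖w‖ ^ (-2 : ℝ) * ‖w‖ ^ (-(1 / 4) : ℝ)) := by
        ring
    _ = _ := by
        rw [← Real.rpow_add hr, ← Real.rpow_add hr]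
        norm_num

lemma potentialKernel_zero (μ : ℝ) : potentialKernel μ 0 = 0 := by simp [potentialKernel]

lemma potentialKernel_le_near {μ : ℝ} (hμ1 : μ ≤ 1) {w : Space3} (hw : ‖w‖ ≤ 1) :
    potentialKernel μ w ≤ 10 * ‖w‖ ^ (-(9 / 4) : ℝ) := by
  rcases eq_or_ne w 0 with rfl | h0
  · rw [potentialKernel_zero]; positivity
  have hr : 0 < ‖w‖ := norm_pos_iff.2 h0
  have h : ‖w‖ ^ (-(7 / 4) : ℝ) ≤ ‖w‖ ^ (-(9 / 4) : ℝ) :=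
    Real.rpow_le_rpow_of_exponent_ge hr hw (by norm_num)
  linarith [potentialKernel_le hμ1 h0]

lemma potentialKernel_le_far {μ : ℝ} (hμ1 : μ ≤ 1) {w : Space3} (hw : 1 / 2 ≤ ‖w‖) :
    potentialKernel μ w ≤ 15 * ‖w‖ ^ (-(7 / 4) : ℝ) := by
  have hr : 0 < ‖w‖ := by linarith
  have h0 : w ≠ 0 := norm_pos_iff.1 hr
  have h1 : ‖w‖ ^ (-(1 / 2) : ℝ) ≤ 2 := by
    calc ‖w‖ ^ (-(1 / 2) : ℝ) ≤ (1 / 2 : ℝ) ^ (-(1 / 2) : ℝ) :=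
          Real.rpow_le_rpow_of_nonpos (by norm_num) hw (by norm_num)
      _ = 2 ^ (1 / 2 : ℝ) := by
          rw [one_div, Real.inv_rpow (by norm_num), Real.rpow_neg (by norm_num), inv_inv]
      _ ≤ (2 : ℝ) ^ (1 : ℝ) := Real.rpow_le_rpow_of_exponent_le (by norm_num) (by norm_num)
      _ = 2 := Real.rpow_one 2
  have h2 : ‖w‖ ^ (-(9 / 4) : ℝ) = ‖w‖ ^ (-(7 / 4) : ℝ) * ‖w‖ ^ (-(1 / 2) : ℝ) := by
    rw [← Real.rpow_add hr]; norm_num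
  have h3 : ‖w‖ ^ (-(9 / 4) : ℝ) ≤ ‖w‖ ^ (-(7 / 4) : ℝ) * 2 := by rw [h2]; gcongr
  linarith [potentialKernel_le hμ1 h0]

lemma potentialKernel_le_const {μ : ℝ} (hμ1 : μ ≤ 1) {w : Space3} (hw : 1 / 2 ≤ ‖w‖) :
    potentialKernel μ w ≤ 60 := by
  have h1 : ‖w‖ ^ (-(7 / 4) : ℝ) ≤ 4 := by
    calc ‖w‖ ^ (-(7 / 4) : ℝ) ≤ (1 / 2 : ℝ) ^ (-(7 / 4) : ℝ) :=
          Real.rpow_le_rpow_of_nonpos (by norm_num) hw (by norm_num)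
      _ = 2 ^ (7 / 4 : ℝ) := by
          rw [one_div, Real.inv_rpow (by norm_num), Real.rpow_neg (by norm_num), inv_inv]
      _ ≤ (2 : ℝ) ^ (2 : ℝ) := Real.rpow_le_rpow_of_exponent_le (by norm_num) (by norm_num)
      _ = 4 := by norm_num
  linarith [potentialKernel_le_far hμ1 hw]

lemma potentialKernel_smul_le {μ : ℝ} (hμ0 : 0 ≤ μ) {d : ℝ} (hd : 0 < d) (w : Space3) :
    potentialKernel μ (d • w) ≤ d⁻¹ ^ 2 * logFactor d ^ μ * potentialKernel μ w := by
  rcases eq_or_ne w 0 with rfl | h0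
  · simp [potentialKernel_zero]
  have hr : 0 < ‖w‖ := norm_pos_iff.2 h0
  have h1 := one_le_logFactor d
  have h2 := one_le_logFactor ‖w‖
  have h3 := one_le_logFactor (d * ‖w‖)
  unfold potentialKernel
  rw [norm_smul, Real.norm_of_nonneg hd.le]
  have h4 : logFactor (d * ‖w‖) ^ μ ≤ logFactor d ^ μ * logFactor ‖w‖ ^ μ := by
    rw [← Real.mul_rpow (by linarith) (by linarith)]
    exact Real.rpow_le_rpow (by linarith) (logFactor_mul_le hd.ne' hr.ne') hμ0
  calc _ ≤ 1 / (d * ‖w‖) ^ 2 * (logFactor d ^ μ * logFactor ‖w‖ ^ μ) := by gcongr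
    _ = _ := by field_simp

lemma lintegral_norm_rpow_ball_lt_top (R : ℝ) :
    ∫⁻ w in Metric.ball (0 : Space3) R, ENNReal.ofReal (‖w‖ ^ (-(9 / 4) : ℝ)) < ⊤ := by
  have h : IntegrableOn (fun w : Space3 => ‖w‖ ^ (-(9 / 4) : ℝ)) (Metric.ball 0 R) := by
    refine integrableOn_ball_of_norm_le_rpow (C := 1) (α := 9 / 4) (by simp) (by simp; norm_num)
      (ae_of_all _ fun x => ?_) (Measurable.aestronglyMeasurable (by fun_prop))
    rw [Real.norm_of_nonneg (by positivity), one_mul]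
  exact (hasFiniteIntegral_iff_ofReal (ae_of_all _ fun x => by positivity)).1 h.2

lemma lintegral_one_add_norm_lt_top :
    ∫⁻ w : Space3, ENNReal.ofReal ((1 + ‖w‖) ^ (-(7 / 2) : ℝ)) < ⊤ :=
  (hasFiniteIntegral_iff_ofReal (ae_of_all _ fun x => by positivity)).1
    (integrable_one_add_norm (by simp; norm_num)).2

/-- The singularities are at distance one, so each point is at distance at least 1/2 from one of
them, where that factor is at most 60. Near the other singularity the remaining factor is
integrable; away from both, `a b ≤ a² + b²` reduces to square integrability of the tails. -/
lemma exists_lintegral_unit_kernel_le {μ : ℝ} (hμ1 : μ ≤ 1) : ∃ M : ENNReal, M ≠ ⊤ ∧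
    ∀ e : Space3, ‖e‖ = 1 → ∫⁻ w, ENNReal.ofReal (potentialKernel μ w)
      * ENNReal.ofReal (potentialKernel μ (w - e)) ≤ M := by
  set B := Metric.ball (0 : Space3) (1 / 2) with hB
  set k : Space3 → ENNReal := fun w => ENNReal.ofReal (potentialKernel μ w) with hk
  have hkm : Measurable k := (measurable_potentialKernel μ).ennreal_ofReal
  have hBm : MeasurableSet B := measurableSet_ball
  set G : Space3 → ENNReal := fun w => 60 * B.indicator k w + Bᶜ.indicator (fun w => k w ^ 2) w
    with hG
  have hG₁ : Measurable fun w => 60 * B.indicator k w := (hkm.indicator hBm).const_mul 60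
  have hGm : Measurable G := hG₁.add ((hkm.pow_const 2).indicator hBm.compl)
  have hk60 : ∀ w, w ∉ B → k w ≤ 60 := by
    intro w hw
    rw [hB, mem_ball_zero_iff, not_lt] at hw
    calc k w ≤ ENNReal.ofReal 60 := ENNReal.ofReal_le_ofReal (potentialKernel_le_const hμ1 hw)
      _ = 60 := by norm_num
  have hGfin : ∫⁻ w, G w < ⊤ := by
    simp only [hG]
    rw [lintegral_add_left hG₁, lintegral_const_mul _
      (hkm.indicator hBm), lintegral_indicator hBm, lintegral_indicator hBm.compl]
    refine ENNReal.add_lt_top.2 ⟨ENNReal.mul_lt_top (by norm_num) ?_, ?_⟩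
    · refine lt_of_le_of_lt (setLIntegral_mono' hBm (g := fun w =>
        ENNReal.ofReal 10 * ENNReal.ofReal (‖w‖ ^ (-(9 / 4) : ℝ))) fun w hw => ?_) ?_
      · rw [← ENNReal.ofReal_mul (by norm_num)]
        rw [hB, mem_ball_zero_iff] at hw
        exact ENNReal.ofReal_le_ofReal (potentialKernel_le_near hμ1 (by linarith))
      · rw [lintegral_const_mul _ (by fun_prop)]
        exact ENNReal.mul_lt_top ENNReal.ofReal_lt_top (lintegral_norm_rpow_ball_lt_top _)
    · refine lt_of_le_of_lt ((setLIntegral_mono' hBm.compl (g := fun w =>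
        ENNReal.ofReal (225 * (1 / 3) ^ (-(7 / 2) : ℝ))
          * ENNReal.ofReal ((1 + ‖w‖) ^ (-(7 / 2) : ℝ))) fun w hw => ?_).trans
            (setLIntegral_le_lintegral _ _)) ?_
      · rw [hB, mem_compl_iff, mem_ball_zero_iff, not_lt] at hw
        rw [← ENNReal.ofReal_mul (by positivity), hk, ← ENNReal.ofReal_pow
          (potentialKernel_nonneg μ w)]
        refine ENNReal.ofReal_le_ofReal ?_
        have h2 : (‖w‖ ^ (-(7 / 4) : ℝ)) ^ 2 = ‖w‖ ^ (-(7 / 2) : ℝ) := by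
          rw [← Real.rpow_natCast, ← Real.rpow_mul (norm_nonneg _)]; norm_num
        have h3 : ‖w‖ ^ (-(7 / 2) : ℝ) ≤ (1 / 3 * (1 + ‖w‖)) ^ (-(7 / 2) : ℝ) :=
          Real.rpow_le_rpow_of_nonpos (by positivity) (by linarith) (by norm_num)
        rw [Real.mul_rpow (by norm_num) (by positivity)] at h3
        have h4 := potentialKernel_nonneg μ w
        calc potentialKernel μ w ^ 2 ≤ (15 * ‖w‖ ^ (-(7 / 4) : ℝ)) ^ 2 := by
              gcongr
              exact potentialKernel_le_far hμ1 hw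
          _ = 225 * ‖w‖ ^ (-(7 / 2) : ℝ) := by rw [mul_pow, h2]; norm_num
          _ ≤ _ := by rw [mul_assoc]; gcongr
      · rw [lintegral_const_mul _ (by fun_prop)]
        exact ENNReal.mul_lt_top ENNReal.ofReal_lt_top lintegral_one_add_norm_lt_top
  refine ⟨(∫⁻ w, G w) + ∫⁻ w, G w, (ENNReal.add_lt_top.2 ⟨hGfin, hGfin⟩).ne, fun e he => ?_⟩
  have hpt : ∀ w, k w * k (w - e) ≤ G w + G (w - e) := by
    intro w
    have hor : w ∉ B ∨ w - e ∉ B := by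
      by_contra! hcon
      rw [hB, mem_ball_zero_iff, mem_ball_zero_iff] at hcon
      have := norm_sub_le w (w - e)
      rw [sub_sub_cancel, he] at this
      linarith [hcon.1, hcon.2]
    have hsq : ∀ a b : ENNReal, a * b ≤ a ^ 2 + b ^ 2 := by
      intro a b
      rcases le_total a b with h | h
      · calc a * b ≤ b * b := by gcongr
          _ = b ^ 2 := (sq b).symm
          _ ≤ _ := le_add_self
      · calc a * b ≤ a * a := by gcongr
          _ = a ^ 2 := (sq a).symm
          _ ≤ _ := le_self_add
    by_cases h1 : w ∈ B
    · have h2 : w - e ∉ B := hor.resolve_left (not_not.2 h1)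
      calc k w * k (w - e) ≤ k w * 60 := by gcongr; exact hk60 _ h2
        _ = 60 * B.indicator k w := by rw [indicator_of_mem h1, mul_comm]
        _ ≤ G w := le_self_add
        _ ≤ _ := le_self_add
    · by_cases h2 : w - e ∈ B
      · calc k w * k (w - e) ≤ 60 * k (w - e) := by gcongr; exact hk60 _ h1
          _ = 60 * B.indicator k (w - e) := by rw [indicator_of_mem h2]
          _ ≤ G (w - e) := le_self_add
          _ ≤ _ := le_add_self
      · refine (hsq _ _).trans (add_le_add ?_ ?_)
        · refine le_trans (le_of_eq ?_) le_add_self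
          rw [indicator_of_mem (by exact h1)]
        · refine le_trans (le_of_eq ?_) le_add_self
          rw [indicator_of_mem (by exact h2)]
  calc _ ≤ ∫⁻ w, G w + G (w - e) := lintegral_mono hpt
    _ = _ := by rw [lintegral_add_left hGm, lintegral_sub_right_eq_self G e]

lemma lintegral_comp_smul_space3 (g : Space3 → ENNReal) (hg : Measurable g) {d : ℝ} (hd : 0 < d) :
    ∫⁻ x, g x = ENNReal.ofReal (d ^ 3) * ∫⁻ w, g (d • w) := by
  have h1 : ∫⁻ w, g (d • w) = ENNReal.ofReal ((d ^ 3)⁻¹) * ∫⁻ x, g x := by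
    rw [← lintegral_map hg (measurable_const_smul d), Measure.map_addHaar_smul volume hd.ne']
    simp only [finrank_euclideanSpace, Fintype.card_fin, lintegral_smul_measure, smul_eq_mul]
    rw [abs_of_pos (by positivity)]
  rw [h1, ← mul_assoc, ← ENNReal.ofReal_mul (by positivity), mul_inv_cancel₀ (by positivity)]
  simp

/-- The composition of two potential kernels is, up to logarithms, the Newton kernel. -/
lemma exists_lintegral_kernel_mul_le {μ : ℝ} (hμ0 : 0 ≤ μ) (hμ1 : μ ≤ 1) :
    ∃ M : ENNReal, M ≠ ⊤ ∧ ∀ y y' : Space3, y ≠ y' →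
      ∫⁻ x, ENNReal.ofReal (potentialKernel μ (x - y)) * ENNReal.ofReal (potentialKernel μ (x - y'))
        ≤ M * ENNReal.ofReal (logFactor ‖y - y'‖ ^ (2 * μ) / ‖y - y'‖) := by
  obtain ⟨M, hM, h⟩ := exists_lintegral_unit_kernel_le hμ1
  refine ⟨M, hM, fun y y' hyy => ?_⟩
  have hkm := measurable_potentialKernel μ
  set v := y' - y with hv
  set d := ‖y - y'‖ with hd
  have hd0 : 0 < d := norm_pos_iff.2 (sub_ne_zero.2 hyy)
  have hdv : ‖v‖ = d := norm_sub_rev _ _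
  -- Dilation by `d` reduces to singularities at distance one; the powers combine as `d³ (d⁻²)² =
  -- 1/d`, and each factor yields `logFactor d ^ μ`.
  set e := d⁻¹ • v with he
  have he1 : ‖e‖ = 1 := by
    rw [he, norm_smul, norm_inv, Real.norm_of_nonneg hd0.le, hdv, inv_mul_cancel₀ hd0.ne']
  have hde : v = d • e := by rw [he, smul_smul, mul_inv_cancel₀ hd0.ne', one_smul]
  have hL := one_le_logFactor d
  have hpt : ∀ w, ENNReal.ofReal (potentialKernel μ (d • w))
      * ENNReal.ofReal (potentialKernel μ (d • w - v))
      ≤ ENNReal.ofReal ((d⁻¹ ^ 2 * logFactor d ^ μ) ^ 2) * (ENNReal.ofReal (potentialKernel μ w)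
        * ENNReal.ofReal (potentialKernel μ (w - e))) := by
    intro w
    rw [hde, ← smul_sub, ← ENNReal.ofReal_mul (potentialKernel_nonneg _ _),
      ← ENNReal.ofReal_mul (potentialKernel_nonneg _ _), ← ENNReal.ofReal_mul (by positivity)]
    refine ENNReal.ofReal_le_ofReal ?_
    have h1 := potentialKernel_nonneg μ w
    calc _ ≤ (d⁻¹ ^ 2 * logFactor d ^ μ * potentialKernel μ w)
          * (d⁻¹ ^ 2 * logFactor d ^ μ * potentialKernel μ (w - e)) := by
          refine mul_le_mul (potentialKernel_smul_le hμ0 hd0 w)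
            (potentialKernel_smul_le hμ0 hd0 _) (potentialKernel_nonneg _ _) (by positivity)
      _ = _ := by ring
  calc _ = ∫⁻ x, ENNReal.ofReal (potentialKernel μ x)
        * ENNReal.ofReal (potentialKernel μ (x - v)) := by
        rw [← lintegral_sub_right_eq_self (fun x => ENNReal.ofReal (potentialKernel μ x)
          * ENNReal.ofReal (potentialKernel μ (x - v))) y]
        refine lintegral_congr fun x => ?_
        rw [hv, sub_sub, add_sub_cancel]
    _ = ENNReal.ofReal (d ^ 3) * ∫⁻ w, ENNReal.ofReal (potentialKernel μ (d • w))
        * ENNReal.ofReal (potentialKernel μ (d • w - v)) :=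
        lintegral_comp_smul_space3 _ (by fun_prop) hd0
    _ ≤ ENNReal.ofReal (d ^ 3) * (ENNReal.ofReal ((d⁻¹ ^ 2 * logFactor d ^ μ) ^ 2) * M) := by
        gcongr
        refine (lintegral_mono hpt).trans ?_
        rw [lintegral_const_mul _ (by fun_prop)]
        gcongr
        exact h e he1
    _ = _ := by
        rw [← mul_assoc, ← ENNReal.ofReal_mul (by positivity), mul_comm]
        congr 2
        rw [mul_comm 2 μ, Real.rpow_mul (by linarith), Real.rpow_two]
        field_simp
end

/-! ### From the interaction energy to the majorizing potential. -/

noncomputable section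

lemma sq_lintegral_eq {X : Type*} [MeasurableSpace X] {m : Measure X} {a : X → ENNReal}
    (ha : Measurable a) : (∫⁻ y, a y ∂m) ^ 2 = ∫⁻ y, ∫⁻ y', a y * a y' ∂m ∂m := by
  rw [sq, ← lintegral_mul_const _ ha]
  exact lintegral_congr fun y => (lintegral_const_mul _ ha).symm

/-- The square of the potential is a double integral; integrating in `x` first, by Tonelli's
theorem, leaves the composed kernel. -/
lemma exists_lintegral_sq_potential_le {μ : ℝ} (hμ0 : 0 ≤ μ) (hμ1 : μ ≤ 1) :
    ∃ M : ENNReal, M ≠ ⊤ ∧ ∀ g : Space3 → ENNReal, Measurable g →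
      ∫⁻ x, (∫⁻ y, ENNReal.ofReal (potentialKernel μ (x - y)) * g y) ^ 2
        ≤ M * ∫⁻ y, ∫⁻ y', g y * g y'
          * ENNReal.ofReal (logFactor ‖y - y'‖ ^ (2 * μ) / ‖y - y'‖) := by
  obtain ⟨M, hM, h⟩ := exists_lintegral_kernel_mul_le hμ0 hμ1
  refine ⟨M, hM, fun g hg => ?_⟩
  have hk := measurable_potentialKernel μ
  have hl := measurable_logFactor
  have hne : ∀ y : Space3, ∀ᵐ y' : Space3, y ≠ y' := by
    intro y
    simp [ae_iff]
  calc _ = ∫⁻ x, ∫⁻ y, ∫⁻ y', (ENNReal.ofReal (potentialKernel μ (x - y)) * g y)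
        * (ENNReal.ofReal (potentialKernel μ (x - y')) * g y') :=
        lintegral_congr fun x => sq_lintegral_eq (by fun_prop)
    _ = ∫⁻ y, ∫⁻ x, ∫⁻ y', (ENNReal.ofReal (potentialKernel μ (x - y)) * g y)
        * (ENNReal.ofReal (potentialKernel μ (x - y')) * g y') := by
        refine lintegral_lintegral_swap (Measurable.aemeasurable ?_)
        exact Measurable.lintegral_prod_right' (f := fun p : (Space3 × Space3) × Space3 =>
          (ENNReal.ofReal (potentialKernel μ (p.1.1 - p.1.2)) * g p.1.2)
          * (ENNReal.ofReal (potentialKernel μ (p.1.1 - p.2)) * g p.2)) (by fun_prop)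
    _ = ∫⁻ y, ∫⁻ y', ∫⁻ x, (ENNReal.ofReal (potentialKernel μ (x - y)) * g y)
        * (ENNReal.ofReal (potentialKernel μ (x - y')) * g y') :=
        lintegral_congr fun y => lintegral_lintegral_swap (by fun_prop)
    _ ≤ ∫⁻ y, ∫⁻ y', M * (g y * g y'
          * ENNReal.ofReal (logFactor ‖y - y'‖ ^ (2 * μ) / ‖y - y'‖)) := by
        refine lintegral_mono fun y => lintegral_mono_ae ?_
        filter_upwards [hne y] with y' hy'
        calc _ = ∫⁻ x, g y * g y' * (ENNReal.ofReal (potentialKernel μ (x - y))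
              * ENNReal.ofReal (potentialKernel μ (x - y'))) := lintegral_congr fun x => by ring
          _ = g y * g y' * ∫⁻ x, ENNReal.ofReal (potentialKernel μ (x - y))
              * ENNReal.ofReal (potentialKernel μ (x - y')) := lintegral_const_mul _ (by fun_prop)
          _ ≤ g y * g y' * (M * ENNReal.ofReal (logFactor ‖y - y'‖ ^ (2 * μ) / ‖y - y'‖)) := by
              gcongr
              exact h y y' hy'
          _ = _ := by ring
    _ = _ := by
        have m1 : Measurable fun y : Space3 => ∫⁻ y', g y * g y'
          * ENNReal.ofReal (logFactor ‖y - y'‖ ^ (2 * μ) / ‖y - y'‖) :=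
          Measurable.lintegral_prod_right' (f := fun p : Space3 × Space3 => g p.1 * g p.2
            * ENNReal.ofReal (logFactor ‖p.1 - p.2‖ ^ (2 * μ) / ‖p.1 - p.2‖)) (by fun_prop)
        rw [← lintegral_const_mul _ m1]
        exact lintegral_congr fun y => lintegral_const_mul _ (by fun_prop)

/-- For `d ≤ 1` one has `|log d| = ½ log (1/d²) ≤ ½ log (1 + 1/d²)`, which explains the factor 1/2
in `logWeight`. For `1 ≤ d ≤ D` the logarithm is bounded by `|log D|`. -/
lemma exists_logFactor_le_radialProfile {α : ℝ} (hα : 0 ≤ α) (D : ℝ) : ∃ c : ℝ, 0 ≤ c ∧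
    ∀ d, 0 < d → d ≤ D → logFactor d ^ α / d ≤ c * radialProfile α (d ^ 2) := by
  set b := 1 + |Real.log D| with hb
  have hb1 : 1 ≤ b := le_add_of_nonneg_right (abs_nonneg _)
  refine ⟨b ^ α, by positivity, fun d hd hdD => ?_⟩
  have hL2 := two_le_logWeight (show 0 < d ^ 2 by positivity)
  have hl : logFactor d ≤ b * logWeight (d ^ 2) := by
    rcases le_total d 1 with h | h
    · have h1 : |Real.log d| ≤ Real.log (1 + 1 / d ^ 2) / 2 := by
        rw [abs_of_nonpos (Real.log_nonpos hd.le h)]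
        have h2 : Real.log (1 / d ^ 2) ≤ Real.log (1 + 1 / d ^ 2) :=
          Real.log_le_log (by positivity) (by linarith)
        rw [one_div, Real.log_inv, Real.log_pow] at h2
        push_cast at h2
        rw [one_div]
        linarith
      have : logFactor d ≤ logWeight (d ^ 2) := by unfold logFactor logWeight; linarith
      nlinarith
    · have h1 : |Real.log d| ≤ |Real.log D| := by
        rw [abs_of_nonneg (Real.log_nonneg h), abs_of_nonneg (Real.log_nonneg (h.trans hdD))]
        exact Real.log_le_log hd hdD
      have : logFactor d ≤ b := by unfold logFactor; linarith
      nlinarith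
  have hsq : (d ^ 2) ^ (-(1 / 2) : ℝ) = 1 / d := by
    rw [← Real.rpow_natCast, ← Real.rpow_mul hd.le]
    norm_num [Real.rpow_neg_one]
  unfold radialProfile
  rw [hsq]
  have h0 := one_le_logFactor d
  calc logFactor d ^ α / d ≤ (b * logWeight (d ^ 2)) ^ α / d := by gcongr
    _ = _ := by rw [Real.mul_rpow (by linarith) (by linarith)]; ring

lemma lintegral_ball_radialProfile_lt_top {α : ℝ} (hα : 0 < α) (R : ℝ) :
    ∫⁻ w in Metric.ball (0 : Space3) R, ENNReal.ofReal (radialProfile α (‖w‖ ^ 2)) < ⊤ := by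
  obtain ⟨c, hc, h⟩ := exists_logWeight_rpow_le hα (show (0 : ℝ) < 5 / 8 by norm_num) (R ^ 2)
  have hne : ∀ᵐ w : Space3, w ≠ 0 := by simp [ae_iff]
  refine lt_of_le_of_lt (setLIntegral_mono_ae' measurableSet_ball (g := fun w =>
    ENNReal.ofReal c * ENNReal.ofReal (‖w‖ ^ (-(9 / 4) : ℝ))) ?_) ?_
  · filter_upwards [hne] with w hw hwR
    rw [mem_ball_zero_iff] at hwR
    have hr : 0 < ‖w‖ := norm_pos_iff.2 hw
    rw [← ENNReal.ofReal_mul hc.le]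
    refine ENNReal.ofReal_le_ofReal ?_
    have h1 := h (‖w‖ ^ 2) (by positivity) (by gcongr)
    have h2 : (‖w‖ ^ 2) ^ (-(5 / 8) : ℝ) * (‖w‖ ^ 2) ^ (-(1 / 2) : ℝ) = ‖w‖ ^ (-(9 / 4) : ℝ) := by
      rw [← Real.rpow_natCast, ← Real.rpow_mul hr.le, ← Real.rpow_mul hr.le, ← Real.rpow_add hr]
      norm_num
    unfold radialProfile
    calc _ ≤ c * (‖w‖ ^ 2) ^ (-(5 / 8) : ℝ) * (‖w‖ ^ 2) ^ (-(1 / 2) : ℝ) := by gcongr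
      _ = _ := by rw [mul_assoc, h2]
  · rw [lintegral_const_mul _ (by fun_prop)]
    exact ENNReal.mul_lt_top ENNReal.ofReal_lt_top (lintegral_norm_rpow_ball_lt_top R)

/-- A nonnegative density supported in a bounded cylinder with bounded mass and bounded
interaction energy. -/
structure IsInteractingDensity (R T C α : ℝ) (ρ : SpaceTime → ℝ) : Prop where
  measurable : Measurable ρ
  nonneg : ∀ z, 0 ≤ ρ z
  eq_zero : ∀ z, z ∉ spaceTimeCylinder (Metric.ball 0 R) T → ρ z = 0
  mass_le : ∀ᵐ t : ℝ, ∫⁻ x, ENNReal.ofReal (ρ (x, t) ^ (3 / 2 : ℝ)) ≤ ENNReal.ofReal C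
  interaction_le : ∫⁻ t : ℝ, ∫⁻ x : Space3, ∫⁻ y : Space3,
    ENNReal.ofReal (ρ (x, t) ^ (3 / 2 : ℝ)) * ENNReal.ofReal (ρ (y, t))
      * ENNReal.ofReal (radialProfile α (‖x - y‖ ^ 2)) ≤ ENNReal.ofReal C

/-- The density increased by one on the cylinder. -/
def raisedDensity (R T : ℝ) (ρ : SpaceTime → ℝ) : SpaceTime → ℝ :=
  (spaceTimeCylinder (Metric.ball 0 R) T).indicator fun z => ρ z + 1

/-- The potential that majorizes all others. -/
def majorant (μ R T : ℝ) (ρ : SpaceTime → ℝ) (z : SpaceTime) : ENNReal :=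
  ∫⁻ y, ENNReal.ofReal (potentialKernel μ (z.1 - y))
    * ENNReal.ofReal (raisedDensity R T ρ (y, z.2) ^ (5 / 4 : ℝ))

/-- A quarter power is moved from the smaller to the larger number. The balance `5/4 + 5/4 = 3/2 +
1` ties the exponent of the potentials to that of the pressure. -/
lemma rpow_five_quarters_mul_le {a b : ℝ} (hb : 0 ≤ b) (hab : b ≤ a) :
    a ^ (5 / 4 : ℝ) * b ^ (5 / 4 : ℝ) ≤ a ^ (3 / 2 : ℝ) * b := by
  have ha : 0 ≤ a := hb.trans hab
  have e1 : b ^ (5 / 4 : ℝ) = b * b ^ (1 / 4 : ℝ) := by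
    rw [← Real.rpow_one_add' hb (by norm_num)]; norm_num
  have e2 : a ^ (3 / 2 : ℝ) = a ^ (5 / 4 : ℝ) * a ^ (1 / 4 : ℝ) := by
    rw [← Real.rpow_add_of_nonneg ha (by norm_num) (by norm_num)]; norm_num
  have h : b ^ (1 / 4 : ℝ) ≤ a ^ (1 / 4 : ℝ) := by gcongr
  rw [e1, e2]
  calc _ ≤ a ^ (5 / 4 : ℝ) * (b * a ^ (1 / 4 : ℝ)) := by gcongr
    _ = _ := by ring

lemma add_one_rpow_le {a : ℝ} (ha : 0 ≤ a) :
    (a + 1) ^ (3 / 2 : ℝ) ≤ 3 * (a ^ (3 / 2 : ℝ) + 1) := by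
  have h2 : (2 : ℝ) ^ (3 / 2 : ℝ) ≤ 3 := by
    have : (2 : ℝ) ^ (3 / 2 : ℝ) = 2 * √2 := by
      rw [Real.sqrt_eq_rpow, ← Real.rpow_one_add' (by norm_num) (by norm_num)]; norm_num
    rw [this]
    nlinarith [Real.sq_sqrt (show (0 : ℝ) ≤ 2 by norm_num), Real.sqrt_nonneg 2,
      sq_nonneg (√2 - 3 / 2)]
  have h3 : 0 ≤ a ^ (3 / 2 : ℝ) := by positivity
  rcases le_total a 1 with h | h
  · calc (a + 1) ^ (3 / 2 : ℝ) ≤ 2 ^ (3 / 2 : ℝ) := by gcongr; linarith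
      _ ≤ _ := by linarith
  · calc (a + 1) ^ (3 / 2 : ℝ) ≤ (2 * a) ^ (3 / 2 : ℝ) := by gcongr; linarith
      _ = 2 ^ (3 / 2 : ℝ) * a ^ (3 / 2 : ℝ) := Real.mul_rpow (by norm_num) ha
      _ ≤ 3 * a ^ (3 / 2 : ℝ) := by gcongr
      _ ≤ _ := by linarith

lemma le_one_add_rpow {a : ℝ} (ha : 0 ≤ a) : a ≤ 1 + a ^ (3 / 2 : ℝ) := by
  rcases le_total a 1 with h | h
  · have : 0 ≤ a ^ (3 / 2 : ℝ) := by positivity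
    linarith
  · have : a ^ (1 : ℝ) ≤ a ^ (3 / 2 : ℝ) := Real.rpow_le_rpow_of_exponent_le h (by norm_num)
    rw [Real.rpow_one] at this
    linarith

/-- Increasing the densities by one adds only terms linear in `a ^ (3/2)` or `b ^ (3/2)`, or
constant. These are controlled by the mass and need no interaction estimate. -/
lemma raised_product_le {a b : ℝ} (ha : 0 ≤ a) (hb : 0 ≤ b) :
    (a + 1) ^ (5 / 4 : ℝ) * (b + 1) ^ (5 / 4 : ℝ)
      ≤ (3 * (a ^ (3 / 2 : ℝ) * b) + 6 * (a ^ (3 / 2 : ℝ) + 1))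
        + (3 * (b ^ (3 / 2 : ℝ) * a) + 6 * (b ^ (3 / 2 : ℝ) + 1)) := by
  have key : ∀ {a b : ℝ}, 0 ≤ a → 0 ≤ b → b ≤ a →
      (a + 1) ^ (5 / 4 : ℝ) * (b + 1) ^ (5 / 4 : ℝ)
      ≤ (3 * (a ^ (3 / 2 : ℝ) * b) + 6 * (a ^ (3 / 2 : ℝ) + 1))
        + (3 * (b ^ (3 / 2 : ℝ) * a) + 6 * (b ^ (3 / 2 : ℝ) + 1)) := by
    intro a b ha hb hab
    have h1 := rpow_five_quarters_mul_le (a := a + 1) (b := b + 1) (by linarith) (by linarith)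
    have h2 := add_one_rpow_le ha
    have h3 : (a + 1) ^ (3 / 2 : ℝ) * (b + 1) ≤ 3 * (a ^ (3 / 2 : ℝ) + 1) * (b + 1) := by gcongr
    have h4 := le_one_add_rpow hb
    have h5 : 0 ≤ a ^ (3 / 2 : ℝ) := by positivity
    have h6 : 0 ≤ b ^ (3 / 2 : ℝ) * a := by positivity
    have h7 : 0 ≤ b ^ (3 / 2 : ℝ) := by positivity
    nlinarith
  rcases le_total b a with h | h
  · exact key ha hb h
  · rw [mul_comm, add_comm (3 * (a ^ (3 / 2 : ℝ) * b) + _)]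
    exact key hb ha h

lemma lintegral_symmetrized {X : Type*} [MeasurableSpace X] (m : Measure X) [SFinite m]
    {Φ : X → X → ENNReal} (hΦ : Measurable fun p : X × X => Φ p.1 p.2) (c : ENNReal) :
    ∫⁻ y, ∫⁻ y', c * (Φ y y' + Φ y' y) ∂m ∂m = c * (2 * ∫⁻ y, ∫⁻ y', Φ y y' ∂m ∂m) := by
  have hΦ' : Measurable fun p : X × X => Φ p.2 p.1 := hΦ.comp measurable_swap
  have m1 : Measurable fun y => ∫⁻ y', Φ y y' ∂m := hΦ.lintegral_prod_right'
  have m2 : Measurable fun y => ∫⁻ y', Φ y' y ∂m := hΦ'.lintegral_prod_right'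
  have hsymm : ∫⁻ y, ∫⁻ y', Φ y' y ∂m ∂m = ∫⁻ y, ∫⁻ y', Φ y y' ∂m ∂m :=
    lintegral_lintegral_swap hΦ'.aemeasurable
  have h : ∀ y, ∫⁻ y', c * (Φ y y' + Φ y' y) ∂m
      = c * ((∫⁻ y', Φ y y' ∂m) + ∫⁻ y', Φ y' y ∂m) := by
    intro y
    have m3 : Measurable fun y' => Φ y y' := hΦ.comp measurable_prodMk_left
    have m4 : Measurable fun y' => Φ y' y := hΦ'.comp measurable_prodMk_left
    have m5 : Measurable fun y' => Φ y y' + Φ y' y := m3.add m4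
    rw [lintegral_const_mul _ m5, lintegral_add_left m3]
  have m6 : Measurable fun y => (∫⁻ y', Φ y y' ∂m) + ∫⁻ y', Φ y' y ∂m := m1.add m2
  simp_rw [h]
  rw [lintegral_const_mul _ m6, lintegral_add_left m1, hsymm, two_mul]

set_option maxHeartbeats 1000000 in
-- On a time slice the squared norm is a double integral of raised densities against the composed
-- kernel. Its leading part is the interaction energy with exponent `2μ`; the lower-order part is at
-- most a mass bound times `J`, which is finite because the kernel is locally integrable.
lemma exists_lintegral_majorant_sq_le {μ : ℝ} (hμ0 : 0 < μ) (hμ1 : μ ≤ 1) (R T C : ℝ) : ∃ B : ENNReal, B ≠ ⊤ ∧ ∀ ρ, IsInteractingDensity R T C (2 * μ) ρ →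
      Measurable (majorant μ R T ρ) ∧ ∫⁻ z, majorant μ R T ρ z ^ 2 ≤ B := by
  obtain ⟨M, hM, hpot⟩ := exists_lintegral_sq_potential_le hμ0.le hμ1
  obtain ⟨c, hc, hcl⟩ := exists_logFactor_le_radialProfile (α := 2 * μ) (by linarith) (2 * R)
  set J := ∫⁻ w in Metric.ball (0 : Space3) (2 * R),
    ENNReal.ofReal (radialProfile (2 * μ) (‖w‖ ^ 2)) with hJ
  have hJt : J < ⊤ := lintegral_ball_radialProfile_lt_top (by linarith) _
  set U := Metric.ball (0 : Space3) R with hU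
  have hUm : MeasurableSet U := measurableSet_ball
  have hUt : volume U < ⊤ := measure_ball_lt_top
  set B := M * (ENNReal.ofReal c * (2 * (3 * ENNReal.ofReal C
    + 6 * ((ENNReal.ofReal C + volume U) * J) * ENNReal.ofReal T))) with hB
  have hBt : B ≠ ⊤ := by
    have := hJt.ne
    have := hUt.ne
    rw [hB]; finiteness
  refine ⟨B, hBt, fun ρ h => ?_⟩
  have hρm := h.measurable
  have hkm := measurable_potentialKernel μ
  have hrm := measurable_radialProfile (2 * μ)
  have hcyl : MeasurableSet (spaceTimeCylinder U T) := hUm.prod measurableSet_Ioo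
  have hrd : Measurable (raisedDensity R T ρ) := (hρm.add_const 1).indicator hcyl
  have hmaj : Measurable (majorant μ R T ρ) := by
    refine Measurable.lintegral_prod_right' (f := fun p : SpaceTime × Space3 =>
      ENNReal.ofReal (potentialKernel μ (p.1.1 - p.2))
      * ENNReal.ofReal (raisedDensity R T ρ (p.2, p.1.2) ^ (5 / 4 : ℝ))) ?_
    fun_prop
  refine ⟨hmaj, ?_⟩
  -- One of the two symmetric halves of the product bound, so that it suffices to integrate it and
  -- double the result.
  set Φ : ℝ → Space3 → Space3 → ENNReal := fun t y y' =>
    (3 * (ENNReal.ofReal (ρ (y, t) ^ (3 / 2 : ℝ)) * ENNReal.ofReal (ρ (y', t)))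
      + 6 * (ENNReal.ofReal (ρ (y, t) ^ (3 / 2 : ℝ)) + 1))
      * ENNReal.ofReal (radialProfile (2 * μ) (‖y - y'‖ ^ 2)) with hΦ
  have hne : ∀ y : Space3, ∀ᵐ y' : Space3, y ≠ y' := by
    intro y
    simp [ae_iff]
  -- one time slice
  have hslice : ∀ᵐ t : ℝ, ∫⁻ x, majorant μ R T ρ (x, t) ^ 2
      ≤ M * (ENNReal.ofReal c * (2 * (3 * (∫⁻ x : Space3, ∫⁻ y : Space3,
        ENNReal.ofReal (ρ (x, t) ^ (3 / 2 : ℝ)) * ENNReal.ofReal (ρ (y, t))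
          * ENNReal.ofReal (radialProfile (2 * μ) (‖x - y‖ ^ 2)))
        + (Ioo (0 : ℝ) T).indicator (fun _ => 6 * ((ENNReal.ofReal C + volume U) * J)) t))) := by
    filter_upwards [h.mass_le] with t ht
    refine (hpot (fun y => ENNReal.ofReal (raisedDensity R T ρ (y, t) ^ (5 / 4 : ℝ)))
      (by fun_prop)).trans ?_
    gcongr
    by_cases htT : t ∈ Ioo (0 : ℝ) T
    swap
    · have : ∀ y, raisedDensity R T ρ (y, t) = 0 := fun y =>
        indicator_of_notMem (fun hy => htT hy.2) _
      simp [this]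
    have mΦ : Measurable fun p : Space3 × Space3 => Φ t p.1 p.2 := by
      simp only [hΦ]; fun_prop
    calc _ ≤ ∫⁻ y, U.indicator (fun y => ∫⁻ y', U.indicator (fun y' =>
          ENNReal.ofReal c * (Φ t y y' + Φ t y' y)) y') y := by
          refine lintegral_mono fun y => ?_
          by_cases hy : y ∈ U
          swap
          · have : raisedDensity R T ρ (y, t) = 0 := indicator_of_notMem (fun hy' => hy hy'.1) _
            simp [this]
          rw [indicator_of_mem hy]
          refine lintegral_mono_ae ?_
          filter_upwards [hne y] with y' hyy
          by_cases hy' : y' ∈ U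
          swap
          · have : raisedDensity R T ρ (y', t) = 0 :=
              indicator_of_notMem (fun hy2 => hy' hy2.1) _
            simp [this]
          rw [indicator_of_mem hy']
          have e1 : raisedDensity R T ρ (y, t) = ρ (y, t) + 1 :=
            indicator_of_mem (show (y, t) ∈ spaceTimeCylinder U T from ⟨hy, htT⟩) _
          have e2 : raisedDensity R T ρ (y', t) = ρ (y', t) + 1 :=
            indicator_of_mem (show (y', t) ∈ spaceTimeCylinder U T from ⟨hy', htT⟩) _
          have hd : 0 < ‖y - y'‖ := norm_pos_iff.2 (sub_ne_zero.2 hyy)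
          have hdR : ‖y - y'‖ ≤ 2 * R := by
            rw [hU, mem_ball_zero_iff] at hy hy'
            linarith [norm_sub_le y y']
          have hr1 := h.nonneg (y, t)
          have hr2 := h.nonneg (y', t)
          have hrp := (radialProfile_pos (2 * μ) (show 0 < ‖y - y'‖ ^ 2 by positivity)).le
          simp only [hΦ]
          rw [norm_sub_rev y' y, ← add_mul, e1, e2]
          have e3 : ∀ {a b : ℝ}, 0 ≤ a → 0 ≤ b →
              3 * (ENNReal.ofReal (a ^ (3 / 2 : ℝ)) * ENNReal.ofReal b)
                + 6 * (ENNReal.ofReal (a ^ (3 / 2 : ℝ)) + 1)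
              = ENNReal.ofReal (3 * (a ^ (3 / 2 : ℝ) * b) + 6 * (a ^ (3 / 2 : ℝ) + 1)) := by
            intro a b ha hb
            rw [ENNReal.ofReal_add (by positivity) (by positivity),
              ENNReal.ofReal_mul (by norm_num), ENNReal.ofReal_mul (by positivity),
              ENNReal.ofReal_mul (by norm_num), ENNReal.ofReal_add (by positivity) (by norm_num)]
            norm_num
          rw [e3 hr1 hr2, e3 hr2 hr1, ← ENNReal.ofReal_add (by positivity) (by positivity),
            ← ENNReal.ofReal_mul (by positivity), ← ENNReal.ofReal_mul (by positivity),
            ← ENNReal.ofReal_mul (by positivity), ← ENNReal.ofReal_mul hc]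
          refine ENNReal.ofReal_le_ofReal ?_
          have h1 := raised_product_le hr1 hr2
          have h2 := hcl _ hd hdR
          have h3 := one_le_logFactor ‖y - y'‖
          calc _ ≤ _ := mul_le_mul h1 h2 (by positivity) (by positivity)
            _ = _ := by ring
      _ = ENNReal.ofReal c * (2 * ∫⁻ y in U, ∫⁻ y' in U, Φ t y y') := by
          rw [lintegral_indicator hUm, ← lintegral_symmetrized (volume.restrict U) mΦ]
          refine lintegral_congr fun y => ?_
          rw [lintegral_indicator hUm]
      _ ≤ _ := by
          rw [indicator_of_mem htT]
          gcongr
          have mP : Measurable fun y => ENNReal.ofReal (ρ (y, t) ^ (3 / 2 : ℝ)) := by fun_prop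
          calc ∫⁻ y in U, ∫⁻ y' in U, Φ t y y'
              ≤ ∫⁻ y in U, (3 * (∫⁻ y' : Space3, ENNReal.ofReal (ρ (y, t) ^ (3 / 2 : ℝ))
                  * ENNReal.ofReal (ρ (y', t))
                  * ENNReal.ofReal (radialProfile (2 * μ) (‖y - y'‖ ^ 2)))
                + 6 * ((ENNReal.ofReal (ρ (y, t) ^ (3 / 2 : ℝ)) + 1) * J)) := by
                refine setLIntegral_mono' hUm fun y hy => ?_
                have e5 : ∀ y', Φ t y y' = 3 * (ENNReal.ofReal (ρ (y, t) ^ (3 / 2 : ℝ))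
                    * ENNReal.ofReal (ρ (y', t))
                    * ENNReal.ofReal (radialProfile (2 * μ) (‖y - y'‖ ^ 2)))
                    + 6 * ((ENNReal.ofReal (ρ (y, t) ^ (3 / 2 : ℝ)) + 1)
                      * ENNReal.ofReal (radialProfile (2 * μ) (‖y - y'‖ ^ 2))) := by
                  intro y'
                  simp only [hΦ]
                  ring
                simp_rw [e5]
                rw [lintegral_add_left (by fun_prop), lintegral_const_mul _ (by fun_prop),
                  lintegral_const_mul _ (by fun_prop), lintegral_const_mul _ (by fun_prop)]
                gcongr
                · exact Measure.restrict_le_self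
                · exact lintegral_translated_kernel_le
                    (fun r => ENNReal.ofReal (radialProfile (2 * μ) (r ^ 2))) subset_rfl hy
            _ ≤ _ := by
                have m5 : Measurable fun y : Space3 => ∫⁻ y' : Space3,
                    ENNReal.ofReal (ρ (y, t) ^ (3 / 2 : ℝ)) * ENNReal.ofReal (ρ (y', t))
                    * ENNReal.ofReal (radialProfile (2 * μ) (‖y - y'‖ ^ 2)) := by
                  refine Measurable.lintegral_prod_right' (f := fun p : Space3 × Space3 =>
                    ENNReal.ofReal (ρ (p.1, t) ^ (3 / 2 : ℝ)) * ENNReal.ofReal (ρ (p.2, t))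
                    * ENNReal.ofReal (radialProfile (2 * μ) (‖p.1 - p.2‖ ^ 2))) ?_
                  fun_prop
                rw [lintegral_add_left (by fun_prop), lintegral_const_mul _ m5,
                  lintegral_const_mul _ (by fun_prop), lintegral_mul_const _ (by fun_prop),
                  lintegral_add_left mP, setLIntegral_const, one_mul]
                gcongr
                · exact Measure.restrict_le_self
                · exact (setLIntegral_le_lintegral _ _).trans ht
  rw [lintegral_spaceTime_symm (hmaj.pow_const 2)]
  refine (lintegral_mono_ae hslice).trans ?_
  have m6 : Measurable fun t : ℝ => ∫⁻ x : Space3, ∫⁻ y : Space3,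
        ENNReal.ofReal (ρ (x, t) ^ (3 / 2 : ℝ)) * ENNReal.ofReal (ρ (y, t))
          * ENNReal.ofReal (radialProfile (2 * μ) (‖x - y‖ ^ 2)) := by
    have m7 : Measurable fun p : ℝ × Space3 => ∫⁻ y : Space3,
        ENNReal.ofReal (ρ (p.2, p.1) ^ (3 / 2 : ℝ)) * ENNReal.ofReal (ρ (y, p.1))
          * ENNReal.ofReal (radialProfile (2 * μ) (‖p.2 - y‖ ^ 2)) := by
      refine Measurable.lintegral_prod_right' (f := fun q : (ℝ × Space3) × Space3 =>
        ENNReal.ofReal (ρ (q.1.2, q.1.1) ^ (3 / 2 : ℝ)) * ENNReal.ofReal (ρ (q.2, q.1.1))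
          * ENNReal.ofReal (radialProfile (2 * μ) (‖q.1.2 - q.2‖ ^ 2))) ?_
      fun_prop
    exact m7.lintegral_prod_right'
  have m8 : Measurable ((Ioo (0 : ℝ) T).indicator
      fun _ => 6 * ((ENNReal.ofReal C + volume U) * J)) :=
    measurable_const.indicator measurableSet_Ioo
  rw [lintegral_const_mul _ (by fun_prop), lintegral_const_mul _ (by fun_prop),
    lintegral_const_mul _ (by fun_prop), lintegral_add_left (by fun_prop),
    lintegral_const_mul _ m6, lintegral_indicator_const measurableSet_Ioo, Real.volume_Ioo,
    sub_zero, hB]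
  gcongr
  exact h.interaction_le
end

/-! ### The potential with a logarithm of the density. -/

noncomputable section

/-- For `a ≥ 1` and `r ≤ 1`: if `r a ^ (1/8) ≤ 1`, then `log a ≤ 8 |log r|`, and the logarithm of
the density is one of the distance. Otherwise `a ^ (1/8) ≤ r a ^ (1/4)`, and the left side is at
most `17 a ^ (1/8)`. The remaining cases are immediate. -/
lemma log_one_add_rpow_le {μ : ℝ} (hμ0 : 0 ≤ μ) (hμ1 : μ ≤ 1) {r a : ℝ} (hr : 0 < r) (ha : 0 ≤ a) :
    Real.log (1 + a) ^ μ ≤ 17 * (logFactor r ^ μ + min 1 r * a ^ (1 / 4 : ℝ)) := by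
  have hl := one_le_logFactor r
  have hl1 : 1 ≤ logFactor r ^ μ := Real.one_le_rpow hl hμ0
  have hm : 0 ≤ min 1 r * a ^ (1 / 4 : ℝ) := by positivity
  have hlog0 : 0 ≤ Real.log (1 + a) := Real.log_nonneg (by linarith)
  rcases le_total a 1 with h1 | h1
  · have h2 : Real.log (1 + a) ≤ 1 := (Real.log_le_sub_one_of_pos (by linarith)).trans (by linarith)
    have h3 : Real.log (1 + a) ^ μ ≤ 1 := Real.rpow_le_one hlog0 h2 hμ0
    linarith
  have ha0 : 0 < a := by linarith
  have hb1 : 1 ≤ a ^ (1 / 8 : ℝ) := Real.one_le_rpow h1 (by norm_num)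
  have hb2 : a ^ (1 / 8 : ℝ) * a ^ (1 / 8 : ℝ) = a ^ (1 / 4 : ℝ) := by
    rw [← Real.rpow_add ha0]; norm_num
  have hlog : Real.log (1 + a) ≤ 16 * a ^ (1 / 8 : ℝ) := by
    have h2 : Real.log (1 + a) ≤ (1 + a) ^ (1 / 8 : ℝ) / (1 / 8) :=
      Real.log_le_rpow_div (by linarith) (by norm_num)
    have h3 : (1 + a) ^ (1 / 8 : ℝ) ≤ 2 * a ^ (1 / 8 : ℝ) := by
      calc (1 + a) ^ (1 / 8 : ℝ) ≤ (2 * a) ^ (1 / 8 : ℝ) := by gcongr; linarith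
        _ = 2 ^ (1 / 8 : ℝ) * a ^ (1 / 8 : ℝ) := Real.mul_rpow (by norm_num) ha
        _ ≤ 2 ^ (1 : ℝ) * a ^ (1 / 8 : ℝ) := by
            gcongr <;> norm_num
        _ = _ := by rw [Real.rpow_one]
    linarith
  have hpow : Real.log (1 + a) ^ μ ≤ 17 * a ^ (1 / 8 : ℝ) := by
    rcases le_total (Real.log (1 + a)) 1 with h | h
    · have : Real.log (1 + a) ^ μ ≤ 1 := Real.rpow_le_one hlog0 h hμ0
      linarith
    · have := Real.rpow_le_rpow_of_exponent_le h hμ1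
      rw [Real.rpow_one] at this
      linarith
  rcases le_total 1 r with hr1 | hr1
  · rw [min_eq_left hr1, one_mul]
    nlinarith
  rw [min_eq_right hr1]
  rcases le_total 1 (r * a ^ (1 / 8 : ℝ)) with h2 | h2
  · have : a ^ (1 / 8 : ℝ) ≤ r * a ^ (1 / 4 : ℝ) := by
      rw [← hb2, ← mul_assoc]
      exact le_mul_of_one_le_left (by positivity) h2
    linarith
  · have h3 : Real.log (1 + a) ≤ 8 * logFactor r := by
      have e1 : Real.log (r * a ^ (1 / 8 : ℝ)) ≤ 0 := Real.log_nonpos (by positivity) h2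
      rw [Real.log_mul hr.ne' (by positivity), Real.log_rpow ha0] at e1
      have e2 : Real.log (1 + a) ≤ Real.log (2 * a) := Real.log_le_log (by linarith) (by linarith)
      rw [Real.log_mul (by norm_num) ha0.ne'] at e2
      have e3 : Real.log 2 ≤ 1 := (Real.log_le_sub_one_of_pos (by norm_num)).trans (by norm_num)
      unfold logFactor
      linarith [neg_abs_le (Real.log r)]
    have h4 : Real.log (1 + a) ^ μ ≤ 8 * logFactor r ^ μ := by
      calc _ ≤ (8 * logFactor r) ^ μ := by gcongr
        _ = 8 ^ μ * logFactor r ^ μ := Real.mul_rpow (by norm_num) (by linarith)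
        _ ≤ 8 ^ (1 : ℝ) * logFactor r ^ μ := by gcongr; norm_num
        _ = _ := by rw [Real.rpow_one]
    have : 0 ≤ r * a ^ (1 / 4 : ℝ) := by positivity
    linarith

/-- A square integrable kernel. -/
def decayKernel (w : Space3) : ℝ := 1 / ‖w‖ ^ 2 * min 1 ‖w‖

lemma measurable_decayKernel : Measurable decayKernel := by unfold decayKernel; fun_prop

lemma decayKernel_nonneg (w : Space3) : 0 ≤ decayKernel w := by unfold decayKernel; positivity

/-- The squared kernel is `|w|⁻²` near the origin and `|w|⁻⁴` at infinity, both integrable in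
dimension 3. -/
lemma lintegral_decayKernel_sq_lt_top :
    ∫⁻ w, ENNReal.ofReal (decayKernel w) ^ 2 < ⊤ := by
  set B := Metric.ball (0 : Space3) 1 with hB
  have hBm : MeasurableSet B := measurableSet_ball
  rw [← lintegral_add_compl _ hBm]
  refine ENNReal.add_lt_top.2 ⟨?_, ?_⟩
  · refine lt_of_le_of_lt (setLIntegral_mono' hBm (g := fun w =>
      ENNReal.ofReal (‖w‖ ^ (-(9 / 4) : ℝ))) fun w hw => ?_) (lintegral_norm_rpow_ball_lt_top 1)
    rw [hB, mem_ball_zero_iff] at hw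
    rw [← ENNReal.ofReal_pow (decayKernel_nonneg w)]
    refine ENNReal.ofReal_le_ofReal ?_
    rcases eq_or_ne w 0 with rfl | h0
    · simp [decayKernel]
    have hr : 0 < ‖w‖ := norm_pos_iff.2 h0
    have e1 : decayKernel w ^ 2 = ‖w‖ ^ (-2 : ℝ) := by
      unfold decayKernel
      rw [min_eq_right hw.le, Real.rpow_neg hr.le, Real.rpow_two]
      field_simp
    rw [e1]
    exact Real.rpow_le_rpow_of_exponent_ge hr hw.le (by norm_num)
  · refine lt_of_le_of_lt ((setLIntegral_mono' hBm.compl (g := fun w =>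
      ENNReal.ofReal ((1 / 2) ^ (-(7 / 2) : ℝ)) * ENNReal.ofReal ((1 + ‖w‖) ^ (-(7 / 2) : ℝ)))
      fun w hw => ?_).trans (setLIntegral_le_lintegral _ _)) ?_
    · rw [hB, mem_compl_iff, mem_ball_zero_iff, not_lt] at hw
      rw [← ENNReal.ofReal_pow (decayKernel_nonneg w), ← ENNReal.ofReal_mul (by positivity)]
      refine ENNReal.ofReal_le_ofReal ?_
      have hr : 0 < ‖w‖ := by linarith
      have e1 : decayKernel w ^ 2 = ‖w‖ ^ (-4 : ℝ) := by
        unfold decayKernel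
        rw [min_eq_left hw, Real.rpow_neg hr.le]
        norm_cast
        field_simp
      rw [e1, ← Real.mul_rpow (by norm_num) (by positivity)]
      calc ‖w‖ ^ (-4 : ℝ) ≤ ‖w‖ ^ (-(7 / 2) : ℝ) :=
            Real.rpow_le_rpow_of_exponent_le hw (by norm_num)
        _ ≤ _ := Real.rpow_le_rpow_of_nonpos (by positivity) (by linarith) (by norm_num)
    · rw [lintegral_const_mul _ (by fun_prop)]
      exact ENNReal.mul_lt_top ENNReal.ofReal_lt_top lintegral_one_add_norm_lt_top

/-- The potential of `ρ^{3/2}` with the square integrable kernel. -/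
def decayPotential (ρ : SpaceTime → ℝ) (z : SpaceTime) : ENNReal :=
  ∫⁻ y, ENNReal.ofReal (decayKernel (z.1 - y)) * ENNReal.ofReal (ρ (y, z.2) ^ (3 / 2 : ℝ))

/-- The `L¹ * L²` convolution inequality on time slices: `ρ ^ (3/2)` is in `L¹` uniformly in time
and the kernel is in `L²`. The time interval contributes the factor `T`. -/
lemma exists_lintegral_decayPotential_sq_le (R T C α : ℝ) : ∃ B : ENNReal, B ≠ ⊤ ∧
    ∀ ρ, IsInteractingDensity R T C α ρ →
      Measurable (decayPotential ρ) ∧ ∫⁻ z, decayPotential ρ z ^ 2 ≤ B := by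
  set J := ∫⁻ w, ENNReal.ofReal (decayKernel w) ^ 2 with hJ
  have hJt : J < ⊤ := lintegral_decayKernel_sq_lt_top
  refine ⟨ENNReal.ofReal C * (ENNReal.ofReal C * J) * ENNReal.ofReal T, ?_, fun ρ h => ?_⟩
  · have := hJt.ne
    finiteness
  have hρm := h.measurable
  have hkm := measurable_decayKernel
  have hmeas : Measurable (decayPotential ρ) := by
    refine Measurable.lintegral_prod_right' (f := fun p : SpaceTime × Space3 =>
      ENNReal.ofReal (decayKernel (p.1.1 - p.2))
        * ENNReal.ofReal (ρ (p.2, p.1.2) ^ (3 / 2 : ℝ))) ?_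
    fun_prop
  refine ⟨hmeas, ?_⟩
  have hslice : ∀ᵐ t : ℝ, ∫⁻ x, decayPotential ρ (x, t) ^ 2
      ≤ (Ioo (0 : ℝ) T).indicator (fun _ => ENNReal.ofReal C * (ENNReal.ofReal C * J)) t := by
    filter_upwards [h.mass_le] with t ht
    by_cases htT : t ∈ Ioo (0 : ℝ) T
    swap
    · have : ∀ y, ρ (y, t) = 0 := fun y => h.eq_zero _ fun hy => htT hy.2
      simp [decayPotential, this]
    rw [indicator_of_mem htT]
    calc _ ≤ ∫⁻ x, ENNReal.ofReal C * ∫⁻ y, ENNReal.ofReal (ρ (y, t) ^ (3 / 2 : ℝ))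
          * ENNReal.ofReal (decayKernel (x - y)) ^ 2 := by
          refine lintegral_mono fun x => ?_
          unfold decayPotential
          simp_rw [mul_comm (ENNReal.ofReal (decayKernel _))]
          refine (sq_lintegral_mul_le _ (by fun_prop) (by fun_prop)).trans ?_
          gcongr
      _ = ENNReal.ofReal C * ∫⁻ y, ∫⁻ x, ENNReal.ofReal (ρ (y, t) ^ (3 / 2 : ℝ))
          * ENNReal.ofReal (decayKernel (x - y)) ^ 2 := by
          rw [lintegral_const_mul _ (Measurable.lintegral_prod_right' (f := fun p : Space3 × Space3 =>
            ENNReal.ofReal (ρ (p.2, t) ^ (3 / 2 : ℝ))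
              * ENNReal.ofReal (decayKernel (p.1 - p.2)) ^ 2) (by fun_prop)),
            lintegral_lintegral_swap (by fun_prop)]
      _ = ENNReal.ofReal C * ((∫⁻ y, ENNReal.ofReal (ρ (y, t) ^ (3 / 2 : ℝ))) * J) := by
          rw [← lintegral_mul_const _ (by fun_prop)]
          congr 1
          refine lintegral_congr fun y => ?_
          rw [lintegral_const_mul _ (by fun_prop), lintegral_sub_right_eq_self
            (fun w => ENNReal.ofReal (decayKernel w) ^ 2) y]
      _ ≤ _ := by gcongr
  rw [lintegral_spaceTime_symm (hmeas.pow_const 2)]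
  refine (lintegral_mono_ae hslice).trans ?_
  rw [lintegral_indicator_const measurableSet_Ioo, Real.volume_Ioo, sub_zero]

section

variable {R T C α μ : ℝ} {ρ : SpaceTime → ℝ}

/-- Powers of a number at least one increase with the exponent. Raising the density by one thus lets
a single majorant serve the exponents 5/4 and 4/5. -/
lemma IsInteractingDensity.rpow_le_raisedDensity (h : IsInteractingDensity R T C α ρ) {q : ℝ}
    (hq0 : 0 < q) (hq : q ≤ 5 / 4) (z : SpaceTime) :
    ρ z ^ q ≤ raisedDensity R T ρ z ^ (5 / 4 : ℝ) := by
  by_cases hz : z ∈ spaceTimeCylinder (Metric.ball 0 R) T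
  · rw [raisedDensity, indicator_of_mem hz]
    have h0 := h.nonneg z
    calc ρ z ^ q ≤ (ρ z + 1) ^ q := by gcongr; linarith
      _ ≤ _ := Real.rpow_le_rpow_of_exponent_le (by linarith) hq
  · rw [h.eq_zero z hz, Real.zero_rpow hq0.ne']
    refine Real.rpow_nonneg ?_ _
    rw [raisedDensity, indicator_of_notMem hz]

lemma psiIntegrand_eq (q μ : ℝ) (ρ : SpaceTime → ℝ) (z : SpaceTime) (y : Space3) :
    psiIntegrand q μ ρ z y = potentialKernel μ (z.1 - y) * ρ (y, z.2) ^ q := rfl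

lemma IsInteractingDensity.lintegral_psiIntegrand_le (h : IsInteractingDensity R T C α ρ) {q : ℝ}
    (hq0 : 0 < q) (hq : q ≤ 5 / 4) (z : SpaceTime) :
    ∫⁻ y, ENNReal.ofReal (psiIntegrand q μ ρ z y) ≤ majorant μ R T ρ z := by
  refine lintegral_mono fun y => ?_
  rw [psiIntegrand_eq, ENNReal.ofReal_mul (potentialKernel_nonneg _ _)]
  gcongr
  exact h.rpow_le_raisedDensity hq0 hq _

lemma gIntegrand_zero_le_psiIntegrand (hμ0 : 0 ≤ μ) (hρ : ∀ z, 0 ≤ ρ z) (z : SpaceTime)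
    (y : Space3) : gIntegrand 0 ρ z y ≤ psiIntegrand (5 / 4) μ ρ z y := by
  have h1 : 1 ≤ logFactor ‖z.1 - y‖ ^ μ := Real.one_le_rpow (one_le_logFactor _) hμ0
  have h2 := hρ (y, z.2)
  unfold gIntegrand
  rw [psiIntegrand_eq, potentialKernel, Real.rpow_zero, mul_one]
  gcongr
  exact le_mul_of_one_le_right (by positivity) h1

lemma IsInteractingDensity.lintegral_gIntegrand_le (h : IsInteractingDensity R T C α ρ)
    (hμ0 : 0 ≤ μ) (hμ1 : μ ≤ 1) (z : SpaceTime) :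
    ∫⁻ y, ENNReal.ofReal (gIntegrand μ ρ z y)
      ≤ 17 * (majorant μ R T ρ z + decayPotential ρ z) := by
  have hρm := h.measurable
  have hkm := measurable_decayKernel
  have hpt : ∀ y, ENNReal.ofReal (gIntegrand μ ρ z y)
      ≤ 17 * (ENNReal.ofReal (psiIntegrand (5 / 4) μ ρ z y)
        + ENNReal.ofReal (decayKernel (z.1 - y)) * ENNReal.ofReal (ρ (y, z.2) ^ (3 / 2 : ℝ))) := by
    intro y
    have h0 := h.nonneg (y, z.2)
    have h1 := potentialKernel_nonneg μ (z.1 - y)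
    have h2 := decayKernel_nonneg (z.1 - y)
    rw [psiIntegrand_eq, ← ENNReal.ofReal_mul h2,
      ← ENNReal.ofReal_add (by positivity) (by positivity),
      show (17 : ENNReal) = ENNReal.ofReal 17 by norm_num, ← ENNReal.ofReal_mul (by norm_num)]
    refine ENNReal.ofReal_le_ofReal ?_
    rcases eq_or_ne (z.1 - y) 0 with h3 | h3
    · simp [gIntegrand, h3, potentialKernel, decayKernel]
    have hr : 0 < ‖z.1 - y‖ := norm_pos_iff.2 h3
    have hlog := log_one_add_rpow_le hμ0 hμ1 hr h0
    have e1 : ρ (y, z.2) ^ (3 / 2 : ℝ)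
        = ρ (y, z.2) ^ (5 / 4 : ℝ) * ρ (y, z.2) ^ (1 / 4 : ℝ) := by
      rw [← Real.rpow_add_of_nonneg h0 (by norm_num) (by norm_num)]; norm_num
    unfold gIntegrand potentialKernel decayKernel
    rw [e1]
    calc _ ≤ 1 / ‖z.1 - y‖ ^ 2 * ρ (y, z.2) ^ (5 / 4 : ℝ)
          * (17 * (logFactor ‖z.1 - y‖ ^ μ + min 1 ‖z.1 - y‖ * ρ (y, z.2) ^ (1 / 4 : ℝ))) := by
          gcongr
      _ = _ := by ring
  have hkp := measurable_potentialKernel μ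
  refine (lintegral_mono hpt).trans ?_
  simp_rw [psiIntegrand_eq]
  rw [lintegral_const_mul _ (by fun_prop), lintegral_add_left (by fun_prop)]
  gcongr
  · exact h.lintegral_psiIntegrand_le (by norm_num) le_rfl z
  · exact le_rfl
end
end

/-! ### The potential `Σ_μ`. -/

noncomputable section

/-- The decay of the potentials far from the cylinder. -/
def tailBound (T : ℝ) (z : SpaceTime) : ENNReal :=
  (Ioo (0 : ℝ) T).indicator (fun _ => ENNReal.ofReal ((1 + ‖z.1‖) ^ (-(7 / 4) : ℝ))) z.2

lemma measurable_tailBound (T : ℝ) : Measurable (tailBound T) := by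
  have h1 : Measurable fun z : SpaceTime => ENNReal.ofReal ((1 + ‖z.1‖) ^ (-(7 / 4) : ℝ)) := by
    fun_prop
  exact h1.indicator (measurable_snd measurableSet_Ioo)

lemma lintegral_tailBound_sq_lt_top (T : ℝ) : ∫⁻ z, tailBound T z ^ 2 < ⊤ := by
  rw [lintegral_spaceTime_symm ((measurable_tailBound T).pow_const 2)]
  have h : ∀ t : ℝ, ∫⁻ x, tailBound T (x, t) ^ 2 = (Ioo (0 : ℝ) T).indicator
      (fun _ => ∫⁻ w : Space3, ENNReal.ofReal ((1 + ‖w‖) ^ (-(7 / 2) : ℝ))) t := by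
    intro t
    by_cases ht : t ∈ Ioo (0 : ℝ) T
    · rw [indicator_of_mem ht]
      refine lintegral_congr fun x => ?_
      simp only [tailBound]
      rw [indicator_of_mem ht, ← ENNReal.ofReal_pow (by positivity), ← Real.rpow_natCast,
        ← Real.rpow_mul (by positivity)]
      norm_num
    · rw [indicator_of_notMem ht]
      simp [tailBound, indicator_of_notMem ht]
  simp_rw [h]
  rw [lintegral_indicator_const measurableSet_Ioo, Real.volume_Ioo]
  exact ENNReal.mul_lt_top lintegral_one_add_norm_lt_top ENNReal.ofReal_lt_top

lemma gIntegrand_zero_eq (ρ : SpaceTime → ℝ) (z : SpaceTime) (y : Space3) :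
    gIntegrand 0 ρ z y = 1 / ‖z.1 - y‖ ^ 2 * ρ (y, z.2) ^ (5 / 4 : ℝ) := by
  simp [gIntegrand]

/-- An eighth of a power pays for the logarithm. If `s` decays like `|x|⁻²`, then `s ^ (7/8)` decays
like `|x| ^ (-7/4)`, which is still square integrable at infinity. -/
lemma mul_logFactor_rpow_le {μ s S : ℝ} (hμ1 : μ ≤ 1) (hs : 0 < s) (hsS : s ≤ S) :
    s * logFactor s ^ μ ≤ 9 * (S ^ (1 / 4 : ℝ) + 1) * s ^ (7 / 8 : ℝ) := by
  have h1 := (logFactor_rpow_le hμ1 s).trans (logFactor_le_rpow hs (show (0 : ℝ) < 1 / 8 by norm_num))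
  have e1 : s * s ^ (-(1 / 8) : ℝ) = s ^ (7 / 8 : ℝ) := by
    rw [← Real.rpow_one_add' hs.le (by norm_num)]; norm_num
  have e2 : s * s ^ (1 / 8 : ℝ) = s ^ (1 / 4 : ℝ) * s ^ (7 / 8 : ℝ) := by
    rw [← Real.rpow_one_add' hs.le (by norm_num), ← Real.rpow_add hs]; norm_num
  calc s * logFactor s ^ μ ≤ s * ((1 + 1 / (1 / 8)) * (s ^ (1 / 8 : ℝ) + s ^ (-(1 / 8) : ℝ))) := by
        gcongr
    _ = 9 * (s * s ^ (1 / 8 : ℝ) + s * s ^ (-(1 / 8) : ℝ)) := by ring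
    _ = 9 * (s ^ (1 / 4 : ℝ) + 1) * s ^ (7 / 8 : ℝ) := by rw [e1, e2]; ring
    _ ≤ _ := by gcongr

section

variable {R T C α μ : ℝ} {ρ : SpaceTime → ℝ}

lemma IsInteractingDensity.lintegral_rpow_five_quarters_le (h : IsInteractingDensity R T C α ρ)
    {t : ℝ} (ht : ∫⁻ x, ENNReal.ofReal (ρ (x, t) ^ (3 / 2 : ℝ)) ≤ ENNReal.ofReal C) :
    ∫⁻ x, ENNReal.ofReal (ρ (x, t) ^ (5 / 4 : ℝ))
      ≤ ENNReal.ofReal (max C 0 + volume.real (Metric.ball (0 : Space3) R)) := by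
  have hU : MeasurableSet (Metric.ball (0 : Space3) R) := measurableSet_ball
  have hm := h.measurable
  calc _ ≤ ∫⁻ x, ENNReal.ofReal (ρ (x, t) ^ (3 / 2 : ℝ))
        + (Metric.ball (0 : Space3) R).indicator 1 x := by
        refine lintegral_mono fun x => ?_
        by_cases hx : x ∈ Metric.ball (0 : Space3) R
        · rw [indicator_of_mem hx, Pi.one_apply, ← ENNReal.ofReal_one,
            ← ENNReal.ofReal_add (Real.rpow_nonneg (h.nonneg _) _) zero_le_one]
          refine ENNReal.ofReal_le_ofReal ?_
          have h0 := h.nonneg (x, t)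
          rcases le_total (ρ (x, t)) 1 with h1 | h1
          · have h2 : ρ (x, t) ^ (5 / 4 : ℝ) ≤ 1 := Real.rpow_le_one h0 h1 (by norm_num)
            have h3 : 0 ≤ ρ (x, t) ^ (3 / 2 : ℝ) := Real.rpow_nonneg h0 _
            linarith
          · have h2 : ρ (x, t) ^ (5 / 4 : ℝ) ≤ ρ (x, t) ^ (3 / 2 : ℝ) :=
              Real.rpow_le_rpow_of_exponent_le h1 (by norm_num)
            linarith
        · rw [h.eq_zero (x, t) fun hz => hx hz.1]
          simp
    _ = (∫⁻ x, ENNReal.ofReal (ρ (x, t) ^ (3 / 2 : ℝ))) + volume (Metric.ball (0 : Space3) R) := by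
        rw [lintegral_add_left (by fun_prop), lintegral_indicator_one hU]
    _ ≤ ENNReal.ofReal (max C 0) + ENNReal.ofReal (volume.real (Metric.ball (0 : Space3) R)) := by
        rw [ofReal_measureReal measure_ball_lt_top.ne]
        gcongr
        exact ht.trans (ENNReal.ofReal_le_ofReal (le_max_left _ _))
    _ = _ := (ENNReal.ofReal_add (le_max_right _ _) measureReal_nonneg).symm

/-- Either `1/r² ≤ √G`, which yields the second summand, or `r < G ^ (-1/4)` up to equality, and
then `log G / 4 ≤ |log r|`, so that the weight is dominated by the logarithm in the kernel. -/
lemma weighted_gIntegrand_le (hμ0 : 0 ≤ μ) (hρ : ∀ z, 0 ≤ ρ z) {G : ℝ} (hG : 1 ≤ G)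
    (z : SpaceTime) (y : Space3) :
    (1 + Real.log G / 4) ^ μ * gIntegrand 0 ρ z y ≤ psiIntegrand (5 / 4) μ ρ z y
      + (1 + Real.log G / 4) ^ μ * √G * ρ (y, z.2) ^ (5 / 4 : ℝ) := by
  have hG0 : 0 < G := by linarith
  have hlog := Real.log_nonneg hG
  have h0 := hρ (y, z.2)
  rw [gIntegrand_zero_eq, psiIntegrand_eq]
  set r := ‖z.1 - y‖ with hr
  set P := ρ (y, z.2) ^ (5 / 4 : ℝ) with hP
  have hP0 : 0 ≤ P := Real.rpow_nonneg h0 _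
  have hk := potentialKernel_nonneg μ (z.1 - y)
  have hQ : 0 ≤ (1 + Real.log G / 4) ^ μ := by positivity
  rcases (norm_nonneg (z.1 - y)).eq_or_lt with h1 | h1
  · rw [hr, ← h1]
    simp only [ne_eq, OfNat.ofNat_ne_zero, not_false_eq_true, zero_pow, div_zero, zero_mul,
      mul_zero]
    positivity
  rw [← hr] at h1
  rcases le_total (1 / r ^ 2) (√G) with h2 | h2
  · have h3 : (1 + Real.log G / 4) ^ μ * (1 / r ^ 2 * P) ≤ (1 + Real.log G / 4) ^ μ * (√G * P) := by
      gcongr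
    nlinarith [mul_nonneg hk hP0]
  · have h3 : 1 + Real.log G / 4 ≤ logFactor r := by
      have h4 : Real.log (√G) ≤ Real.log (1 / r ^ 2) := Real.log_le_log (by positivity) h2
      rw [Real.log_sqrt hG0.le, one_div, Real.log_inv, Real.log_pow] at h4
      push_cast at h4
      unfold logFactor
      linarith [neg_abs_le (Real.log r)]
    have h5 : (1 + Real.log G / 4) ^ μ * (1 / r ^ 2 * P) ≤ logFactor r ^ μ * (1 / r ^ 2 * P) := by
      gcongr
    have h6 : potentialKernel μ (z.1 - y) * P = logFactor r ^ μ * (1 / r ^ 2 * P) := by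
      unfold potentialKernel; ring
    have h7 : 0 ≤ (1 + Real.log G / 4) ^ μ * √G * P := by positivity
    linarith

lemma gPotential_nonneg (hρ : ∀ z, 0 ≤ ρ z) (z : SpaceTime) : 0 ≤ gPotential μ ρ z := by
  refine integral_nonneg fun y => ?_
  have h0 := hρ (y, z.2)
  have h1 : 0 ≤ Real.log (1 + ρ (y, z.2)) := Real.log_nonneg (by linarith)
  unfold gIntegrand
  positivity

lemma gIntegrand_nonneg (hρ : ∀ z, 0 ≤ ρ z) (z : SpaceTime) (y : Space3) :
    0 ≤ gIntegrand μ ρ z y := by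
  have h0 := hρ (y, z.2)
  have h1 : 0 ≤ Real.log (1 + ρ (y, z.2)) := Real.log_nonneg (by linarith)
  unfold gIntegrand
  positivity

/-- Large values of `G₀` are produced by nearby mass, where the logarithm is large as well. -/
lemma IsInteractingDensity.sigmaPotential_le_majorant (h : IsInteractingDensity R T C α ρ)
    (hμ0 : 0 ≤ μ) (hμ1 : μ ≤ 1) {z : SpaceTime} {m : ℝ}
    (hmass : ∫⁻ x, ENNReal.ofReal (ρ (x, z.2) ^ (5 / 4 : ℝ)) ≤ ENNReal.ofReal m)
    (hint : Integrable (gIntegrand 0 ρ z)) (hG1 : 1 ≤ gPotential 0 ρ z)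
    (hGm : 4 * m ^ 2 ≤ gPotential 0 ρ z) :
    ENNReal.ofReal (sigmaPotential μ ρ z) ≤ 8 * majorant μ R T ρ z := by
  set G := gPotential 0 ρ z with hG
  have hG0 : 0 < G := by linarith
  have hlog := Real.log_nonneg hG1
  set Q := (1 + Real.log G / 4) ^ μ with hQ
  have hQ0 : 0 ≤ Q := by positivity
  have hρm := h.measurable
  have hkp := measurable_potentialKernel μ
  have hGe : ENNReal.ofReal G = ∫⁻ y, ENNReal.ofReal (gIntegrand 0 ρ z y) :=
    ofReal_integral_eq_lintegral_ofReal hint (ae_of_all _ (gIntegrand_nonneg h.nonneg z))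
  -- Distant mass contributes at most `Q √G m`, and `√G m ≤ G/2` because `G ≥ 4 m²`; this half is
  -- finite and can be subtracted afterwards.
  have h1 : ENNReal.ofReal (Q * G) ≤ majorant μ R T ρ z + ENNReal.ofReal (Q * G / 2) := by
    have mg : Measurable fun y => ENNReal.ofReal (gIntegrand 0 ρ z y) := by
      simp_rw [gIntegrand_zero_eq]; fun_prop
    have mp : Measurable fun y => ENNReal.ofReal (psiIntegrand (5 / 4) μ ρ z y) := by
      simp_rw [psiIntegrand_eq]; fun_prop
    calc ENNReal.ofReal (Q * G) = ∫⁻ y, ENNReal.ofReal Q * ENNReal.ofReal (gIntegrand 0 ρ z y) := by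
          rw [ENNReal.ofReal_mul hQ0, hGe, lintegral_const_mul _ mg]
      _ ≤ ∫⁻ y, ENNReal.ofReal (psiIntegrand (5 / 4) μ ρ z y)
          + ENNReal.ofReal (Q * √G) * ENNReal.ofReal (ρ (y, z.2) ^ (5 / 4 : ℝ)) := by
          refine lintegral_mono fun y => ?_
          have h2 : 0 ≤ ρ (y, z.2) ^ (5 / 4 : ℝ) := Real.rpow_nonneg (h.nonneg _) _
          have h3 : 0 ≤ psiIntegrand (5 / 4) μ ρ z y :=
            mul_nonneg (potentialKernel_nonneg μ _) h2
          simp only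
          rw [← ENNReal.ofReal_mul hQ0, ← ENNReal.ofReal_mul (by positivity),
            ← ENNReal.ofReal_add h3 (by positivity)]
          exact ENNReal.ofReal_le_ofReal (weighted_gIntegrand_le hμ0 h.nonneg hG1 z y)
      _ ≤ majorant μ R T ρ z + ENNReal.ofReal (Q * √G) * ENNReal.ofReal m := by
          rw [lintegral_add_left mp, lintegral_const_mul _ (by fun_prop)]
          gcongr
          exact h.lintegral_psiIntegrand_le (by norm_num) le_rfl z
      _ ≤ _ := by
          rw [← ENNReal.ofReal_mul (by positivity)]
          gcongr
          have h4 : 2 * m ≤ √G := by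
            refine Real.le_sqrt_of_sq_le ?_
            nlinarith
          have h5 : √G * √G = G := Real.mul_self_sqrt hG0.le
          have h6 : 0 ≤ √G := Real.sqrt_nonneg _
          have h7 : √G * m ≤ G / 2 := by nlinarith
          calc Q * √G * m = Q * (√G * m) := by ring
            _ ≤ Q * (G / 2) := by gcongr
            _ = _ := by ring
  have h2 : ENNReal.ofReal (Q * G / 2) ≤ majorant μ R T ρ z := by
    have e : ENNReal.ofReal (Q * G) = ENNReal.ofReal (Q * G / 2) + ENNReal.ofReal (Q * G / 2) := by
      rw [← ENNReal.ofReal_add (by positivity) (by positivity)]; congr 1; ring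
    rw [e] at h1
    exact (ENNReal.add_le_add_iff_right ENNReal.ofReal_ne_top).1 h1
  -- Restoring `log G` from `log G / 4` costs a factor `4 ^ μ ≤ 4`, and the absorbed half doubles
  -- it.
  have h3 : sigmaPotential μ ρ z ≤ 8 * (Q * G / 2) := by
    unfold sigmaPotential
    rw [← hG, abs_of_nonneg hlog]
    have h4 : (1 + Real.log G) ^ μ ≤ 4 * Q := by
      calc (1 + Real.log G) ^ μ ≤ (4 * (1 + Real.log G / 4)) ^ μ := by gcongr; linarith
        _ = 4 ^ μ * Q := Real.mul_rpow (by norm_num) (by positivity)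
        _ ≤ 4 ^ (1 : ℝ) * Q := by gcongr; norm_num
        _ = _ := by rw [Real.rpow_one]
    calc _ ≤ G * (4 * Q) := by gcongr
      _ = _ := by ring
  calc _ ≤ ENNReal.ofReal (8 * (Q * G / 2)) := ENNReal.ofReal_le_ofReal h3
    _ = 8 * ENNReal.ofReal (Q * G / 2) := by
        rw [ENNReal.ofReal_mul (by norm_num)]; norm_num
    _ ≤ _ := by gcongr

/-- Far from the cylinder `G₀` decays like the square of the distance. -/
lemma IsInteractingDensity.gPotential_zero_far_le (h : IsInteractingDensity R T C α ρ)
    {z : SpaceTime} {m : ℝ} (hm : 0 ≤ m)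
    (hmass : ∫⁻ x, ENNReal.ofReal (ρ (x, z.2) ^ (5 / 4 : ℝ)) ≤ ENNReal.ofReal m)
    (hint : Integrable (gIntegrand 0 ρ z)) (hz0 : 0 < ‖z.1‖) (hz : 2 * R ≤ ‖z.1‖) :
    gPotential 0 ρ z ≤ 4 / ‖z.1‖ ^ 2 * m := by
  have hρm := h.measurable
  have hGe : ENNReal.ofReal (gPotential 0 ρ z) = ∫⁻ y, ENNReal.ofReal (gIntegrand 0 ρ z y) :=
    ofReal_integral_eq_lintegral_ofReal hint (ae_of_all _ (gIntegrand_nonneg h.nonneg z))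
  rw [← ENNReal.ofReal_le_ofReal_iff (by positivity), hGe]
  calc _ ≤ ∫⁻ y, ENNReal.ofReal (4 / ‖z.1‖ ^ 2) * ENNReal.ofReal (ρ (y, z.2) ^ (5 / 4 : ℝ)) := by
        refine lintegral_mono fun y => ?_
        simp only
        rw [← ENNReal.ofReal_mul (by positivity), gIntegrand_zero_eq]
        refine ENNReal.ofReal_le_ofReal ?_
        by_cases hy : y ∈ Metric.ball (0 : Space3) R
        · have h1 : ‖z.1‖ / 2 ≤ ‖z.1 - y‖ := by
            rw [mem_ball_zero_iff] at hy
            linarith [norm_sub_norm_le z.1 y]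
          have h2 : 1 / ‖z.1 - y‖ ^ 2 ≤ 4 / ‖z.1‖ ^ 2 := by
            calc 1 / ‖z.1 - y‖ ^ 2 ≤ 1 / (‖z.1‖ / 2) ^ 2 := by gcongr
              _ = _ := by field_simp; norm_num
          have := Real.rpow_nonneg (h.nonneg (y, z.2)) (5 / 4)
          gcongr
        · rw [h.eq_zero (y, z.2) fun hz => hy hz.1, Real.zero_rpow (by norm_num)]
          simp
    _ ≤ _ := by
        rw [lintegral_const_mul _ (by fun_prop), ENNReal.ofReal_mul (by positivity)]
        gcongr
end

lemma exists_sigmaPotential_le {R : ℝ} (hR : 0 < R) (T C : ℝ) {μ : ℝ} (hμ0 : 0 ≤ μ) (hμ1 : μ ≤ 1) :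
    ∃ c : ℝ, 0 ≤ c ∧ ∀ {α : ℝ} {ρ : SpaceTime → ℝ}, IsInteractingDensity R T C α ρ →
      ∀ z : SpaceTime, ∫⁻ x, ENNReal.ofReal (ρ (x, z.2) ^ (3 / 2 : ℝ)) ≤ ENNReal.ofReal C →
        Integrable (gIntegrand 0 ρ z) → ENNReal.ofReal (sigmaPotential μ ρ z)
          ≤ ENNReal.ofReal c * (majorant μ R T ρ z + tailBound T z) := by
  set m := max C 0 + volume.real (Metric.ball (0 : Space3) R) with hm
  have hm0 : 0 ≤ m := add_nonneg (le_max_right _ _) measureReal_nonneg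
  -- The threshold: above it large values are attributed to nearby mass, below it the decay at
  -- infinity is used.
  set S := max 1 (4 * m ^ 2) with hS
  have hS1 : 1 ≤ S := le_max_left _ _
  -- A bound for `G₀ (1 + |x|)²` below the threshold: the first summand covers `|x| ≤ 2R`, the
  -- second the far field.
  set A := S * (1 + 2 * R) ^ 2 + 4 * m * (1 + 1 / (2 * R)) ^ 2 with hA
  have hA0 : 0 ≤ A := by positivity
  set B := 9 * (S ^ (1 / 4 : ℝ) + 1) * A ^ (7 / 8 : ℝ) with hB
  have hB0 : 0 ≤ B := by positivity
  refine ⟨8 + B, by positivity, fun {α ρ} h z hmass hint => ?_⟩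
  have hmass' := h.lintegral_rpow_five_quarters_le hmass
  have hG0 : 0 ≤ gPotential 0 ρ z := gPotential_nonneg h.nonneg z
  rcases le_total S (gPotential 0 ρ z) with h1 | h1
  · refine (h.sigmaPotential_le_majorant hμ0 hμ1 hmass' hint ((le_max_left _ _).trans h1)
      ((le_max_right _ _).trans h1)).trans ?_
    rw [ENNReal.ofReal_add (by norm_num) hB0]
    calc 8 * majorant μ R T ρ z = ENNReal.ofReal 8 * majorant μ R T ρ z := by norm_num
      _ ≤ _ := mul_le_mul' le_self_add le_self_add
  · rcases hG0.eq_or_lt with h2 | h2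
    · unfold sigmaPotential
      rw [← h2]
      simp
    have ht : z.2 ∈ Ioo (0 : ℝ) T := by
      by_contra ht
      have : ∀ y, gIntegrand 0 ρ z y = 0 := fun y => by
        rw [gIntegrand_zero_eq, h.eq_zero (y, z.2) fun hy => ht hy.2,
          Real.zero_rpow (by norm_num), mul_zero]
      simp [gPotential, this] at h2
    have hdec : gPotential 0 ρ z ≤ A * (1 + ‖z.1‖) ^ (-2 : ℝ) := by
      rw [Real.rpow_neg (by positivity), Real.rpow_two, ← div_eq_mul_inv,
        le_div_iff₀ (by positivity)]
      rcases le_total ‖z.1‖ (2 * R) with h3 | h3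
      · have h4 : gPotential 0 ρ z * (1 + ‖z.1‖) ^ 2 ≤ S * (1 + 2 * R) ^ 2 := by gcongr
        have h5 : 0 ≤ 4 * m * (1 + 1 / (2 * R)) ^ 2 := by positivity
        linarith
      · have hz0 : 0 < ‖z.1‖ := by linarith
        have h4 := h.gPotential_zero_far_le hm0 hmass' hint hz0 h3
        have h5 : 1 + ‖z.1‖ ≤ (1 + 1 / (2 * R)) * ‖z.1‖ := by
          have : 1 ≤ 1 / (2 * R) * ‖z.1‖ := by
            rw [one_div, inv_mul_eq_div, one_le_div (by positivity)]; exact h3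
          linarith
        have h6 : gPotential 0 ρ z * (1 + ‖z.1‖) ^ 2
            ≤ 4 / ‖z.1‖ ^ 2 * m * ((1 + 1 / (2 * R)) * ‖z.1‖) ^ 2 := by gcongr
        have h7 : 4 / ‖z.1‖ ^ 2 * m * ((1 + 1 / (2 * R)) * ‖z.1‖) ^ 2
            = 4 * m * (1 + 1 / (2 * R)) ^ 2 := by
          rw [mul_pow]; field_simp
        have h8 : 0 ≤ S * (1 + 2 * R) ^ 2 := by positivity
        linarith
    have h3 : gPotential 0 ρ z ^ (7 / 8 : ℝ) ≤ A ^ (7 / 8 : ℝ) * (1 + ‖z.1‖) ^ (-(7 / 4) : ℝ) := by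
      calc _ ≤ (A * (1 + ‖z.1‖) ^ (-2 : ℝ)) ^ (7 / 8 : ℝ) := by gcongr
        _ = _ := by
            rw [Real.mul_rpow hA0 (by positivity), ← Real.rpow_mul (by positivity)]
            norm_num
    have h4 : sigmaPotential μ ρ z ≤ B * (1 + ‖z.1‖) ^ (-(7 / 4) : ℝ) := by
      calc sigmaPotential μ ρ z = gPotential 0 ρ z * logFactor (gPotential 0 ρ z) ^ μ := rfl
        _ ≤ 9 * (S ^ (1 / 4 : ℝ) + 1) * gPotential 0 ρ z ^ (7 / 8 : ℝ) :=
            mul_logFactor_rpow_le hμ1 h2 h1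
        _ ≤ 9 * (S ^ (1 / 4 : ℝ) + 1) * (A ^ (7 / 8 : ℝ) * (1 + ‖z.1‖) ^ (-(7 / 4) : ℝ)) := by
            gcongr
        _ = _ := by rw [hB]; ring
    refine (ENNReal.ofReal_le_ofReal h4).trans ?_
    rw [ENNReal.ofReal_mul hB0, ENNReal.ofReal_add (by norm_num) hB0]
    refine mul_le_mul' le_add_self ?_
    refine le_trans (le_of_eq ?_) le_add_self
    rw [tailBound, indicator_of_mem ht]
end

/-! ### Assembly of the four bounds. -/

noncomputable section

lemma ENNReal.add_sq_le_four_mul (a b : ENNReal) : (a + b) ^ 2 ≤ 4 * (a ^ 2 + b ^ 2) := by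
  rcases le_total a b with h | h
  · calc (a + b) ^ 2 ≤ (b + b) ^ 2 := by gcongr
      _ = 4 * b ^ 2 := by ring
      _ ≤ _ := by gcongr; exact le_add_self
  · calc (a + b) ^ 2 ≤ (a + a) ^ 2 := by gcongr
      _ = 4 * a ^ 2 := by ring
      _ ≤ _ := by gcongr; exact le_self_add

lemma l2NormLe_of_lintegral_sq_le {F : SpaceTime → ℝ} {W : SpaceTime → ENNReal} {c : ℝ}
    (hF : AEStronglyMeasurable F volume) (hW : ∀ᵐ z, ‖F z‖ₑ ≤ W z)
    (hB : ∫⁻ z, W z ^ 2 ≤ ENNReal.ofReal c ^ 2) : L2NormLe F c := by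
  have h : eLpNorm F 2 volume ≤ ENNReal.ofReal c := by
    rw [eLpNorm_eq_lintegral_rpow_enorm_toReal (by norm_num) (by norm_num)]
    simp only [ENNReal.toReal_ofNat, ENNReal.rpow_ofNat]
    have h1 : ∫⁻ z, ‖F z‖ₑ ^ 2 ≤ ENNReal.ofReal c ^ 2 := by
      refine (lintegral_mono_ae ?_).trans hB
      filter_upwards [hW] with z hz
      gcongr
    calc _ ≤ (ENNReal.ofReal c ^ 2) ^ (1 / 2 : ℝ) := by gcongr
      _ = _ := by rw [← ENNReal.rpow_ofNat, ← ENNReal.rpow_mul]; norm_num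
  exact ⟨⟨hF, h.trans_lt ENNReal.ofReal_lt_top⟩, h⟩

/-- Absolute convergence almost everywhere and square integrability of the potentials. -/
def HasBoundedPotentials (μ c : ℝ) (ρ : SpaceTime → ℝ) : Prop :=
  (∀ᵐ z : SpaceTime,
    Integrable (psiIntegrand (5 / 4) μ ρ z) ∧ Integrable (psiIntegrand (4 / 5) μ ρ z) ∧
    Integrable (gIntegrand μ ρ z) ∧ Integrable (gIntegrand 0 ρ z)) ∧
  L2NormLe (psiPotential (5 / 4) μ ρ) c ∧ L2NormLe (psiPotential (4 / 5) μ ρ) c ∧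
  L2NormLe (gPotential μ ρ) c ∧ L2NormLe (sigmaPotential μ ρ) c

lemma L2NormLe.congr {F G : SpaceTime → ℝ} {c : ℝ} (h : F =ᵐ[volume] G) (hG : L2NormLe G c) :
    L2NormLe F c :=
  ⟨hG.1.ae_eq h.symm, (eLpNorm_congr_ae h).trans_le hG.2⟩

/-- The potentials at `(x,t)` depend only on the slice of the density at time `t`, and almost all
slices agree almost everywhere. -/
lemma HasBoundedPotentials.congr {μ c : ℝ} {ρ ρ' : SpaceTime → ℝ} (h : ρ =ᵐ[volume] ρ')
    (h' : HasBoundedPotentials μ c ρ') : HasBoundedPotentials μ c ρ := by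
  have h1 : ∀ᵐ t : ℝ, ∀ᵐ y : Space3, ρ (y, t) = ρ' (y, t) :=
    Measure.ae_ae_of_ae_prod ((Measure.measurePreserving_swap (μ := (volume : Measure ℝ))
      (ν := (volume : Measure Space3))).quasiMeasurePreserving.ae h)
  have h2 : ∀ᵐ z : SpaceTime, ∀ᵐ y : Space3, ρ (y, z.2) = ρ' (y, z.2) :=
    (Measure.quasiMeasurePreserving_snd (μ := (volume : Measure Space3))
      (ν := (volume : Measure ℝ))).ae h1
  have hpsi : ∀ q, ∀ᵐ z : SpaceTime, psiIntegrand q μ ρ z =ᵐ[volume] psiIntegrand q μ ρ' z := by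
    intro q
    filter_upwards [h2] with z hz
    filter_upwards [hz] with y hy
    simp only [psiIntegrand, hy]
  have hg : ∀ ν, ∀ᵐ z : SpaceTime, gIntegrand ν ρ z =ᵐ[volume] gIntegrand ν ρ' z := by
    intro ν
    filter_upwards [h2] with z hz
    filter_upwards [hz] with y hy
    simp only [gIntegrand, hy]
  obtain ⟨h3, h4, h5, h6, h7⟩ := h'
  refine ⟨?_, h4.congr ?_, h5.congr ?_, h6.congr ?_, h7.congr ?_⟩
  · filter_upwards [h3, hpsi (5 / 4), hpsi (4 / 5), hg μ, hg 0] with z h8 e1 e2 e3 e4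
    exact ⟨h8.1.congr e1.symm, h8.2.1.congr e2.symm, h8.2.2.1.congr e3.symm,
      h8.2.2.2.congr e4.symm⟩
  · filter_upwards [hpsi (5 / 4)] with z hz using integral_congr_ae hz
  · filter_upwards [hpsi (4 / 5)] with z hz using integral_congr_ae hz
  · filter_upwards [hg μ] with z hz using integral_congr_ae hz
  · filter_upwards [hg 0] with z hz
    have : gPotential 0 ρ z = gPotential 0 ρ' z := integral_congr_ae hz
    simp only [sigmaPotential, this]

lemma exists_hasBoundedPotentials {R : ℝ} (hR : 0 < R) (T C : ℝ) {μ : ℝ} (hμ0 : 0 < μ)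
    (hμ1 : μ ≤ 1) : ∃ c : ℝ, 0 < c ∧ ∀ ρ, IsInteractingDensity R T C (2 * μ) ρ →
      HasBoundedPotentials μ c ρ := by
  obtain ⟨B₁, hB₁, h1⟩ := exists_lintegral_majorant_sq_le hμ0 hμ1 R T C
  obtain ⟨B₂, hB₂, h2⟩ := exists_lintegral_decayPotential_sq_le R T C (2 * μ)
  obtain ⟨A, hA, h3⟩ := exists_sigmaPotential_le hR T C hμ0.le hμ1
  have hB₃ := lintegral_tailBound_sq_lt_top T
  set D : ENNReal := 17 + ENNReal.ofReal A with hD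
  set B := D ^ 2 * (4 * (4 * (B₁ + B₂) + ∫⁻ z, tailBound T z ^ 2)) with hB
  have hBt : B ≠ ⊤ := by finiteness
  -- The added 1 makes `c` positive even if `B = 0`.
  set c := Real.sqrt B.toReal + 1 with hc
  have hBc : B ≤ ENNReal.ofReal c ^ 2 := by
    rw [← ENNReal.ofReal_toReal hBt, ← ENNReal.ofReal_pow (by positivity)]
    refine ENNReal.ofReal_le_ofReal ?_
    have e := Real.sq_sqrt (ENNReal.toReal_nonneg (a := B))
    have e' := Real.sqrt_nonneg B.toReal
    rw [hc]; nlinarith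
  refine ⟨c, by positivity, fun ρ hρ => ?_⟩
  obtain ⟨hm1, hi1⟩ := h1 ρ hρ
  obtain ⟨hm2, hi2⟩ := h2 ρ hρ
  have hm3 := measurable_tailBound T
  -- A common square integrable majorant of all the potentials. Its finiteness almost everywhere
  -- also yields absolute convergence.
  set W : SpaceTime → ENNReal := fun z =>
    D * (majorant μ R T ρ z + decayPotential ρ z + tailBound T z) with hW
  have hWm : Measurable W := by fun_prop
  have hWB : ∫⁻ z, W z ^ 2 ≤ B := by
    calc ∫⁻ z, W z ^ 2 ≤ ∫⁻ z, D ^ 2 * (4 * (4 * (majorant μ R T ρ z ^ 2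
            + decayPotential ρ z ^ 2) + tailBound T z ^ 2)) := by
          refine lintegral_mono fun z => ?_
          rw [hW, mul_pow]
          gcongr
          refine (ENNReal.add_sq_le_four_mul _ _).trans ?_
          gcongr
          exact ENNReal.add_sq_le_four_mul _ _
      _ = D ^ 2 * (4 * (4 * ((∫⁻ z, majorant μ R T ρ z ^ 2) + ∫⁻ z, decayPotential ρ z ^ 2)
            + ∫⁻ z, tailBound T z ^ 2)) := by
          rw [lintegral_const_mul _ (by fun_prop), lintegral_const_mul _ (by fun_prop),
            lintegral_add_left (by fun_prop), lintegral_const_mul _ (by fun_prop),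
            lintegral_add_left (by fun_prop)]
      _ ≤ B := by rw [hB]; gcongr
  have hWt : ∀ᵐ z, W z < ⊤ := by
    filter_upwards [ae_lt_top (hWm.pow_const 2) (hWB.trans_lt hBt.lt_top).ne] with z hz
    exact lt_top_iff_ne_top.2 fun h => by simp [h] at hz
  have hWB' := hWB.trans hBc
  have hρm := hρ.measurable
  have hρ0 := hρ.nonneg
  have hkp := measurable_potentialKernel μ
  have hpm : ∀ q, Measurable fun p : SpaceTime × Space3 => psiIntegrand q μ ρ p.1 p.2 := by
    intro q
    simp_rw [psiIntegrand_eq]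
    fun_prop
  have hgm : ∀ ν, Measurable fun p : SpaceTime × Space3 => gIntegrand ν ρ p.1 p.2 := by
    intro ν
    unfold gIntegrand
    fun_prop
  have hp0 : ∀ q z y, 0 ≤ psiIntegrand q μ ρ z y := fun q z y => by
    rw [psiIntegrand_eq]
    exact mul_nonneg (potentialKernel_nonneg _ _) (Real.rpow_nonneg (hρ0 _) _)
  have hD17 : 17 ≤ D := le_self_add
  have hD1 : 1 ≤ D := le_trans (by norm_num) hD17
  have hmW : ∀ z, majorant μ R T ρ z ≤ W z := fun z => by
    calc _ ≤ 1 * (majorant μ R T ρ z + decayPotential ρ z + tailBound T z) := by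
          rw [one_mul, add_assoc]; exact le_self_add
      _ ≤ D * (majorant μ R T ρ z + decayPotential ρ z + tailBound T z) := by gcongr
  have hpW : ∀ q : ℝ, 0 < q → q ≤ 5 / 4 → ∀ z, ∫⁻ y, ENNReal.ofReal (psiIntegrand q μ ρ z y) ≤ W z :=
    fun q hq0 hq z => (hρ.lintegral_psiIntegrand_le hq0 hq z).trans (hmW z)
  have hgW : ∀ z, ∫⁻ y, ENNReal.ofReal (gIntegrand μ ρ z y) ≤ W z := fun z => by
    refine (hρ.lintegral_gIntegrand_le hμ0.le hμ1 z).trans (mul_le_mul' hD17 le_self_add)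
  have hg0W : ∀ z, ∫⁻ y, ENNReal.ofReal (gIntegrand 0 ρ z y) ≤ W z := fun z =>
    (lintegral_mono fun y => ENNReal.ofReal_le_ofReal
      (gIntegrand_zero_le_psiIntegrand hμ0.le hρ0 z y)).trans (hpW _ (by norm_num) le_rfl z)
  have key : ∀ {k : SpaceTime → Space3 → ℝ}, (Measurable fun p : SpaceTime × Space3 => k p.1 p.2) →
      (∀ z y, 0 ≤ k z y) → (∀ z, ∫⁻ y, ENNReal.ofReal (k z y) ≤ W z) →
      (∀ᵐ z, Integrable (k z)) ∧ L2NormLe (fun z => ∫ y, k z y) c := by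
    intro k hk hk0 hkW
    have hkm : ∀ z, Measurable (k z) := fun z => hk.comp measurable_prodMk_left
    refine ⟨?_, l2NormLe_of_lintegral_sq_le
      hk.stronglyMeasurable.integral_prod_right'.aestronglyMeasurable
      (ae_of_all _ fun z => ?_) hWB'⟩
    · filter_upwards [hWt] with z hz
      refine ⟨(hkm z).aestronglyMeasurable, ?_⟩
      rw [hasFiniteIntegral_iff_ofReal (ae_of_all _ (hk0 z))]
      exact (hkW z).trans_lt hz
    · refine (enorm_integral_le_lintegral_enorm _).trans ((lintegral_congr fun y => ?_).trans_le
        (hkW z))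
      exact Real.enorm_of_nonneg (hk0 z y)
  obtain ⟨i1, l1⟩ := key (hpm (5 / 4)) (hp0 _) (hpW _ (by norm_num) le_rfl)
  obtain ⟨i2, l2⟩ := key (hpm (4 / 5)) (hp0 _) (hpW _ (by norm_num) (by norm_num))
  obtain ⟨i3, l3⟩ := key (hgm μ) (gIntegrand_nonneg hρ0) hgW
  obtain ⟨i4, l4⟩ := key (hgm 0) (gIntegrand_nonneg hρ0) hg0W
  have hmass : ∀ᵐ z : SpaceTime,
      ∫⁻ x, ENNReal.ofReal (ρ (x, z.2) ^ (3 / 2 : ℝ)) ≤ ENNReal.ofReal C :=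
    (Measure.quasiMeasurePreserving_snd (μ := (volume : Measure Space3))
      (ν := (volume : Measure ℝ))).ae hρ.mass_le
  refine ⟨?_, l1, l2, l3, l2NormLe_of_lintegral_sq_le (W := W) ?_ ?_ hWB'⟩
  · filter_upwards [i1, i2, i3, i4] with z a1 a2 a3 a4 using ⟨a1, a2, a3, a4⟩
  · have hGm : Measurable (gPotential 0 ρ) :=
      (hgm 0).stronglyMeasurable.integral_prod_right'.measurable
    refine Measurable.aestronglyMeasurable ?_
    unfold sigmaPotential
    fun_prop
  · filter_upwards [hmass, i4] with z hz hiz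
    have hs0 : 0 ≤ sigmaPotential μ ρ z := by
      have := gPotential_nonneg (μ := 0) hρ0 z
      unfold sigmaPotential
      positivity
    rw [Real.enorm_of_nonneg hs0]
    exact (h3 hρ z hz hiz).trans
      (mul_le_mul' le_add_self (add_le_add_left le_self_add _))

/-- The power `ρ ^ (3/2)` carries `κ⁶`, whereas the interaction estimate carries `κ⁴` at that point;
the surplus is at most `K²`. -/
lemma exists_isInteractingDensity {Ω : Set Space3} (hΩm : MeasurableSet Ω) {R : ℝ}
    (hR : 0 < R) (hΩR : Ω ⊆ Metric.ball 0 R) {α : ℝ} (hα : 0 < α) (hα2 : α < 4 / 3)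
    (T ν₁ ν₂ E S : ℝ) {F : ℝ} (hF : 0 ≤ F)
    {κ : SpaceTime → ℝ} (hκ : IsTestFunction (spaceTimeCylinder Ω T) κ) (hκ0 : ∀ z, 0 ≤ κ z) :
    ∃ C : ℝ, ∀ {m ε : ℝ}
    {f : SpaceTime → Space3} {dens : SpaceTime → ℝ} {u : SpaceTime → Space3}
    {Du : SpaceTime → Matrix (Fin 3) (Fin 3) ℝ},
    IsMeasurableFlow Ω T ν₁ ν₂ m ε E F S κ f dens u Du → 0 < ε →
      IsInteractingDensity R T C α (localDensity κ dens) := by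
  obtain ⟨C, hC, hint⟩ := exists_interaction_le hΩm hR hΩR hα hα2 T ν₁ ν₂ E S hF hκ hκ0
  obtain ⟨K, hK, hκK, -, -⟩ := hκ.exists_bound
  refine ⟨K ^ 6 * max E 0 + K ^ 2 * C, fun {m ε f dens u Du} h hε => ?_⟩
  have hκm : Measurable κ := hκ.1.continuous.measurable
  have hdm := h.measurable_dens
  have hd := h.dens_nonneg
  have hκK' : ∀ z, κ z ≤ K := fun z => (le_abs_self _).trans (hκK z)
  have hpow : ∀ z, localDensity κ dens z ^ (3 / 2 : ℝ) = κ z ^ 6 * dens z ^ (3 / 2 : ℝ) := by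
    intro z
    have h0 := hκ0 z
    rw [localDensity, Real.mul_rpow (by positivity) (hd z), ← Real.rpow_natCast,
      ← Real.rpow_mul h0, ← Real.rpow_natCast]
    norm_num
  have hzero : ∀ z, z ∉ spaceTimeCylinder Ω T → localDensity κ dens z = 0 := fun z hz => by
    simp [localDensity, hκ.eq_zero_of_notMem hz]
  refine ⟨by unfold localDensity; fun_prop,
    fun z => mul_nonneg (pow_nonneg (hκ0 z) 4) (hd z),
    fun z hz => hzero z fun hz2 => hz ⟨hΩR hz2.1, hz2.2⟩, ?_, ?_⟩
  · have hp := (ae_restrict_iff' measurableSet_Ioo).1 h.pressure_le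
    filter_upwards [hp] with t ht
    refine le_trans ?_ (ENNReal.ofReal_le_ofReal (le_add_of_nonneg_right (by positivity)))
    by_cases ht0 : t ∈ Ioo (0 : ℝ) T
    · have e : ∀ x, ENNReal.ofReal (localDensity κ dens (x, t) ^ (3 / 2 : ℝ))
          ≤ Ω.indicator (fun x => ENNReal.ofReal (K ^ 6)
            * ENNReal.ofReal (pressure m ε (dens (x, t)))) x := by
        intro x
        by_cases hx : x ∈ Ω
        · have h0 := hκ0 (x, t)
          have h1 := hκK' (x, t)
          have h2 := hd (x, t)
          rw [indicator_of_mem hx, hpow, ← ENNReal.ofReal_mul (by positivity)]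
          gcongr
          exact rpow_le_pressure hε h2
        · rw [hzero (x, t) fun hz => hx hz.1, Real.zero_rpow (by norm_num)]
          simp
      refine (lintegral_mono e).trans ?_
      rw [lintegral_indicator hΩm, lintegral_const_mul' _ _ ENNReal.ofReal_ne_top,
        ENNReal.ofReal_mul (by positivity)]
      gcongr
      exact (ht ht0).trans (ENNReal.ofReal_le_ofReal (le_max_left _ _))
    · have e : ∀ x, localDensity κ dens (x, t) = 0 := fun x => hzero _ fun hz => ht0 hz.2
      simp [e, Real.zero_rpow]
  · calc _ ≤ ∫⁻ t : ℝ, ∫⁻ x : Space3, ∫⁻ y : Space3, ENNReal.ofReal (K ^ 2) *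
          (ENNReal.ofReal (κ (x, t) ^ 4 * dens (x, t) ^ (3 / 2 : ℝ))
          * ENNReal.ofReal (κ (y, t) ^ 4 * dens (y, t))
          * ENNReal.ofReal (radialProfile α (‖x - y‖ ^ 2))) := by
          refine lintegral_mono fun t => lintegral_mono fun x => lintegral_mono fun y => ?_
          have h0 := hκ0 (x, t)
          have h1 := hκK' (x, t)
          have h2 := hd (x, t)
          rw [hpow, ← mul_assoc, ← mul_assoc, ← ENNReal.ofReal_mul (p := K ^ 2) (by positivity)]
          gcongr ENNReal.ofReal ?_ * ENNReal.ofReal ?_ * _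
          · calc κ (x, t) ^ 6 * dens (x, t) ^ (3 / 2 : ℝ)
                = κ (x, t) ^ 2 * (κ (x, t) ^ 4 * dens (x, t) ^ (3 / 2 : ℝ)) := by ring
              _ ≤ _ := by gcongr
          · exact le_rfl
      _ = ENNReal.ofReal (K ^ 2) * ∫⁻ t : ℝ, ∫⁻ x : Space3, ∫⁻ y : Space3,
          ENNReal.ofReal (κ (x, t) ^ 4 * dens (x, t) ^ (3 / 2 : ℝ))
          * ENNReal.ofReal (κ (y, t) ^ 4 * dens (y, t))
          * ENNReal.ofReal (radialProfile α (‖x - y‖ ^ 2)) := by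
          simp_rw [lintegral_const_mul' _ _ ENNReal.ofReal_ne_top]
      _ ≤ ENNReal.ofReal (K ^ 2) * ENNReal.ofReal C := by gcongr; exact hint h hε
      _ ≤ _ := by
          rw [← ENNReal.ofReal_mul (by positivity)]
          exact ENNReal.ofReal_le_ofReal (le_add_of_nonneg_left (by positivity))

lemma localDensity_ae_eq {Ω : Set Space3} (hΩ : IsOpen Ω) {T : ℝ} {κ dens dens' : SpaceTime → ℝ}
    (hκ : IsTestFunction (spaceTimeCylinder Ω T) κ)
    (h : dens =ᵐ[volume.restrict (spaceTimeCylinder Ω T)] dens') :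
    localDensity κ dens =ᵐ[volume] localDensity κ dens' := by
  have hcyl : MeasurableSet (spaceTimeCylinder Ω T) := hΩ.measurableSet.prod measurableSet_Ioo
  filter_upwards [(ae_restrict_iff' hcyl).1 h] with z hz
  by_cases hz2 : z ∈ spaceTimeCylinder Ω T
  · rw [localDensity, localDensity, hz hz2]
  · simp [localDensity, hκ.eq_zero_of_notMem hz2]
end

theorem proposition5p1
    (Ω : Set Space3) (hΩ : IsOpen Ω) (hΩb : Bornology.IsBounded Ω)
    (T : ℝ) (hT : 0 < T)
    (ν₁ ν₂ : ℝ) (hν₁ : 0 < ν₁) (hν : 0 ≤ ν₁ + ν₂)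
    (E Cf : ℝ)
    (κ : SpaceTime → ℝ) (hκ : IsTestFunction (spaceTimeCylinder Ω T) κ) (hκ0 : ∀ z, 0 ≤ κ z)
    (μ : ℝ) (hμ : μ ∈ Set.Ioo (0 : ℝ) (2 / 3)) :
    ∃ c : ℝ, 0 < c ∧
      ∀ (m ε : ℝ), 1 < m → 0 < ε →
      ∀ (f : SpaceTime → Space3) (dens : SpaceTime → ℝ) (u : SpaceTime → Space3)
        (Du : SpaceTime → Matrix (Fin 3) (Fin 3) ℝ),
        AEMeasurable f (volume.restrict (spaceTimeCylinder Ω T)) →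
        (∀ᵐ z ∂(volume.restrict (spaceTimeCylinder Ω T)), ‖f z‖ ≤ Cf) →
        IsEnergyWeakSolution Ω T ν₁ ν₂ m ε E f dens u Du →
        -- the integrals that define the potentials converge absolutely for a.e. `(x, t)`
        (∀ᵐ z : SpaceTime,
          Integrable (psiIntegrand (5 / 4) μ (localDensity κ dens) z) ∧
          Integrable (psiIntegrand (4 / 5) μ (localDensity κ dens) z) ∧
          Integrable (gIntegrand μ (localDensity κ dens) z) ∧
          Integrable (gIntegrand 0 (localDensity κ dens) z)) ∧
        L2NormLe (psiPotential (5 / 4) μ (localDensity κ dens)) c ∧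
        L2NormLe (psiPotential (4 / 5) μ (localDensity κ dens)) c ∧
        L2NormLe (gPotential μ (localDensity κ dens)) c ∧
        L2NormLe (sigmaPotential μ (localDensity κ dens)) c := by
  obtain ⟨R, hR, hΩR⟩ : ∃ R : ℝ, 0 < R ∧ Ω ⊆ Metric.ball 0 R := by
    obtain ⟨R, hR⟩ := hΩb.subset_ball_lt 0 0
    exact ⟨R, hR.1, hR.2⟩
  obtain ⟨hμ0, hμ2⟩ := hμ
  obtain ⟨S, hS⟩ := exists_isMeasurableFlow hΩ hκ hκ0 Cf
  -- Composing two kernels with logarithmic exponent `μ` produces the exponent `2μ`, and `2μ < 4/3`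
  -- is the admissible range of the test field.
  obtain ⟨C, hC⟩ := exists_isInteractingDensity hΩ.measurableSet hR hΩR (α := 2 * μ)
    (by linarith) (by linarith) T ν₁ ν₂ E S (le_max_right Cf 0) hκ hκ0
  obtain ⟨c, hc, hbound⟩ := exists_hasBoundedPotentials hR T C hμ0 (by linarith)
  refine ⟨c, hc, ?_⟩
  intro m ε _ hε f dens u Du hf hfb hsol
  obtain ⟨f', dens', u', Du', hflow, he⟩ := hS hf hfb hsol
  exact (hbound _ (hC hflow hε)).congr (localDensity_ae_eq hΩ hκ he)
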